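/- Let $p$ be a prime, $d\ge 1$ an integer, and $\psi:(\mathbb{Q}_p,+)\to\mathbb{C}_p^\times$ a non-trivial smooth character (a homomorphism with open kernel). Let $\mathcal{S}$ be the space of locally constant, compactly supported functions $\mathbb{Q}_p^d\to\mathbb{C}_p$. Let $\mathcal{H}$ be the Heisenberg group with underlying set $(\mathbb{Q}_p^d\oplus\mathbb{Q}_p^d)\times\mathbb{Q}_p$ and product $$[w_1,t_1][w_2,t_2]=[w_1+w_2,\;t_1+t_2+\tfrac12\omega(w_1,w_2)],\qquad \omega((a_1,b_1),(a_2,b_2))=a_1\cdot b_2-b_1\cdot a_2,$$ acting on $\mathcal{S}$ by the Schrödinger representation $$(\rho_\psi([(a,b),t])f)(x)=\psi\left(t+\tfrac12 a\cdot b+b\cdot x\right)f(x+a).$$ A norm on $\mathcal{S}$ is a map $\|\cdot\|:\mathcal{S}\to\mathbb{R}_{\ge0}$ that vanishes only at $0$ and satisfies $\|cf\|=|c|_p\|f\|$ for $c\in\mathbb{C}_p$ and $\|f+g\|\le\max(\|f\|,\|g\|)$; it is invariant if $\|\rho_\psi(h)f\|=\|f\|$ for all $h\in\mathcal{H}$ and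 $f\in\mathcal{S}$. We say that $\|\cdot\|_1$ is dominated by $\|\cdot\|_2$ if $\|\cdot\|_1\le D\|\cdot\|_2$ for some constant $D>0$, and that the two are equivalent if each is dominated by the other. For $g\in\mathrm{Sp}_{2d}(\mathbb{Q}_p)$ let $T_g$ be an invertible linear operator on $\mathcal{S}$ with $\rho_\psi([w,t])\circ T_g=T_g\circ\rho_\psi([wg,t])$ for all $[w,t]\in\mathcal{H}$ ($w$ being a row vector); it exists and is unique up to a non-zero scalar. Let $P\subset\mathrm{Sp}_{2d}(\mathbb{Q}_p)$ be the Siegel parabolic subgroup of matrices with vanishing lower left $d\times d$ block, and let $\mathrm{Gr}=P\backslash\mathrm{Sp}_{2d}(\mathbb{Q}_p)$. For $\alpha=Pg\in\mathrm{Gr}$ put $$\|f\|_\alpha=\frac{\|T_gf\|_\infty}{\|T_g\mathbf{1}_{\mathbb{Z}_p^d}\|_\infty},\qquad \|f\|_\infty=\sup_{x\in\mathbb{Q}_p^d}|f(x)|_p ,$$ an invariant norm that depends only on $\alpha$. For a finite subset $I\subset\mathrm{Gr}$ put $\|\cdot\|_I=\max_{\alpha\in I}\|\cdot\|_\alpha$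 (with $\|\cdot\|_\emptyset=0$; equivalence and domination are understood in the same way for $\|\cdot\|_\emptyset$). Then: 1. If $I,J\subset\mathrm{Gr}$ are distinct finite subsets, then $\|\cdot\|_I$ and $\|\cdot\|_J$ are not equivalent. 2. If $I\subset\mathrm{Gr}$ is finite and $\|\cdot\|$ is an invariant norm on $\mathcal{S}$ dominated by $\|\cdot\|_I$, then there is a unique subset $J\subset I$ such that $\|\cdot\|$ is equivalent to $\|\cdot\|_J$. 3. If $I_1,I_2\subset\mathrm{Gr}$ are finite and disjoint, then no invariant norm on $\mathcal{S}$ is dominated by both $\|\cdot\|_{I_1}$ and $\|\cdot\|_{I_2}$. -/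

import Mathlib

open scoped NNReal Matrix

noncomputable section

namespace PadicHeis

/-- A smooth character of `(ℚ_p, +)` with values in `ℂ_pˣ`: a homomorphism with open kernel. -/
structure SmoothCharacter (p : ℕ) [Fact p.Prime] where
  /-- the underlying homomorphism -/
  toAddChar : AddChar ℚ_[p] ℂ_[p]
  isOpen_ker : IsOpen {t : ℚ_[p] | toAddChar t = 1}

/-- The space `𝒮(ℚ_p^d)` of locally constant compactly supported functions `ℚ_p^d → ℂ_p`. -/
def Schwartz (p : ℕ) [Fact p.Prime] (d : ℕ) :
    Submodule ℂ_[p] ((Fin d → ℚ_[p]) → ℂ_[p]) where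
  carrier := {f | IsLocallyConstant f ∧ HasCompactSupport f}
  zero_mem' := ⟨IsLocallyConstant.const 0, HasCompactSupport.zero⟩
  add_mem' hf hg := ⟨hf.1.add hg.1, hf.2.add hg.2⟩
  smul_mem' c _ hf := ⟨hf.1.comp (fun z => c • z), hf.2.smul_left (f := fun _ => c)⟩

/-- The Heisenberg group `ℋ_{2d+1}(ℚ_p)`: pairs `[w, t]` with `w = (a, b) ∈ ℚ_p^d ⊕ ℚ_p^d`,
`t ∈ ℚ_p`. -/
@[ext]
structure Heisenberg (p : ℕ) [Fact p.Prime] (d : ℕ) where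
  /-- the component in the symplectic space -/
  w : Fin d ⊕ Fin d → ℚ_[p]
  /-- the central component -/
  t : ℚ_[p]

variable {p : ℕ} [Fact p.Prime] {d : ℕ}

/-- The first component `a ∈ ℚ_p^d` of `w = (a, b)`. -/
def fstPart (w : Fin d ⊕ Fin d → ℚ_[p]) : Fin d → ℚ_[p] := fun i => w (Sum.inl i)

/-- The second component `b ∈ ℚ_p^d` of `w = (a, b)`. -/
def sndPart (w : Fin d ⊕ Fin d → ℚ_[p]) : Fin d → ℚ_[p] := fun i => w (Sum.inr i)

/-- The symplectic form `ω((a₁, b₁), (a₂, b₂)) = a₁ ⬝ b₂ - b₁ ⬝ a₂`. -/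
def omega (w₁ w₂ : Fin d ⊕ Fin d → ℚ_[p]) : ℚ_[p] :=
  fstPart w₁ ⬝ᵥ sndPart w₂ - sndPart w₁ ⬝ᵥ fstPart w₂

@[simp] theorem fstPart_add (w₁ w₂ : Fin d ⊕ Fin d → ℚ_[p]) :
    fstPart (w₁ + w₂) = fstPart w₁ + fstPart w₂ := rfl
@[simp] theorem sndPart_add (w₁ w₂ : Fin d ⊕ Fin d → ℚ_[p]) :
    sndPart (w₁ + w₂) = sndPart w₁ + sndPart w₂ := rfl
@[simp] theorem fstPart_zero : fstPart (0 : Fin d ⊕ Fin d → ℚ_[p]) = 0 := rfl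
@[simp] theorem sndPart_zero : sndPart (0 : Fin d ⊕ Fin d → ℚ_[p]) = 0 := rfl
@[simp] theorem fstPart_neg (w : Fin d ⊕ Fin d → ℚ_[p]) : fstPart (-w) = -fstPart w := rfl
@[simp] theorem sndPart_neg (w : Fin d ⊕ Fin d → ℚ_[p]) : sndPart (-w) = -sndPart w := rfl

namespace Heisenberg

instance : Mul (Heisenberg p d) := ⟨fun h k => ⟨h.w + k.w, h.t + k.t + 1 / 2 * omega h.w k.w⟩⟩
instance : One (Heisenberg p d) := ⟨⟨0, 0⟩⟩
instance : Inv (Heisenberg p d) := ⟨fun h => ⟨-h.w, -h.t⟩⟩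

@[simp] theorem mul_w (h k : Heisenberg p d) : (h * k).w = h.w + k.w := rfl
@[simp] theorem mul_t (h k : Heisenberg p d) :
    (h * k).t = h.t + k.t + 1 / 2 * omega h.w k.w := rfl
@[simp] theorem one_w : (1 : Heisenberg p d).w = 0 := rfl
@[simp] theorem one_t : (1 : Heisenberg p d).t = 0 := rfl
@[simp] theorem inv_w (h : Heisenberg p d) : h⁻¹.w = -h.w := rfl
@[simp] theorem inv_t (h : Heisenberg p d) : h⁻¹.t = -h.t := rfl

instance : Group (Heisenberg p d) :=
  Group.ofLeftAxioms
    (fun h k l => by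
      ext1
      · simp [add_assoc]
      · simp only [mul_t, mul_w, omega, fstPart_add, sndPart_add, add_dotProduct,
          dotProduct_add]
        ring)
    (fun h => by ext1 <;> simp [omega])
    (fun h => by
      ext1
      · simp
      · simp [omega, dotProduct_comm (fstPart h.w) (sndPart h.w)])

/-- The right action `[w, t] · g = [w g, t]` of a matrix, with `w` a row vector. -/
def act (h : Heisenberg p d) (g : Matrix (Fin d ⊕ Fin d) (Fin d ⊕ Fin d) ℚ_[p]) :
    Heisenberg p d :=
  ⟨h.w ᵥ* g, h.t⟩

end Heisenberg

theorem SmoothCharacter.isLocallyConstant (ψ : SmoothCharacter p) :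
    IsLocallyConstant (fun t => ψ.toAddChar t) := by
  rw [IsLocallyConstant.iff_exists_open]
  intro x
  refine ⟨(fun y => y - x) ⁻¹' {t | ψ.toAddChar t = 1},
    ψ.isOpen_ker.preimage (continuous_id.sub continuous_const), by simp, ?_⟩
  intro y hy
  have hy' : ψ.toAddChar (y - x) = 1 := hy
  calc ψ.toAddChar y = ψ.toAddChar ((y - x) + x) := by rw [sub_add_cancel]
    _ = ψ.toAddChar x := by rw [AddChar.map_add_eq_mul, hy', one_mul]

/-- The value at `x` of `ρ_ψ([w, t]) f`, for `w = (a, b)`: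
`ψ(t + a ⬝ b / 2 + b ⬝ x) f(x + a)`. -/
def schrodingerFun (ψ : SmoothCharacter p) (h : Heisenberg p d)
    (f : (Fin d → ℚ_[p]) → ℂ_[p]) : (Fin d → ℚ_[p]) → ℂ_[p] := fun x =>
  ψ.toAddChar (h.t + 1 / 2 * (fstPart h.w ⬝ᵥ sndPart h.w) + sndPart h.w ⬝ᵥ x)
    * f (x + fstPart h.w)

theorem schrodingerFun_mem (ψ : SmoothCharacter p) (h : Heisenberg p d)
    {f : (Fin d → ℚ_[p]) → ℂ_[p]} (hf : f ∈ Schwartz p d) :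
    schrodingerFun ψ h f ∈ Schwartz p d := by
  refine ⟨?_, ?_⟩
  · refine IsLocallyConstant.mul ?_ ?_
    · refine ψ.isLocallyConstant.comp_continuous
        (f := fun x : Fin d → ℚ_[p] =>
          h.t + 1 / 2 * (fstPart h.w ⬝ᵥ sndPart h.w) + sndPart h.w ⬝ᵥ x) ?_
      exact continuous_const.add (Continuous.dotProduct continuous_const continuous_id)
    · exact hf.1.comp_continuous (f := fun x : Fin d → ℚ_[p] => x + fstPart h.w)
        (continuous_id.add continuous_const)
  · exact HasCompactSupport.mul_left
      (hf.2.comp_homeomorph (Homeomorph.addRight (fstPart h.w)))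

/-- The Schrödinger representation `ρ_ψ` of the Heisenberg group on `𝒮(ℚ_p^d)`. -/
def schrodinger (ψ : SmoothCharacter p) (d : ℕ) :
    Representation ℂ_[p] (Heisenberg p d) (Schwartz p d) where
  toFun h :=
    { toFun := fun f => ⟨schrodingerFun ψ h f, schrodingerFun_mem ψ h f.2⟩
      map_add' := fun f g => by
        ext x
        exact mul_add _ _ _
      map_smul' := fun c f => by
        ext x
        exact mul_left_comm _ _ _ }
  map_one' := by
    ext f x
    simp [schrodingerFun]
  map_mul' h k := by
    ext f x
    simp only [schrodingerFun, LinearMap.coe_mk, AddHom.coe_mk, Module.End.mul_apply]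
    rw [← mul_assoc, ← AddChar.map_add_eq_mul]
    congr 2
    · simp only [Heisenberg.mul_t, Heisenberg.mul_w, omega, fstPart_add, sndPart_add,
        add_dotProduct, dotProduct_add, dotProduct_comm (fstPart k.w) (sndPart h.w),
        dotProduct_comm (fstPart h.w) (sndPart k.w)]
      ring
    · simp [add_assoc]

/-- `T` is an intertwining operator for `g`:
`ρ_ψ([w, t]) ∘ T = T ∘ ρ_ψ([w g, t])` for all `[w, t]`. -/
def IsIntertwining (ψ : SmoothCharacter p) (g : Matrix.symplecticGroup (Fin d) ℚ_[p])
    (T : Schwartz p d ≃ₗ[ℂ_[p]] Schwartz p d) : Prop :=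
  ∀ (h : Heisenberg p d) (f : Schwartz p d),
    schrodinger ψ d h (T f) = T (schrodinger ψ d (h.act g.1) f)

/-- A chosen intertwining operator `T_g`. For nontrivial `ψ` one exists and it is unique up to a
nonzero scalar (smooth Stone-von Neumann theorem and Schur's lemma). -/
def intertwiner (ψ : SmoothCharacter p) (g : Matrix.symplecticGroup (Fin d) ℚ_[p]) :
    Schwartz p d ≃ₗ[ℂ_[p]] Schwartz p d :=
  Classical.epsilon (IsIntertwining ψ g)

theorem bddAbove_norm (f : Schwartz p d) : BddAbove (Set.range fun x => ‖f.1 x‖) := by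
  have h : Continuous f.1 := f.2.1.continuous
  exact h.norm.bddAbove_range_of_hasCompactSupport f.2.2.norm

/-- The sup norm on `𝒮(ℚ_p^d)`. -/
def supNorm (p : ℕ) [Fact p.Prime] (d : ℕ) : Seminorm ℂ_[p] (Schwartz p d) :=
  Seminorm.of (fun f => ⨆ x, ‖f.1 x‖)
    (fun f g => ciSup_le fun x => (norm_add_le (f.1 x) (g.1 x)).trans
      (add_le_add (le_ciSup (bddAbove_norm f) x) (le_ciSup (bddAbove_norm g) x)))
    (fun c f => by
      change ⨆ x, ‖c * f.1 x‖ = _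
      simp only [norm_mul]
      exact (Real.mul_iSup_of_nonneg (norm_nonneg c) _).symm)

theorem isCompact_intBall (p : ℕ) [Fact p.Prime] (d : ℕ) :
    IsCompact {x : Fin d → ℚ_[p] | ∀ i, ‖x i‖ ≤ 1} := by
  have h : {x : Fin d → ℚ_[p] | ∀ i, ‖x i‖ ≤ 1}
      = Set.pi Set.univ fun _ => Metric.closedBall (0 : ℚ_[p]) 1 := by
    ext x; simp
  rw [h]
  exact isCompact_univ_pi fun _ => isCompact_closedBall _ _

theorem isOpen_intBall (p : ℕ) [Fact p.Prime] (d : ℕ) :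
    IsOpen {x : Fin d → ℚ_[p] | ∀ i, ‖x i‖ ≤ 1} := by
  have h : {x : Fin d → ℚ_[p] | ∀ i, ‖x i‖ ≤ 1}
      = Set.pi Set.univ fun _ => Metric.closedBall (0 : ℚ_[p]) 1 := by
    ext x; simp
  rw [h]
  exact isOpen_set_pi Set.finite_univ
    fun _ _ => IsUltrametricDist.isOpen_closedBall _ one_ne_zero

/-- The characteristic function `𝟏_{ℤ_p^d}`. -/
def intIndicator (p : ℕ) [Fact p.Prime] (d : ℕ) : Schwartz p d :=
  ⟨Set.indicator {x | ∀ i, ‖x i‖ ≤ 1} 1, by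
    refine ⟨?_, ?_⟩
    · rw [← LocallyConstant.coe_charFn ℂ_[p]
        ⟨(isCompact_intBall p d).isClosed, isOpen_intBall p d⟩]
      exact LocallyConstant.isLocallyConstant _
    · exact HasCompactSupport.intro (isCompact_intBall p d)
        fun x hx => Set.indicator_of_notMem hx _⟩

/-- The Siegel parabolic: symplectic matrices whose lower left `d × d` block vanishes. -/
def siegelParabolic (p : ℕ) [Fact p.Prime] (d : ℕ) :
    Subgroup (Matrix.symplecticGroup (Fin d) ℚ_[p]) where
  carrier := {g | g.1.toBlocks₂₁ = 0}
  one_mem' := by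
    ext i j
    simp [Matrix.toBlocks₂₁]
  mul_mem' {g h} hg hh := by
    have hg' : g.1.toBlocks₂₁ = 0 := hg
    have hh' : h.1.toBlocks₂₁ = 0 := hh
    change (g.1 * h.1).toBlocks₂₁ = 0
    rw [← Matrix.fromBlocks_toBlocks g.1, ← Matrix.fromBlocks_toBlocks h.1,
      Matrix.fromBlocks_multiply, Matrix.toBlocks_fromBlocks₂₁, hg', hh']
    simp
  inv_mem' {g} hg := by
    have hg' : g.1.toBlocks₂₁ = 0 := hg
    change (g⁻¹).1.toBlocks₂₁ = 0
    rw [SymplecticGroup.coe_inv, ← Matrix.fromBlocks_toBlocks g.1, hg', Matrix.J,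
      Matrix.fromBlocks_transpose, Matrix.fromBlocks_neg, Matrix.fromBlocks_multiply,
      Matrix.fromBlocks_multiply, Matrix.toBlocks_fromBlocks₂₁]
    simp

/-- The Grassmannian `P \ Sp_{2d}(ℚ_p)` of right cosets `P g` of the Siegel parabolic `P`. -/
def Grassmannian (p : ℕ) [Fact p.Prime] (d : ℕ) : Type :=
  Quotient (QuotientGroup.rightRel (siegelParabolic p d))

/-- The norm `‖T_g(·)‖_∞`, rescaled to take the value `1` at `𝟏_{ℤ_p^d}`. -/
def symplecticNorm (ψ : SmoothCharacter p) (g : Matrix.symplecticGroup (Fin d) ℚ_[p]) :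
    Seminorm ℂ_[p] (Schwartz p d) :=
  (Real.toNNReal (supNorm p d (intertwiner ψ g (intIndicator p d))))⁻¹ •
    (supNorm p d).comp (intertwiner ψ g).toLinearMap

/-- The norm `‖·‖_α` for `α = P g`; since `‖·‖_∞` and `‖T_q(·)‖_∞` are homothetic for
`q ∈ P`, it does not depend on the representative `g` of `α`. -/
def grassmannianNorm (ψ : SmoothCharacter p) (α : Grassmannian p d) :
    Seminorm ℂ_[p] (Schwartz p d) :=
  symplecticNorm ψ (Quotient.out α)

/-- `‖·‖_I = max_{α ∈ I} ‖·‖_α` for a finite set `I`; it is `0` for `I = ∅`. -/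
def maxNorm (ψ : SmoothCharacter p) (I : Finset (Grassmannian p d)) :
    Seminorm ℂ_[p] (Schwartz p d) :=
  I.sup (grassmannianNorm ψ)

/-- `N` is a (non-archimedean) norm on `𝒮(ℚ_p^d)` invariant under the Heisenberg group. -/
structure IsInvariantNorm (ψ : SmoothCharacter p) (N : Seminorm ℂ_[p] (Schwartz p d)) :
    Prop where
  eq_zero : ∀ f, N f = 0 → f = 0
  add_le_max : ∀ f g, N (f + g) ≤ max (N f) (N g)
  invariant : ∀ (h : Heisenberg p d) (f : Schwartz p d), N (schrodinger ψ d h f) = N f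

/-- `N₁` is dominated by `N₂`. -/
def Dominated (N₁ N₂ : Seminorm ℂ_[p] (Schwartz p d)) : Prop :=
  ∃ D : ℝ, 0 < D ∧ ∀ f, N₁ f ≤ D * N₂ f

/-- `N₁` and `N₂` are equivalent: each is dominated by the other. -/
def Equivalent (N₁ N₂ : Seminorm ℂ_[p] (Schwartz p d)) : Prop :=
  Dominated N₁ N₂ ∧ Dominated N₂ N₁

end PadicHeis

end

open PadicHeis

/-! Integral combinations of Heisenberg operators (`heisenbergRing`) do not increase any invariant
ultrametric seminorm (`IsInvariantUltrametric.apply_le`). Comparing norms therefore amounts to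
producing good operators in this ring, and two kinds suffice.

Transitivity with a uniform loss (`exists_mem_heisenbergRing_near`): from `f` one reaches, up to an
arbitrarily small sup-norm error, `f(x₀) p^(2d) g` for every `g` with values in the unit ball. The
factor `p^(2d)` does not depend on `f`, `g` or the error. Averaging characters would give indicators
of small balls only with a factor that tends to 0 with the radius. Instead, an integral polynomial
in a single root of unity approximates `p²` times an indicator up to `p^(-3)`
(`exists_polynomial_near_indicator`), and the gap between `p^(-2)` and `p^(-3)` allows the error to
be corrected repeatedly.

Separation (`exists_le_supNorm_and_supNorm_le`): for `g ∉ P` some operator does not decrease `‖f‖_∞`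
but makes `‖T_g f‖_∞` arbitrarily small. It is a monic polynomial in a Heisenberg element that is a
modulation on one side and a nontrivial translation, up to a phase, on the other.

Suppose `‖·‖_α` is not dominated by an invariant `N`. Choose `f` with `N f` tiny compared to
`‖f‖_α`; separation makes the other `‖f‖_β` tiny too, and transitivity carries `f` close to any
prescribed function for `‖·‖_α`. So every function is `‖·‖_α`-close to one that is negligible for
`N` and the other `‖·‖_β`, and `α` can be dropped from any `I` that dominates `N`
(`dominated_maxNorm_erase`). Dropping indices until all the remaining ones are dominated by `N`
gives `J`. Separation alone gives nonequivalence and uniqueness. For disjoint `I₁`, `I₂` the common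
`J` is empty, which forces `N = 0`.

Since `T_g` is defined by choice, its existence for every symplectic `g` is also needed
(`intertwinableSubgroup_eq_top`). It follows from irreducibility, invariant functionals and
generation of the symplectic group. -/

namespace PadicHeis

/-! ### Distances between roots of unity of p-power order -/

section RootsOfUnity

open Polynomial

variable {p : ℕ} [hp : Fact p.Prime] {K : Type*} [NormedField K]

theorem norm_eq_one_of_isPrimitiveRoot {ζ : K} {n : ℕ} [NeZero n] (h : IsPrimitiveRoot ζ n) :
    ‖ζ‖ = 1 :=
  (pow_eq_one_iff_of_nonneg (norm_nonneg _) (NeZero.ne n)).1 (by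
    rw [← norm_pow, h.pow_eq_one, norm_one])

variable [IsUltrametricDist K]

theorem norm_sum_le_of_forall {ι : Type*} (s : Finset ι) (f : ι → K) {C : ℝ} (hC : 0 ≤ C)
    (h : ∀ i ∈ s, ‖f i‖ ≤ C) : ‖∑ i ∈ s, f i‖ ≤ C :=
  IsUltrametricDist.norm_sum_le_of_forall_le_of_nonneg hC h

theorem norm_add_le_of_le_of_le {E : Type*} [SeminormedAddCommGroup E] [IsUltrametricDist E]
    {x y : E} {C : ℝ} (hx : ‖x‖ ≤ C) (hy : ‖y‖ ≤ C) : ‖x + y‖ ≤ C :=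
  (IsUltrametricDist.norm_add_le_max x y).trans (max_le hx hy)

theorem norm_sub_le_of_le_of_le {E : Type*} [SeminormedAddCommGroup E] [IsUltrametricDist E]
    {x y : E} {C : ℝ} (hx : ‖x‖ ≤ C) (hy : ‖y‖ ≤ C) : ‖x - y‖ ≤ C := by
  rw [sub_eq_add_neg]
  exact norm_add_le_of_le_of_le hx (by rwa [norm_neg])

theorem norm_pow_sub_one_le {z : K} (hz : ‖z‖ ≤ 1) (i : ℕ) : ‖z ^ i - 1‖ ≤ ‖z - 1‖ := by
  rw [← mul_geom_sum, norm_mul]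
  refine mul_le_of_le_one_right (norm_nonneg _) (norm_sum_le_of_forall _ _ zero_le_one ?_)
  intro j _
  rw [norm_pow]
  exact pow_le_one₀ (norm_nonneg _) hz

/-- Each of the two roots is a power of the other, and `z ^ i - 1` is an integral multiple of `z -
1`. -/
theorem norm_sub_one_eq_of_isPrimitiveRoot {η μ : K} {n : ℕ} [NeZero n]
    (hη : IsPrimitiveRoot η n) (hμ : IsPrimitiveRoot μ n) : ‖μ - 1‖ = ‖η - 1‖ := by
  have key : ∀ {a b : K}, IsPrimitiveRoot a n → IsPrimitiveRoot b n → ‖b - 1‖ ≤ ‖a - 1‖ := by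
    intro a b ha hb
    obtain ⟨i, -, hi⟩ := ha.eq_pow_of_pow_eq_one hb.pow_eq_one
    rw [← hi]
    exact norm_pow_sub_one_le (norm_eq_one_of_isPrimitiveRoot ha).le i
  exact le_antisymm (key hη hμ) (key hμ hη)

/-- The cyclotomic polynomial of order `p ^ k` takes the value `p` at 1, and its linear factors
there all have the same norm. -/
theorem norm_sub_one_pow_totient (hpK : ‖(p : K)‖ = (p : ℝ)⁻¹) {η : K} {k : ℕ} (hk : k ≠ 0)
    (hη : IsPrimitiveRoot η (p ^ k)) : ‖η - 1‖ ^ (p ^ k).totient = (p : ℝ)⁻¹ := by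
  obtain ⟨k, rfl⟩ := Nat.exists_eq_succ_of_ne_zero hk
  have : NeZero (p ^ (k + 1)) := ⟨pow_ne_zero _ hp.out.ne_zero⟩
  have h1 := congrArg (Polynomial.eval 1) (cyclotomic_eq_prod_X_sub_primitiveRoots hη)
  rw [Nat.succ_eq_add_one, eval_one_cyclotomic_prime_pow, eval_prod] at h1
  rw [← hpK, h1, norm_prod, Finset.prod_congr rfl (g := fun _ => ‖η - 1‖), Finset.prod_const,
    hη.card_primitiveRoots]
  intro μ hμ
  rw [eval_sub, eval_X, eval_C, norm_sub_rev]
  exact norm_sub_one_eq_of_isPrimitiveRoot hη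
    ((mem_primitiveRoots (NeZero.pos _)).1 hμ)

theorem norm_sub_one_le_one {ζ : K} (h : ‖ζ‖ ≤ 1) : ‖ζ - 1‖ ≤ 1 :=
  norm_sub_le_of_le_of_le h norm_one.le

/-- The power is a primitive root of order `p ^ (k - j)`, and `φ(p^k) = p^j φ(p^(k-j))`, so raising
both sides to the power `φ(p^(k-j))` gives `1/p`. -/
theorem norm_pow_sub_one_eq (hpK : ‖(p : K)‖ = (p : ℝ)⁻¹) {ζ : K} {k : ℕ}
    (hζ : IsPrimitiveRoot ζ (p ^ k)) {j a : ℕ} (hj : j < k) (ha : ¬ p ∣ a) :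
    ‖ζ ^ (p ^ j * a) - 1‖ = ‖ζ - 1‖ ^ p ^ j := by
  have hp0 := hp.out.pos
  have h1 : IsPrimitiveRoot (ζ ^ p ^ j) (p ^ (k - j)) := by
    refine hζ.pow (pow_pos hp0 _) ?_
    rw [← pow_add, Nat.add_sub_cancel' hj.le]
  have h2 : IsPrimitiveRoot (ζ ^ (p ^ j * a)) (p ^ (k - j)) := by
    rw [pow_mul]
    exact h1.pow_of_coprime _ (((Nat.Prime.coprime_iff_not_dvd hp.out).2 ha).symm.pow_right _)
  have h3 := norm_sub_one_pow_totient hpK (Nat.sub_ne_zero_of_lt hj) h2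
  have h4 := norm_sub_one_pow_totient hpK (by omega) hζ
  have h5 : (p ^ k).totient = p ^ j * (p ^ (k - j)).totient := by
    rw [Nat.totient_prime_pow hp.out (by omega), Nat.totient_prime_pow hp.out (by omega),
      ← mul_assoc, ← pow_add]
    congr 2
    omega
  rw [h5, pow_mul, ← h3] at h4
  exact (pow_left_injective₀ h4.symm)
where pow_left_injective₀ {x y : ℝ} (h : x ^ (p ^ (k - j)).totient = y ^ (p ^ (k - j)).totient)
    (hx : 0 ≤ x := by positivity) (hy : 0 ≤ y := by positivity) : x = y :=
  (pow_left_inj₀ hx hy (Nat.totient_pos.2 (pow_pos hp.out.pos _)).ne').1 h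

theorem norm_pow_sub_pow_le (hpK : ‖(p : K)‖ = (p : ℝ)⁻¹) {ζ : K} {k : ℕ}
    (hζ : IsPrimitiveRoot ζ (p ^ k)) {j x u : ℕ} (hj : j < k) (hxu : x ≡ u [MOD p ^ j]) :
    ‖ζ ^ x - ζ ^ u‖ ≤ ‖ζ - 1‖ ^ p ^ j := by
  have : NeZero (p ^ k) := ⟨pow_ne_zero _ hp.out.ne_zero⟩
  have hζ1 := norm_eq_one_of_isPrimitiveRoot hζ
  have key : ∀ a : ℕ, p ^ j ∣ a → ‖ζ ^ a - 1‖ ≤ ‖ζ - 1‖ ^ p ^ j := by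
    rintro a ⟨b, rfl⟩
    rw [pow_mul]
    refine (norm_pow_sub_one_le (by rw [norm_pow, hζ1, one_pow]) b).trans ?_
    have := norm_pow_sub_one_eq hpK hζ hj (Nat.Prime.one_lt hp.out |> Nat.not_dvd_of_pos_of_lt one_pos)
    rw [mul_one] at this
    exact this.le
  wlog h : u ≤ x generalizing x u
  · rw [norm_sub_rev]
    exact this hxu.symm (by omega)
  have h1 : ζ ^ x - ζ ^ u = ζ ^ u * (ζ ^ (x - u) - 1) := by
    rw [mul_sub, ← pow_add, Nat.add_sub_cancel' h, mul_one]
  rw [h1, norm_mul, norm_pow, hζ1, one_pow, one_mul]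
  exact key _ ((Nat.modEq_iff_dvd' h).1 hxu.symm)

theorem card_filter_modEq {M n : ℕ} (hn : n ≤ M) (x : ℕ) :
    ((Finset.range (p ^ M)).filter fun u => u ≡ x [MOD p ^ n]).card = p ^ (M - n) := by
  rw [← Nat.count_eq_card_filter_range, Nat.count_modEq_card _ (pow_pos hp.out.pos _),
    Nat.pow_div hn hp.out.pos, if_neg, add_zero]
  rw [Nat.mod_eq_zero_of_dvd (pow_dvd_pow p hn)]
  exact not_lt_zero

theorem totient_prime_pow_eq_sub {m : ℕ} (hm : m ≠ 0) :
    (p ^ m).totient = p ^ m - p ^ (m - 1) := by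
  rw [Nat.totient_prime_pow hp.out (Nat.pos_of_ne_zero hm), Nat.mul_sub, mul_one, ← pow_succ]
  congr 2
  omega

theorem prime_pow_mul_totient {n M : ℕ} (h : n < M) :
    p ^ n * (p ^ (M - n)).totient = (p ^ M).totient := by
  rw [Nat.totient_prime_pow hp.out (by omega), Nat.totient_prime_pow hp.out (by omega),
    ← mul_assoc, ← pow_add]
  congr 2
  omega

/-- The product of the distances from `ζ ^ x` to the points `ζ ^ u` with `u` in a box, `u`
congruent to `x`, is small. -/
theorem prod_norm_pow_sub_pow_le (hpK : ‖(p : K)‖ = (p : ℝ)⁻¹) {ζ : K} {k : ℕ}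
    (hζ : IsPrimitiveRoot ζ (p ^ k)) {n M : ℕ} (hn : n ≤ M) (hM : M < k) (x : ℕ) :
    ∏ u ∈ (Finset.range (p ^ M)).filter (fun u => u ≡ x [MOD p ^ n]), ‖ζ ^ x - ζ ^ u‖ ≤
      (‖ζ - 1‖ ^ (p ^ M).totient) ^ (M - n) := by
  have : NeZero (p ^ k) := ⟨pow_ne_zero _ hp.out.ne_zero⟩
  have hζ1 := norm_eq_one_of_isPrimitiveRoot hζ
  induction hn using Nat.decreasingInduction with
  | self =>
    rw [Nat.sub_self, pow_zero]
    refine Finset.prod_le_one (fun _ _ => norm_nonneg _) fun u _ => ?_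
    exact norm_sub_le_of_le_of_le (by simp [hζ1]) (by simp [hζ1])
  | of_succ n hn ih =>
    have hsub : (Finset.range (p ^ M)).filter (fun u => u ≡ x [MOD p ^ (n + 1)]) ⊆
        (Finset.range (p ^ M)).filter (fun u => u ≡ x [MOD p ^ n]) := by
      intro u hu
      rw [Finset.mem_filter] at hu ⊢
      exact ⟨hu.1, hu.2.of_dvd (pow_dvd_pow p n.le_succ)⟩
    -- The shell of `u` congruent to `x` modulo `p^n` but not modulo `p^(n+1)` has `φ(p^(M-n))`
    -- elements, each at distance at most `‖ζ - 1‖ ^ p^n`. As `p^n φ(p^(M-n)) = φ(p^M)`, every shell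
    -- contributes the same factor.
    rw [← Finset.prod_sdiff hsub, show M - n = (M - (n + 1)) + 1 by omega, pow_succ, mul_comm]
    refine mul_le_mul ih ?_ (Finset.prod_nonneg fun _ _ => norm_nonneg _)
      (pow_nonneg (pow_nonneg (norm_nonneg _) _) _)
    calc _ ≤ ∏ u ∈ (Finset.range (p ^ M)).filter (fun u => u ≡ x [MOD p ^ n]) \
            (Finset.range (p ^ M)).filter (fun u => u ≡ x [MOD p ^ (n + 1)]), ‖ζ - 1‖ ^ p ^ n := by
          refine Finset.prod_le_prod (fun _ _ => norm_nonneg _) fun u hu => ?_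
          rw [Finset.mem_sdiff, Finset.mem_filter] at hu
          exact norm_pow_sub_pow_le hpK hζ (by omega) hu.1.2.symm
      _ = _ := by
          rw [Finset.prod_const, Finset.card_sdiff_of_subset hsub, card_filter_modEq hn.le,
            card_filter_modEq hn, ← pow_mul, ← prime_pow_mul_totient (p := p) hn,
            totient_prime_pow_eq_sub (p := p) (m := M - n) (by omega), Nat.sub_sub]

/-- The same shell count, centred at 1 and over the outer `n` shells. The distances are now known
exactly, which supplies the lower bound needed for normalisation. -/
theorem prod_norm_one_sub_pow (hpK : ‖(p : K)‖ = (p : ℝ)⁻¹) {ζ : K} {k : ℕ}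
    (hζ : IsPrimitiveRoot ζ (p ^ k)) {n M : ℕ} (hn : n ≤ M) (hM : M < k) :
    ∏ u ∈ (Finset.range (p ^ M)).filter (fun u => ¬ p ^ n ∣ u), ‖1 - ζ ^ u‖ =
      (‖ζ - 1‖ ^ (p ^ M).totient) ^ n := by
  induction n with
  | zero => simp
  | succ n ih =>
    have hsub : (Finset.range (p ^ M)).filter (fun u => ¬ p ^ n ∣ u) ⊆
        (Finset.range (p ^ M)).filter (fun u => ¬ p ^ (n + 1) ∣ u) := by
      intro u hu
      rw [Finset.mem_filter] at hu ⊢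
      exact ⟨hu.1, fun h => hu.2 ((pow_dvd_pow p n.le_succ).trans h)⟩
    rw [← Finset.prod_sdiff hsub, ih (by omega), pow_succ (_ ^ _ : ℝ), mul_comm]
    congr 1
    have hset : (Finset.range (p ^ M)).filter (fun u => ¬ p ^ (n + 1) ∣ u) \
        (Finset.range (p ^ M)).filter (fun u => ¬ p ^ n ∣ u) =
        (Finset.range (p ^ M)).filter (fun u => u ≡ 0 [MOD p ^ n]) \
            (Finset.range (p ^ M)).filter (fun u => u ≡ 0 [MOD p ^ (n + 1)]) := by
      ext u
      simp only [Finset.mem_sdiff, Finset.mem_filter, Nat.modEq_zero_iff_dvd]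
      tauto
    have hsub' : (Finset.range (p ^ M)).filter (fun u => u ≡ 0 [MOD p ^ (n + 1)]) ⊆
        (Finset.range (p ^ M)).filter (fun u => u ≡ 0 [MOD p ^ n]) := by
      intro u hu
      rw [Finset.mem_filter] at hu ⊢
      exact ⟨hu.1, hu.2.of_dvd (pow_dvd_pow p n.le_succ)⟩
    rw [hset, Finset.prod_congr rfl (g := fun _ => ‖ζ - 1‖ ^ p ^ n), Finset.prod_const,
      Finset.card_sdiff_of_subset hsub', card_filter_modEq (by omega), card_filter_modEq hn,
      ← pow_mul, ← prime_pow_mul_totient (p := p) (M := M) (n := n) (by omega),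
      totient_prime_pow_eq_sub (p := p) (m := M - n) (by omega), Nat.sub_sub]
    intro u hu
    simp only [Finset.mem_sdiff, Finset.mem_filter, Nat.modEq_zero_iff_dvd, not_and] at hu
    obtain ⟨⟨hu1, ⟨v, rfl⟩⟩, hu2⟩ := hu
    rw [norm_sub_rev]
    refine norm_pow_sub_one_eq hpK hζ (by omega) fun h => hu2 hu1 ?_
    rw [pow_succ]
    exact mul_dvd_mul_left _ h

end RootsOfUnity

/-! ### Integral polynomials approximating an indicator on roots of unity -/

section PolynomialApproximation

open Polynomial

/-- A polynomial with constant coefficient `1` is invertible modulo `X ^ L`. -/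
theorem exists_mul_eq_one_add_X_pow_mul {R : Type*} [CommRing R] [Nontrivial R] (A : R[X])
    (hA : A.coeff 0 = 1) (L : ℕ) : ∃ Q S : R[X], Q.degree < L ∧ A * Q = 1 + X ^ L * S := by
  have h1 : IsCoprime A (X ^ L) := by
    refine IsCoprime.pow_right ⟨1, -A.divX, ?_⟩
    have := A.divX_mul_X_add
    rw [hA, C_1] at this
    linear_combination -this
  obtain ⟨a, b, hab⟩ := h1
  refine ⟨a %ₘ X ^ L, -(b + A * (a /ₘ X ^ L)), ?_, ?_⟩
  · simpa using degree_modByMonic_lt a (monic_X_pow (R := R) L)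
  · have := modByMonic_add_div a (X ^ L)
    linear_combination A * this + hab

variable (K : Type*) [NormedField K] [IsUltrametricDist K]

/-- The closed unit ball of an ultrametric field, as a subring. -/
def unitBallSubring : Subring K where
  carrier := {x | ‖x‖ ≤ 1}
  mul_mem' hx hy := (norm_mul_le _ _).trans (mul_le_one₀ hx (norm_nonneg _) hy)
  one_mem' := norm_one.le
  add_mem' hx hy := norm_add_le_of_le_of_le hx hy
  zero_mem' := by simp
  neg_mem' hx := by simpa using hx

variable {K}

theorem mem_unitBallSubring {x : K} : x ∈ unitBallSubring K ↔ ‖x‖ ≤ 1 := Iff.rfl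

theorem norm_coe_unitBallSubring (x : unitBallSubring K) : ‖(x : K)‖ ≤ 1 := x.2

theorem norm_aeval_le_one (G : (unitBallSubring K)[X]) {z : K} (hz : ‖z‖ ≤ 1) :
    ‖aeval z G‖ ≤ 1 := by
  have : aeval z G = ((aeval (⟨z, hz⟩ : unitBallSubring K) G : unitBallSubring K) : K) :=
    (aeval_algebraMap_apply K (⟨z, hz⟩ : unitBallSubring K) G)
  rw [this]
  exact norm_coe_unitBallSubring _

/-- Since the degree is below `L`, the factor `ρ ^ L` clears all denominators of the rescaled
polynomial. -/
theorem exists_aeval_eq_pow_mul_aeval_div (Q : (unitBallSubring K)[X]) {L : ℕ}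
    (hL : L ≠ 0) (hQ : Q.degree < L) {ρ : K} (hρ : ‖ρ‖ ≤ 1) (hρ0 : ρ ≠ 0) :
    ∃ H : (unitBallSubring K)[X], ∀ z : K, aeval z H = ρ ^ L * aeval ((z - 1) / ρ) Q := by
  have hQ' : Q.natDegree < L := by
    rcases eq_or_ne Q 0 with rfl | h
    · simpa using Nat.pos_of_ne_zero hL
    · exact (natDegree_lt_iff_degree_lt h).2 hQ
  refine ⟨∑ i ∈ Finset.range L, C (Q.coeff i * (⟨ρ, hρ⟩ : unitBallSubring K) ^ (L - i)) *
    (X - 1) ^ i, fun z => ?_⟩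
  rw [aeval_eq_sum_range' (n := L) hQ', map_sum, Finset.mul_sum]
  refine Finset.sum_congr rfl fun i hi => ?_
  rw [Finset.mem_range] at hi
  simp only [map_mul, aeval_C, map_pow, map_sub, aeval_X, map_one]
  rw [show ρ ^ L = ρ ^ (L - i) * ρ ^ i by rw [← pow_add, Nat.sub_add_cancel hi.le], div_pow,
    Algebra.smul_def]
  have : (algebraMap (unitBallSubring K) K) ⟨ρ, hρ⟩ = ρ := rfl
  rw [this]
  have := pow_ne_zero i hρ0
  field_simp

/-- The polynomial is a product of two. `P`, with zeros at the `ζ ^ u` for `p^n ∤ u`, is small at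
every `ζ ^ x` with `p^n ∤ x`. Near 1 it equals `P(1)` times an integral polynomial `A` in `(z -
1)/ρ` with constant term 1, so a truncated inverse of `A` flattens it there. The total loss is at
most `p²`, whatever `n` is, while the error is smaller by a factor `p`. -/
theorem exists_polynomial_near_indicator {p : ℕ} [hp : Fact p.Prime]
    (hpK : ‖(p : K)‖ = (p : ℝ)⁻¹) {n : ℕ} (hn : n ≠ 0) :
    ∃ k, n ≤ k ∧ ∀ ζ : K, IsPrimitiveRoot ζ (p ^ k) → ∃ G : (unitBallSubring K)[X], ∀ x : ℕ,
      ‖aeval (ζ ^ x) G - if p ^ n ∣ x then (p : K) ^ 2 else 0‖ ≤ (p : ℝ)⁻¹ ^ 3 := by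
  have hp0 : (0 : ℝ) < p := by exact_mod_cast hp.out.pos
  have hp1 : (p : ℝ)⁻¹ ≤ 1 := inv_le_one_of_one_le₀ (by exact_mod_cast hp.out.one_lt.le)
  -- For order `p^(M+n)` one has `σ ^ p^n = 1/p`, where `σ` is the contribution of a shell. The `M -
  -- n = 4 p^n` shells around a point with `p^n ∤ x` thus give `p^(-4)`.
  set M := n + 4 * p ^ n with hM
  refine ⟨M + n, by omega, fun ζ hζ => ?_⟩
  have hpn : 0 < p ^ n := pow_pos hp.out.pos _
  have hMk : M < M + n := by omega
  have hnM : n ≤ M := by omega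
  have : NeZero (p ^ (M + n)) := ⟨pow_ne_zero _ hp.out.ne_zero⟩
  have hζ1 := norm_eq_one_of_isPrimitiveRoot hζ
  have htot := norm_sub_one_pow_totient hpK (by omega) hζ
  set r := ‖ζ - 1‖ with hr
  have hr1 : r ≤ 1 := norm_sub_one_le_one hζ1.le
  have hr0 : 0 ≤ r := norm_nonneg _
  have hrpos : 0 < r := by
    refine lt_of_le_of_ne hr0 fun h => ?_
    rw [← h, zero_pow (Nat.totient_pos.2 (NeZero.pos _)).ne'] at htot
    exact (inv_pos.2 hp0).ne htot
  set σ := r ^ (p ^ M).totient with hσ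
  have hσ0 : 0 ≤ σ := pow_nonneg hr0 _
  have hσ1 : σ ≤ 1 := pow_le_one₀ hr0 hr1
  have hσp : σ ^ p ^ n = (p : ℝ)⁻¹ := by
    rw [← htot, hσ, ← pow_mul, ← prime_pow_mul_totient (p := p) (M := M + n) (n := n) (by omega),
      Nat.add_sub_cancel, mul_comm]
  -- the radius of the disc on which the product of linear factors has no zeros
  set ρ := ζ ^ p ^ (n - 1) - 1 with hρ
  have hρn : ‖ρ‖ = r ^ p ^ (n - 1) := by
    have := norm_pow_sub_one_eq hpK hζ (j := n - 1) (a := 1) (by omega) hp.out.not_dvd_one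
    rwa [mul_one] at this
  have hρ1 : ‖ρ‖ ≤ 1 := hρn ▸ pow_le_one₀ hr0 hr1
  have hρpos : 0 < ‖ρ‖ := hρn ▸ pow_pos hrpos _
  have hρ0 : ρ ≠ 0 := norm_pos_iff.1 hρpos
  set U := (Finset.range (p ^ M)).filter (fun u => ¬ p ^ n ∣ u) with hU
  have hρu : ∀ u, ¬ p ^ n ∣ u → ‖ρ‖ ≤ ‖ζ ^ u - 1‖ := by
    intro u hu
    have hu0 : u ≠ 0 := by rintro rfl; exact hu (dvd_zero _)
    obtain ⟨j, b, hb, rfl⟩ := Nat.exists_eq_pow_mul_and_not_dvd hu0 p hp.out.ne_one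
    have hj : j < n := by
      by_contra! h
      exact hu (Dvd.dvd.mul_right (pow_dvd_pow p h) _)
    rw [norm_pow_sub_one_eq hpK hζ (by omega) hb, hρn]
    exact pow_le_pow_of_le_one hr0 hr1 (Nat.pow_le_pow_right hp.out.pos (by omega))
  have hcu : ∀ u, ¬ p ^ n ∣ u → ‖ρ / (ζ ^ u - 1)‖ ≤ 1 := by
    intro u hu
    rw [norm_div]
    exact div_le_one_of_le₀ (hρu u hu) (norm_nonneg _)
  have hu1 : ∀ u, ¬ p ^ n ∣ u → ζ ^ u - 1 ≠ 0 := fun u hu =>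
    norm_pos_iff.1 (hρpos.trans_le (hρu u hu))
  -- The norm of `ρ` is at most the distance from 1 to each zero of `P`; hence the coefficients of
  -- `A` are integral.
  set A : (unitBallSubring K)[X] := ∏ u ∈ U.attach,
    (1 - C (⟨ρ / (ζ ^ (u : ℕ) - 1), hcu u (Finset.mem_filter.1 u.2).2⟩ : unitBallSubring K) * X)
    with hA
  have hA0 : A.coeff 0 = 1 := by
    rw [coeff_zero_eq_eval_zero, hA, eval_prod]
    exact Finset.prod_eq_one fun u _ => by simp
  set L := p ^ M with hL
  obtain ⟨Q, S, hQ, hAQ⟩ := exists_mul_eq_one_add_X_pow_mul A hA0 L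
  have hL0 : L ≠ 0 := pow_ne_zero _ hp.out.ne_zero
  obtain ⟨H, hH⟩ := exists_aeval_eq_pow_mul_aeval_div Q hL0 hQ hρ1 hρ0
  set P : (unitBallSubring K)[X] := ∏ u ∈ U,
    (X - C (⟨ζ ^ u, by rw [mem_unitBallSubring, norm_pow, hζ1, one_pow]⟩ : unitBallSubring K))
    with hP
  have hPz : ∀ z : K, aeval z P = ∏ u ∈ U, (z - ζ ^ u) := by
    intro z
    rw [hP, map_prod]
    refine Finset.prod_congr rfl fun u _ => ?_
    rw [map_sub, aeval_X, aeval_C]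
    rfl
  have hPA : ∀ z : K, aeval z P = aeval 1 P * aeval ((z - 1) / ρ) A := by
    intro z
    rw [hPz, hPz, hA, map_prod, Finset.prod_attach U (fun u => (1 : K) - ζ ^ u) |>.symm,
      Finset.prod_attach U (fun u => z - ζ ^ u) |>.symm, ← Finset.prod_mul_distrib]
    refine Finset.prod_congr rfl fun u _ => ?_
    have h1 := hu1 u (Finset.mem_filter.1 u.2).2
    rw [map_sub, map_one, map_mul, aeval_C, aeval_X]
    change _ = (1 - ζ ^ (u : ℕ)) * (1 - ρ / (ζ ^ (u : ℕ) - 1) * ((z - 1) / ρ))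
    field_simp
    ring
  set G₀ := aeval 1 P * ρ ^ L with hG₀
  have hP1 : ‖aeval (1 : K) P‖ = σ ^ n := by
    rw [hPz, norm_prod, prod_norm_one_sub_pow hpK hζ hnM hMk]
  have hP1p : (p : ℝ)⁻¹ ≤ ‖aeval (1 : K) P‖ := by
    rw [hP1, ← hσp]
    exact pow_le_pow_of_le_one hσ0 hσ1 (Nat.lt_pow_self hp.out.one_lt).le
  have hρL : (p : ℝ)⁻¹ ≤ ‖ρ ^ L‖ := by
    rw [norm_pow, hρn, ← htot, ← pow_mul]
    refine pow_le_pow_of_le_one hr0 hr1 ?_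
    rw [hL, ← pow_add, Nat.totient_prime_pow hp.out (by omega),
      show n - 1 + M = M + n - 1 by omega]
    exact Nat.le_mul_of_pos_right _ (Nat.sub_pos_of_lt hp.out.one_lt)
  have hG₀n : (p : ℝ)⁻¹ ^ 2 ≤ ‖G₀‖ := by
    rw [hG₀, norm_mul, sq]
    exact mul_le_mul hP1p hρL (inv_nonneg.2 hp0.le) (norm_nonneg _)
  have hG₀0 : G₀ ≠ 0 := norm_pos_iff.1 ((pow_pos (inv_pos.2 hp0) 2).trans_le hG₀n)
  have hc : ‖(p : K) ^ 2 / G₀‖ ≤ 1 := by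
    rw [norm_div, norm_pow, hpK]
    exact div_le_one_of_le₀ hG₀n (norm_nonneg _)
  refine ⟨C (⟨(p : K) ^ 2 / G₀, hc⟩ : unitBallSubring K) * (P * H), fun x => ?_⟩
  rw [map_mul, aeval_C]
  change ‖(p : K) ^ 2 / G₀ * _ - _‖ ≤ _
  have hx1 : ‖ζ ^ x‖ ≤ 1 := by rw [norm_pow, hζ1, one_pow]
  split_ifs with hx
  -- Here `P H = P(1) ρ^L (1 + X^L S)` with `X = (ζ^x - 1)/ρ`, and `p^M φ(p^n) = φ(p^(M+n))` gives
  -- `|X|^L ≤ 1/p`.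
  · have hX : ‖(ζ ^ x - 1) / ρ‖ ≤ r ^ (p ^ n).totient := by
      rw [norm_div, div_le_iff₀ hρpos, hρn, ← pow_add, totient_prime_pow_eq_sub hn,
        Nat.sub_add_cancel (Nat.pow_le_pow_right hp.out.pos (Nat.sub_le _ _))]
      have := norm_pow_sub_pow_le hpK hζ (j := n) (x := x) (u := 0) (by omega)
        ((Nat.modEq_zero_iff_dvd).2 hx)
      rwa [pow_zero] at this
    have hXL : ‖((ζ ^ x - 1) / ρ) ^ L‖ ≤ (p : ℝ)⁻¹ := by
      rw [norm_pow, ← htot]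
      refine (pow_le_pow_left₀ (norm_nonneg _) hX L).trans (le_of_eq ?_)
      rw [← pow_mul, ← prime_pow_mul_totient (p := p) (M := M + n) (n := M) (by omega),
        Nat.add_sub_cancel_left, mul_comm, hL]
    have hX1 : ‖(ζ ^ x - 1) / ρ‖ ≤ 1 := hX.trans (pow_le_one₀ hr0 hr1)
    have h1 := congrArg (aeval ((ζ ^ x - 1) / ρ)) hAQ
    rw [map_mul, map_add, map_one, map_mul, map_pow, aeval_X] at h1
    have h2 : (p : K) ^ 2 / G₀ * aeval (ζ ^ x) (P * H) - (p : K) ^ 2 =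
        (p : K) ^ 2 * (((ζ ^ x - 1) / ρ) ^ L * aeval ((ζ ^ x - 1) / ρ) S) := by
      have h3 : aeval (ζ ^ x) (P * H) =
          G₀ * (aeval ((ζ ^ x - 1) / ρ) A * aeval ((ζ ^ x - 1) / ρ) Q) := by
        rw [map_mul, hPA, hH, hG₀]
        ring
      rw [h3, h1, ← mul_assoc, div_mul_cancel₀ _ hG₀0]
      ring
    rw [h2, norm_mul, norm_mul, norm_pow, hpK, pow_succ]
    refine mul_le_mul_of_nonneg_left ?_ (by positivity)
    exact (mul_le_of_le_one_right (norm_nonneg _) (norm_aeval_le_one S hX1)).trans hXL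
  · have h1 : ‖aeval (ζ ^ x) P‖ ≤ σ ^ (M - n) := by
      rw [hPz, norm_prod]
      refine le_trans ?_ (prod_norm_pow_sub_pow_le hpK hζ hnM hMk x)
      refine Finset.prod_le_prod_of_subset_of_le_one (fun u hu => ?_)
        (fun _ _ => norm_nonneg _) fun u _ _ => ?_
      · rw [Finset.mem_filter] at hu ⊢
        exact ⟨hu.1, fun h => hx ((hu.2.dvd_iff dvd_rfl).1 h)⟩
      · exact norm_sub_le_of_le_of_le hx1 (by rw [norm_pow, hζ1, one_pow])
    have h2 : σ ^ (M - n) ≤ (p : ℝ)⁻¹ ^ 4 := by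
      rw [hM, Nat.add_sub_cancel_left, mul_comm, pow_mul, hσp]
    have h3 := norm_aeval_le_one H hx1
    rw [sub_zero, norm_mul, map_mul, norm_mul]
    calc _ ≤ 1 * ((p : ℝ)⁻¹ ^ 4 * 1) := by
          gcongr
          exact h1.trans h2
      _ ≤ _ := by
          rw [one_mul, mul_one]
          exact pow_le_pow_of_le_one (by positivity) hp1 (by norm_num)

end PolynomialApproximation

/-! ### Smooth characters and integral trigonometric polynomials -/

section Trigonometric

variable {p : ℕ} [hp : Fact p.Prime]

theorem norm_prime_padicComplex : ‖(p : ℂ_[p])‖ = (p : ℝ)⁻¹ := by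
  have h := PadicComplex.norm_extends' p (p : ℚ_[p])
  rw [Padic.norm_p] at h
  rw [← h]
  congr 1
  exact (map_natCast (algebraMap ℚ_[p] ℂ_[p]) p).symm

theorem prime_inv_pos : (0 : ℝ) < (p : ℝ)⁻¹ := inv_pos.2 (by exact_mod_cast hp.out.pos)

theorem prime_inv_lt_one : (p : ℝ)⁻¹ < 1 := inv_lt_one_of_one_lt₀ (by exact_mod_cast hp.out.one_lt)

theorem norm_prime_pow (n : ℕ) : ‖(p : ℚ_[p]) ^ n‖ = (p : ℝ)⁻¹ ^ n := by
  rw [norm_pow, Padic.norm_p]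

theorem prime_ne_zero_padic : (p : ℚ_[p]) ≠ 0 := Nat.cast_ne_zero.2 hp.out.ne_zero

theorem prime_ne_zero_padicComplex : (p : ℂ_[p]) ≠ 0 := Nat.cast_ne_zero.2 hp.out.ne_zero

namespace SmoothCharacter

variable (ψ : SmoothCharacter p)

theorem exists_eq_one_of_norm_le : ∃ n : ℕ, ∀ t : ℚ_[p], ‖t‖ ≤ (p : ℝ)⁻¹ ^ n →
    ψ.toAddChar t = 1 := by
  obtain ⟨ε, hε, h⟩ := Metric.isOpen_iff.1 ψ.isOpen_ker 0 (by simp)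
  obtain ⟨n, hn⟩ := exists_pow_lt_of_lt_one hε (prime_inv_lt_one (p := p))
  refine ⟨n, fun t ht => h ?_⟩
  rw [mem_ball_zero_iff]
  exact ht.trans_lt hn

theorem exists_pow_mul_eq_one (t : ℚ_[p]) :
    ∃ m : ℕ, ∀ z : ℚ_[p], ‖z‖ ≤ 1 → ψ.toAddChar ((p : ℚ_[p]) ^ m * t * z) = 1 := by
  obtain ⟨n, hn⟩ := ψ.exists_eq_one_of_norm_le
  have hpos : 0 < (p : ℝ)⁻¹ ^ n / (‖t‖ + 1) :=
    div_pos (pow_pos prime_inv_pos _) (by positivity)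
  obtain ⟨m, hm⟩ := exists_pow_lt_of_lt_one hpos (prime_inv_lt_one (p := p))
  refine ⟨m, fun z hz => hn _ ?_⟩
  rw [norm_mul, norm_mul, norm_prime_pow]
  rw [lt_div_iff₀ (by positivity)] at hm
  have h1 : (p : ℝ)⁻¹ ^ m * ‖t‖ ≤ (p : ℝ)⁻¹ ^ m * (‖t‖ + 1) :=
    mul_le_mul_of_nonneg_left (by linarith) (pow_pos prime_inv_pos _).le
  have h2 : (p : ℝ)⁻¹ ^ m * ‖t‖ * ‖z‖ ≤ (p : ℝ)⁻¹ ^ m * ‖t‖ :=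
    mul_le_of_le_one_right (mul_nonneg (pow_pos prime_inv_pos _).le (norm_nonneg _)) hz
  linarith

theorem norm_eq_one (t : ℚ_[p]) : ‖ψ.toAddChar t‖ = 1 := by
  obtain ⟨m, hm⟩ := ψ.exists_pow_mul_eq_one t
  have h := hm 1 (by simp)
  rw [mul_one, ← Nat.cast_pow, ← nsmul_eq_mul, AddChar.map_nsmul_eq_pow] at h
  exact (pow_eq_one_iff_of_nonneg (norm_nonneg _) (pow_pos hp.out.pos m).ne').1 (by
    rw [← norm_pow, h, norm_one])

variable {ψ}

/-- If `ψ(t) ≠ 1`, the least `m` for which `ψ` is trivial on `p^m t ℤ_p` is positive, and `y` is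
taken in `p^(m-1) t ℤ_p`. -/
theorem exists_ne_one_and_eq_one (hψ : ψ.toAddChar ≠ 1) :
    ∃ y : ℚ_[p], ψ.toAddChar y ≠ 1 ∧
      ∀ x : ℚ_[p], ‖x‖ ≤ (p : ℝ)⁻¹ → ψ.toAddChar (y * x) = 1 := by
  classical
  obtain ⟨t, ht⟩ := AddChar.ne_one_iff.1 hψ
  have hex := ψ.exists_pow_mul_eq_one t
  obtain ⟨m, hm⟩ := Nat.exists_eq_succ_of_ne_zero (n := Nat.find hex) fun h => ht (by
    have := Nat.find_spec hex 1 (by simp)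
    rwa [h, pow_zero, one_mul, mul_one] at this)
  have h1 := Nat.find_min hex (m := m) (by omega)
  have h2 := Nat.find_spec hex
  rw [hm] at h2
  push Not at h1
  obtain ⟨z, hz, hz'⟩ := h1
  refine ⟨_, hz', fun x hx => ?_⟩
  have h3 : (p : ℚ_[p]) ^ m * t * z * x = (p : ℚ_[p]) ^ m.succ * t * (z * (x / p)) := by
    have := prime_ne_zero_padic (p := p)
    rw [pow_succ]
    field_simp
  rw [h3]
  refine h2 _ ?_
  rw [norm_mul, norm_div, Padic.norm_p]
  exact mul_le_one₀ hz (by positivity) ((div_le_one prime_inv_pos).2 hx)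

theorem exists_isPrimitiveRoot (hψ : ψ.toAddChar ≠ 1) : ∃ y : ℚ_[p], y ≠ 0 ∧ ∀ k : ℕ,
    IsPrimitiveRoot (ψ.toAddChar (y / (p : ℚ_[p]) ^ k)) (p ^ (k + 1)) ∧
      ∀ x : ℚ_[p], ‖x‖ ≤ (p : ℝ)⁻¹ ^ (k + 1) →
        ψ.toAddChar (y / (p : ℚ_[p]) ^ k * x) = 1 := by
  obtain ⟨y, hy, hy'⟩ := exists_ne_one_and_eq_one hψ
  have hp0 := prime_ne_zero_padic (p := p)
  refine ⟨y, by rintro rfl; simp at hy, fun k => ?_⟩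
  have h1 : ∀ x : ℚ_[p], ‖x‖ ≤ (p : ℝ)⁻¹ ^ (k + 1) →
      ψ.toAddChar (y / (p : ℚ_[p]) ^ k * x) = 1 := by
    intro x hx
    rw [div_mul_eq_mul_div, mul_div_assoc]
    refine hy' _ ?_
    rw [norm_div, norm_prime_pow, div_le_iff₀ (pow_pos prime_inv_pos _), ← pow_succ']
    exact hx
  refine ⟨?_, h1⟩
  have h2 : orderOf (ψ.toAddChar (y / (p : ℚ_[p]) ^ k)) = p ^ (k + 1) := by
    refine orderOf_eq_prime_pow ?_ ?_
    · rw [← AddChar.map_nsmul_eq_pow, nsmul_eq_mul, Nat.cast_pow,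
        mul_div_cancel₀ _ (pow_ne_zero _ hp0)]
      exact hy
    · rw [← AddChar.map_nsmul_eq_pow, nsmul_eq_mul, Nat.cast_pow, mul_comm]
      exact h1 _ (norm_prime_pow _).le
  rw [← h2]
  exact IsPrimitiveRoot.orderOf _

end SmoothCharacter

/-- The ring generated by the integral constants and the functions `x ↦ ψ (l x)`, for linear
forms `l`. -/
noncomputable def trigRing (ψ : SmoothCharacter p) (E : Type*) [AddCommGroup E] [Module ℚ_[p] E] :
    Subring (E → ℂ_[p]) :=
  Subring.closure ({φ | ∃ c : ℂ_[p], ‖c‖ ≤ 1 ∧ φ = fun _ => c} ∪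
    {φ | ∃ l : E →ₗ[ℚ_[p]] ℚ_[p], φ = fun x => ψ.toAddChar (l x)})

section

variable {ψ : SmoothCharacter p} {E F : Type*} [AddCommGroup E] [Module ℚ_[p] E]
  [AddCommGroup F] [Module ℚ_[p] F]

theorem const_mem_trigRing {c : ℂ_[p]} (hc : ‖c‖ ≤ 1) : (fun _ => c) ∈ trigRing ψ E :=
  Subring.subset_closure (Or.inl ⟨c, hc, rfl⟩)

theorem char_mem_trigRing (l : E →ₗ[ℚ_[p]] ℚ_[p]) :
    (fun x => ψ.toAddChar (l x)) ∈ trigRing ψ E :=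
  Subring.subset_closure (Or.inr ⟨l, rfl⟩)

theorem trigRing_induction {P : (E → ℂ_[p]) → Prop} (hc : ∀ c : ℂ_[p], ‖c‖ ≤ 1 → P fun _ => c)
    (hl : ∀ l : E →ₗ[ℚ_[p]] ℚ_[p], P fun x => ψ.toAddChar (l x))
    (hadd : ∀ f g, P f → P g → P (f + g)) (hmul : ∀ f g, P f → P g → P (f * g))
    {φ : E → ℂ_[p]} (hφ : φ ∈ trigRing ψ E) : P φ := by
  induction hφ using Subring.closure_induction with
  | mem φ h =>
    rcases h with ⟨c, h, rfl⟩ | ⟨l, rfl⟩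
    · exact hc c h
    · exact hl l
  | zero => exact hc 0 (by simp)
  | one => exact hc 1 (by simp)
  | add f g _ _ hf hg => exact hadd f g hf hg
  | mul f g _ _ hf hg => exact hmul f g hf hg
  | neg f _ hf =>
    have := hmul _ _ (hc (-1) (by simp)) hf
    convert this using 1
    ext x
    simp

theorem comp_linearMap_mem_trigRing {φ : F → ℂ_[p]} (hφ : φ ∈ trigRing ψ F)
    (L : E →ₗ[ℚ_[p]] F) : (fun x => φ (L x)) ∈ trigRing ψ E := by
  refine trigRing_induction (P := fun φ => (fun x => φ (L x)) ∈ trigRing ψ E)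
    (fun c hc => const_mem_trigRing hc) (fun l => char_mem_trigRing (l ∘ₗ L))
    (fun f g hf hg => add_mem hf hg) (fun f g hf hg => mul_mem hf hg) hφ

theorem comp_add_right_mem_trigRing {φ : E → ℂ_[p]} (hφ : φ ∈ trigRing ψ E) (a : E) :
    (fun x => φ (x + a)) ∈ trigRing ψ E := by
  refine trigRing_induction (P := fun φ => (fun x => φ (x + a)) ∈ trigRing ψ E)
    (fun c hc => const_mem_trigRing hc) (fun l => ?_)
    (fun f g hf hg => add_mem hf hg) (fun f g hf hg => mul_mem hf hg) hφ
  simp only [map_add, AddChar.map_add_eq_mul]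
  exact mul_mem (char_mem_trigRing l) (const_mem_trigRing (ψ.norm_eq_one _).le)

theorem norm_le_one_of_mem_trigRing {φ : E → ℂ_[p]} (hφ : φ ∈ trigRing ψ E) (x : E) :
    ‖φ x‖ ≤ 1 :=
  trigRing_induction (P := fun φ => ‖φ x‖ ≤ 1) (fun _ hc => hc) (fun _ => (ψ.norm_eq_one _).le)
    (fun _ _ hf hg => norm_add_le_of_le_of_le hf hg)
    (fun _ _ hf hg => (norm_mul_le _ _).trans (mul_le_one₀ hf (norm_nonneg _) hg)) hφ

theorem aeval_mem_trigRing {φ : E → ℂ_[p]} (hφ : φ ∈ trigRing ψ E)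
    (G : Polynomial (unitBallSubring ℂ_[p])) :
    (fun x => Polynomial.aeval (φ x) G) ∈ trigRing ψ E := by
  induction G using Polynomial.induction_on' with
  | add f g hf hg =>
    simp only [map_add]
    exact add_mem hf hg
  | monomial n c =>
    simp only [Polynomial.aeval_monomial]
    exact mul_mem (const_mem_trigRing c.2) (pow_mem hφ n)

/-- Uniform local constancy is what allows the error of a trigonometric approximation to be
approximated in its turn. -/
theorem exists_eq_of_norm_sub_le_of_mem_trigRing {φ : ℚ_[p] → ℂ_[p]}
    (hφ : φ ∈ trigRing ψ ℚ_[p]) :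
    ∃ n : ℕ, ∀ x y, ‖x - y‖ ≤ (p : ℝ)⁻¹ ^ n → φ x = φ y := by
  have hanti : ∀ {m n : ℕ}, m ≤ n → (p : ℝ)⁻¹ ^ n ≤ (p : ℝ)⁻¹ ^ m := fun h =>
    pow_le_pow_of_le_one prime_inv_pos.le prime_inv_lt_one.le h
  have comb : ∀ (f g h : ℚ_[p] → ℂ_[p]), (∀ x y, f x = f y → g x = g y → h x = h y) →
      (∃ n : ℕ, ∀ x y, ‖x - y‖ ≤ (p : ℝ)⁻¹ ^ n → f x = f y) →
      (∃ n : ℕ, ∀ x y, ‖x - y‖ ≤ (p : ℝ)⁻¹ ^ n → g x = g y) →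
      ∃ n : ℕ, ∀ x y, ‖x - y‖ ≤ (p : ℝ)⁻¹ ^ n → h x = h y := by
    rintro f g h hfg ⟨m, hm⟩ ⟨n, hn⟩
    exact ⟨max m n, fun x y hxy => hfg x y (hm x y (hxy.trans (hanti (le_max_left _ _))))
      (hn x y (hxy.trans (hanti (le_max_right _ _))))⟩
  refine trigRing_induction
    (P := fun φ => ∃ n : ℕ, ∀ x y, ‖x - y‖ ≤ (p : ℝ)⁻¹ ^ n → φ x = φ y)
    (fun c _ => ⟨0, fun _ _ _ => rfl⟩) (fun l => ?_)
    (fun f g hf hg => comb f g _ (fun x y h1 h2 => by simp [h1, h2]) hf hg)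
    (fun f g hf hg => comb f g _ (fun x y h1 h2 => by simp [h1, h2]) hf hg) hφ
  obtain ⟨m, hm⟩ := ψ.exists_pow_mul_eq_one (l 1)
  refine ⟨m, fun x y hxy => ?_⟩
  have h1 : l x = (p : ℚ_[p]) ^ m * l 1 * ((x - y) / (p : ℚ_[p]) ^ m) + l y := by
    have h2 : ∀ z, l z = z * l 1 := fun z => by
      rw [← smul_eq_mul, ← map_smul, smul_eq_mul, mul_one]
    have := pow_ne_zero m (prime_ne_zero_padic (p := p))
    rw [h2 x, h2 y]
    field_simp
    ring
  change ψ.toAddChar (l x) = ψ.toAddChar (l y)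
  rw [h1, AddChar.map_add_eq_mul, hm, one_mul]
  rw [norm_div, norm_prime_pow]
  exact (div_le_one (pow_pos prime_inv_pos _)).2 hxy

end

theorem exists_nat_norm_sub_le {x : ℚ_[p]} (hx : ‖x‖ ≤ 1) (n : ℕ) :
    ∃ a < p ^ n, ‖x - (a : ℚ_[p])‖ ≤ (p : ℝ)⁻¹ ^ n := by
  refine ⟨PadicInt.appr ⟨x, hx⟩ n, PadicInt.appr_lt _ _, ?_⟩
  have h := PadicInt.appr_spec n (⟨x, hx⟩ : ℤ_[p])
  rw [← PadicInt.norm_le_pow_iff_mem_span_pow] at h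
  rw [inv_pow, ← zpow_natCast, ← zpow_neg]
  exact_mod_cast h

theorem norm_natCast_le_iff (n a : ℕ) : ‖(a : ℚ_[p])‖ ≤ (p : ℝ)⁻¹ ^ n ↔ p ^ n ∣ a := by
  have := Padic.norm_int_le_pow_iff_dvd (p := p) (a : ℤ) n
  rw [inv_pow, ← zpow_natCast, ← zpow_neg]
  rw [Int.cast_natCast] at this
  rw [this]
  exact_mod_cast Int.natCast_dvd_natCast

theorem norm_le_iff_of_norm_sub_le {E : Type*} [SeminormedAddCommGroup E] [IsUltrametricDist E]
    {x y : E} {C : ℝ} (h : ‖x - y‖ ≤ C) : ‖x‖ ≤ C ↔ ‖y‖ ≤ C := by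
  constructor
  · intro hx
    simpa using norm_sub_le_of_le_of_le hx h
  · intro hy
    simpa using norm_add_le_of_le_of_le h hy

variable {ψ : SmoothCharacter p}

/-- On `ℤ_p` a suitable character takes values `ζ ^ a` with `a` an integer close to `x`, so the
polynomial approximation on roots of unity applies to it. -/
theorem exists_trig_near_indicator (hψ : ψ.toAddChar ≠ 1) (n : ℕ) :
    ∃ φ ∈ trigRing ψ ℚ_[p], ∀ x : ℚ_[p], ‖x‖ ≤ 1 →
      ‖φ x - if ‖x‖ ≤ (p : ℝ)⁻¹ ^ n then (p : ℂ_[p]) ^ 2 else 0‖ ≤ (p : ℝ)⁻¹ ^ 3 := by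
  rcases eq_or_ne n 0 with rfl | hn
  · refine ⟨_, const_mem_trigRing (c := (p : ℂ_[p]) ^ 2) ?_, fun x hx => ?_⟩
    · rw [norm_pow, norm_prime_padicComplex]
      exact pow_le_one₀ prime_inv_pos.le prime_inv_lt_one.le
    · rw [pow_zero, if_pos hx, sub_self, norm_zero]
      exact (pow_pos prime_inv_pos _).le
  obtain ⟨k, hnk, hk⟩ := exists_polynomial_near_indicator
    (norm_prime_padicComplex (p := p)) hn
  obtain ⟨y, -, hy⟩ := SmoothCharacter.exists_isPrimitiveRoot hψ
  obtain ⟨k, rfl⟩ := Nat.exists_eq_succ_of_ne_zero (show k ≠ 0 by omega)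
  obtain ⟨hζ, hy⟩ := hy k
  obtain ⟨G, hG⟩ := hk _ hζ
  set b := y / (p : ℚ_[p]) ^ k
  refine ⟨_, aeval_mem_trigRing (char_mem_trigRing (b • LinearMap.id)) G, fun x hx => ?_⟩
  obtain ⟨a, -, ha⟩ := exists_nat_norm_sub_le hx (k + 1)
  have h1 : ψ.toAddChar ((b • LinearMap.id : ℚ_[p] →ₗ[ℚ_[p]] ℚ_[p]) x) =
      ψ.toAddChar b ^ a := by
    have : (b • LinearMap.id : ℚ_[p] →ₗ[ℚ_[p]] ℚ_[p]) x = b * (x - a) + a • b := by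
      rw [LinearMap.smul_apply, LinearMap.id_apply, smul_eq_mul, nsmul_eq_mul]
      ring
    rw [this, AddChar.map_add_eq_mul, hy _ ha, one_mul, AddChar.map_nsmul_eq_pow]
  have h2 : ‖x‖ ≤ (p : ℝ)⁻¹ ^ n ↔ p ^ n ∣ a := by
    rw [← norm_natCast_le_iff]
    exact norm_le_iff_of_norm_sub_le
      (ha.trans (pow_le_pow_of_le_one prime_inv_pos.le prime_inv_lt_one.le hnk))
  simp only [h1, h2]
  exact hG a

end Trigonometric

/-! ### Approximation of locally constant functions to any precision -/

section Approximation

variable {p : ℕ} [hp : Fact p.Prime] {ψ : SmoothCharacter p}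

/-- Integral combination of translates of the approximate indicator over the residues modulo `p^n`.
By the ultrametric inequality the number of terms does not affect the error. -/
theorem exists_trig_near_of_level (hψ : ψ.toAddChar ≠ 1) (n : ℕ) (f : ℚ_[p] → ℂ_[p])
    (hf1 : ∀ x, ‖x‖ ≤ 1 → ‖f x‖ ≤ 1)
    (hf : ∀ x y, ‖x‖ ≤ 1 → ‖x - y‖ ≤ (p : ℝ)⁻¹ ^ n → f x = f y) :
    ∃ φ ∈ trigRing ψ ℚ_[p], ∀ x : ℚ_[p], ‖x‖ ≤ 1 →
      ‖φ x - (p : ℂ_[p]) ^ 2 * f x‖ ≤ (p : ℝ)⁻¹ ^ 3 := by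
  obtain ⟨φ, hφ, hφx⟩ := exists_trig_near_indicator hψ n
  have hpn : (0 : ℝ) ≤ (p : ℝ)⁻¹ ^ 3 := (pow_pos prime_inv_pos _).le
  have hnat : ∀ a : ℕ, ‖(a : ℚ_[p])‖ ≤ 1 := fun a => by
    simpa using (norm_natCast_le_iff (p := p) 0 a).2 (by simp)
  refine ⟨∑ a ∈ Finset.range (p ^ n), (fun _ => f a) * fun x => φ (x + (-(a : ℚ_[p]))),
    sum_mem fun a _ => mul_mem (const_mem_trigRing (hf1 _ (hnat a)))
      (comp_add_right_mem_trigRing hφ _), fun x hx => ?_⟩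
  obtain ⟨a, ha, hxa⟩ := exists_nat_norm_sub_le hx n
  have h1 : (p : ℂ_[p]) ^ 2 * f x = ∑ b ∈ Finset.range (p ^ n), f b *
      (if ‖x + -(b : ℚ_[p])‖ ≤ (p : ℝ)⁻¹ ^ n then (p : ℂ_[p]) ^ 2 else 0) := by
    rw [Finset.sum_eq_single a]
    · rw [if_pos (by rwa [← sub_eq_add_neg]), mul_comm, hf x a hx hxa]
    · intro b hb hba
      rw [if_neg, mul_zero]
      intro h
      rw [← sub_eq_add_neg] at h
      have h2 : ‖((a : ℤ) - (b : ℤ) : ℤ) • (1 : ℚ_[p])‖ ≤ (p : ℝ)⁻¹ ^ n := by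
        have := norm_sub_le_of_le_of_le h hxa
        rw [sub_sub_sub_cancel_left] at this
        simpa using this
      rw [zsmul_eq_mul, mul_one, inv_pow, ← zpow_natCast, ← zpow_neg,
        Padic.norm_int_le_pow_iff_dvd] at h2
      refine hba ?_
      rw [Finset.mem_range] at hb
      have h3 := Int.eq_zero_of_abs_lt_dvd h2 (by
        rw [abs_lt]
        constructor <;> zify at ha hb <;> linarith)
      omega
    · intro h
      exact absurd (Finset.mem_range.2 ha) h
  rw [h1, Finset.sum_apply, ← Finset.sum_sub_distrib]
  refine norm_sum_le_of_forall _ _ hpn fun b _ => ?_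
  change ‖f b * φ (x + -(b : ℚ_[p])) - _‖ ≤ _
  rw [← mul_sub, norm_mul]
  refine (mul_le_of_le_one_left (norm_nonneg _) (hf1 _ (hnat b))).trans (hφx _ ?_)
  rw [← sub_eq_add_neg]
  exact norm_sub_le_of_le_of_le hx (hnat b)

/-- Successive correction: the error divided by `p^(j+3)` is again integral and of some finite
level, so it can be approximated up to the factor `p²`. The level is unbounded along the way, but
the loss stays `p²`. -/
theorem exists_trig_near_of_level_of_pow (hψ : ψ.toAddChar ≠ 1) (j : ℕ) :
    ∀ (n : ℕ) (f : ℚ_[p] → ℂ_[p]), (∀ x, ‖x‖ ≤ 1 → ‖f x‖ ≤ 1) →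
    (∀ x y, ‖x‖ ≤ 1 → ‖x - y‖ ≤ (p : ℝ)⁻¹ ^ n → f x = f y) →
    ∃ φ ∈ trigRing ψ ℚ_[p], ∀ x : ℚ_[p], ‖x‖ ≤ 1 →
      ‖φ x - (p : ℂ_[p]) ^ 2 * f x‖ ≤ (p : ℝ)⁻¹ ^ (j + 3) := by
  induction j with
  | zero => exact fun n f hf1 hf => by simpa using exists_trig_near_of_level hψ n f hf1 hf
  | succ j ih =>
    intro n f hf1 hf
    obtain ⟨φ, hφ, hφx⟩ := ih n f hf1 hf
    obtain ⟨m, hm⟩ := exists_eq_of_norm_sub_le_of_mem_trigRing hφ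
    have hp0 := prime_ne_zero_padicComplex (p := p)
    have hanti : ∀ {m n : ℕ}, m ≤ n → (p : ℝ)⁻¹ ^ n ≤ (p : ℝ)⁻¹ ^ m := fun h =>
      pow_le_pow_of_le_one prime_inv_pos.le prime_inv_lt_one.le h
    have hpn : ∀ i : ℕ, ‖(p : ℂ_[p]) ^ i‖ = (p : ℝ)⁻¹ ^ i := fun i => by
      rw [norm_pow, norm_prime_padicComplex]
    obtain ⟨φ', hφ', hφx'⟩ := exists_trig_near_of_level hψ (max m n)
      (fun x => ((p : ℂ_[p]) ^ 2 * f x - φ x) / (p : ℂ_[p]) ^ (j + 3)) (fun x hx => by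
        rw [norm_div, hpn, norm_sub_rev]
        exact (div_le_one (pow_pos prime_inv_pos _)).2 (hφx x hx)) (fun x y hx hxy => by
        rw [hf x y hx (hxy.trans (hanti (le_max_right _ _))),
          hm x y (hxy.trans (hanti (le_max_left _ _)))])
    -- The exponent is `(j + 3) - 2`: the factor `p²` in front of the rescaled error already
    -- restores two powers of `p`, so the coefficient of the correction is integral.
    refine ⟨φ + (fun _ => (p : ℂ_[p]) ^ (j + 1)) * φ', add_mem hφ (mul_mem (const_mem_trigRing ?_)
      hφ'), fun x hx => ?_⟩
    · rw [hpn]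
      exact pow_le_one₀ prime_inv_pos.le prime_inv_lt_one.le
    · have h1 : (φ + (fun _ => (p : ℂ_[p]) ^ (j + 1)) * φ' : ℚ_[p] → ℂ_[p]) x - (p : ℂ_[p]) ^ 2 * f x =
          (p : ℂ_[p]) ^ (j + 1) * (φ' x - (p : ℂ_[p]) ^ 2 *
            (((p : ℂ_[p]) ^ 2 * f x - φ x) / (p : ℂ_[p]) ^ (j + 3))) := by
        change φ x + (p : ℂ_[p]) ^ (j + 1) * φ' x - _ = _
        field_simp
        ring
      rw [h1, norm_mul, hpn, show j + 1 + 3 = (j + 1) + 3 from rfl, pow_add _ (j + 1) 3]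
      exact mul_le_mul_of_nonneg_left (hφx' x hx) (pow_pos prime_inv_pos _).le

/-- Orthogonality of characters, as a geometric sum. It is exact, but the constant `p^n` degenerates
with the radius; this is enough for irreducibility and not for comparing norms. -/
theorem exists_trig_eq_indicator (hψ : ψ.toAddChar ≠ 1) (n : ℕ) :
    ∃ φ ∈ trigRing ψ ℚ_[p], ∀ x : ℚ_[p], ‖x‖ ≤ 1 →
      φ x = if ‖x‖ ≤ (p : ℝ)⁻¹ ^ n then (p : ℂ_[p]) ^ n else 0 := by
  rcases eq_or_ne n 0 with rfl | hn
  · exact ⟨1, one_mem _, fun x hx => by simp [hx]⟩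
  obtain ⟨n, rfl⟩ := Nat.exists_eq_succ_of_ne_zero hn
  obtain ⟨y, -, hy⟩ := SmoothCharacter.exists_isPrimitiveRoot hψ
  obtain ⟨hζ, hy⟩ := hy n
  set b := y / (p : ℚ_[p]) ^ n
  set ζ := ψ.toAddChar b
  refine ⟨∑ i ∈ Finset.range (p ^ (n + 1)),
    (fun x => ψ.toAddChar ((b • LinearMap.id : ℚ_[p] →ₗ[ℚ_[p]] ℚ_[p]) x)) ^ i,
    sum_mem fun i _ => pow_mem (char_mem_trigRing _) i, fun x hx => ?_⟩
  obtain ⟨a, -, ha⟩ := exists_nat_norm_sub_le hx (n + 1)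
  have h1 : ψ.toAddChar ((b • LinearMap.id : ℚ_[p] →ₗ[ℚ_[p]] ℚ_[p]) x) = ζ ^ a := by
    have : (b • LinearMap.id : ℚ_[p] →ₗ[ℚ_[p]] ℚ_[p]) x = b * (x - a) + a • b := by
      rw [LinearMap.smul_apply, LinearMap.id_apply, smul_eq_mul, nsmul_eq_mul]
      ring
    rw [this, AddChar.map_add_eq_mul, hy _ ha, one_mul, AddChar.map_nsmul_eq_pow]
  rw [Finset.sum_apply]
  simp only [Pi.pow_apply, h1]
  rw [if_congr ((norm_le_iff_of_norm_sub_le ha).trans (norm_natCast_le_iff (n + 1) a)) rfl rfl]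
  split_ifs with h
  · have h2 : ζ ^ a = 1 := (hζ.pow_eq_one_iff_dvd a).2 h
    simp [h2]
  · have h2 : ζ ^ a - 1 ≠ 0 := fun h3 => h ((hζ.pow_eq_one_iff_dvd a).1 (sub_eq_zero.1 h3))
    have h3 := mul_geom_sum (ζ ^ a) (p ^ (n + 1))
    rw [← pow_mul, mul_comm a, pow_mul, hζ.pow_eq_one, one_pow, sub_self] at h3
    exact (mul_eq_zero.1 h3).resolve_left h2

theorem norm_prod_sub_prod_le {ι K : Type*} [NormedField K] [IsUltrametricDist K] (s : Finset ι)
    (f g : ι → K) {ε : ℝ} (hε : 0 ≤ ε) (hf : ∀ i ∈ s, ‖f i‖ ≤ 1) (hg : ∀ i ∈ s, ‖g i‖ ≤ 1)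
    (h : ∀ i ∈ s, ‖f i - g i‖ ≤ ε) : ‖∏ i ∈ s, f i - ∏ i ∈ s, g i‖ ≤ ε := by
  classical
  induction s using Finset.induction_on with
  | empty => simpa using hε
  | insert a s ha ih =>
    rw [Finset.prod_insert ha, Finset.prod_insert ha]
    have h1 : f a * ∏ i ∈ s, f i - g a * ∏ i ∈ s, g i =
        f a * (∏ i ∈ s, f i - ∏ i ∈ s, g i) + (f a - g a) * ∏ i ∈ s, g i := by ring
    rw [h1]
    refine norm_add_le_of_le_of_le ?_ ?_
    · rw [norm_mul]
      refine (mul_le_of_le_one_left (norm_nonneg _) (hf a (by simp))).trans (ih ?_ ?_ ?_)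
      · exact fun i hi => hf i (Finset.mem_insert_of_mem hi)
      · exact fun i hi => hg i (Finset.mem_insert_of_mem hi)
      · exact fun i hi => h i (Finset.mem_insert_of_mem hi)
    · rw [norm_mul, norm_prod]
      refine (mul_le_of_le_one_right (norm_nonneg _) ?_).trans (h a (by simp))
      exact Finset.prod_le_one (fun _ _ => norm_nonneg _)
        fun i hi => hg i (Finset.mem_insert_of_mem hi)

variable {d : ℕ}

/-- From one variable on the unit ball to `d` variables on a ball of arbitrary radius. -/
theorem exists_trig_pi_of_trig {n m : ℕ} {c : ℂ_[p]} (hc : ‖c‖ ≤ 1) {ε : ℝ} (hε : 0 ≤ ε)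
    (h : ∃ φ ∈ trigRing ψ ℚ_[p], ∀ x : ℚ_[p], ‖x‖ ≤ 1 →
      ‖φ x - if ‖x‖ ≤ (p : ℝ)⁻¹ ^ (n + m) then c else 0‖ ≤ ε) :
    ∃ Φ ∈ trigRing ψ (Fin d → ℚ_[p]), ∀ x : Fin d → ℚ_[p], ‖x‖ ≤ (p : ℝ) ^ m →
      ‖Φ x - if ‖x‖ ≤ (p : ℝ)⁻¹ ^ n then c ^ d else 0‖ ≤ ε := by
  obtain ⟨φ, hφ, hφx⟩ := h
  have hp0 : (0 : ℝ) < p := by exact_mod_cast hp.out.pos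
  refine ⟨∏ i : Fin d, fun x => φ (((p : ℚ_[p]) ^ m • LinearMap.proj (R := ℚ_[p])
    (φ := fun _ => ℚ_[p]) i) x), prod_mem fun i _ => comp_linearMap_mem_trigRing hφ _,
    fun x hx => ?_⟩
  have h1 : (if ‖x‖ ≤ (p : ℝ)⁻¹ ^ n then c ^ d else 0) =
      ∏ i : Fin d, if ‖(p : ℚ_[p]) ^ m * x i‖ ≤ (p : ℝ)⁻¹ ^ (n + m) then c else 0 := by
    have h2 : ∀ i, ‖(p : ℚ_[p]) ^ m * x i‖ ≤ (p : ℝ)⁻¹ ^ (n + m) ↔ ‖x i‖ ≤ (p : ℝ)⁻¹ ^ n := by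
      intro i
      rw [norm_mul, norm_prime_pow, add_comm, pow_add]
      exact mul_le_mul_iff_of_pos_left (pow_pos prime_inv_pos _)
    simp only [h2]
    split_ifs with h3
    · rw [pi_norm_le_iff_of_nonneg (pow_pos prime_inv_pos _).le] at h3
      rw [Finset.prod_congr rfl fun i _ => if_pos (h3 i), Finset.prod_const, Finset.card_univ,
        Fintype.card_fin]
    · rw [pi_norm_le_iff_of_nonneg (pow_pos prime_inv_pos _).le] at h3
      push Not at h3
      obtain ⟨i, hi⟩ := h3
      exact (Finset.prod_eq_zero (Finset.mem_univ i) (if_neg (not_le.2 hi))).symm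
  rw [h1, Finset.prod_apply]
  refine norm_prod_sub_prod_le _ _ _ hε (fun i _ => norm_le_one_of_mem_trigRing hφ _)
    (fun i _ => by split_ifs <;> simp [hc]) fun i _ => hφx _ ?_
  change ‖(p : ℚ_[p]) ^ m * x i‖ ≤ 1
  rw [norm_mul, norm_prime_pow, inv_pow, inv_mul_le_iff₀ (pow_pos hp0 _), mul_one]
  exact (norm_le_pi_norm x i).trans hx

theorem exists_trig_pi_near_indicator (hψ : ψ.toAddChar ≠ 1) (n m : ℕ) {ε : ℝ} (hε : 0 < ε) :
    ∃ Φ ∈ trigRing ψ (Fin d → ℚ_[p]), ∀ x : Fin d → ℚ_[p], ‖x‖ ≤ (p : ℝ) ^ m →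
      ‖Φ x - if ‖x‖ ≤ (p : ℝ)⁻¹ ^ n then ((p : ℂ_[p]) ^ 2) ^ d else 0‖ ≤ ε := by
  refine exists_trig_pi_of_trig ?_ hε.le ?_
  · rw [norm_pow, norm_prime_padicComplex]
    exact pow_le_one₀ prime_inv_pos.le prime_inv_lt_one.le
  obtain ⟨j, hj⟩ := exists_pow_lt_of_lt_one hε (prime_inv_lt_one (p := p))
  obtain ⟨φ, hφ, hφx⟩ := exists_trig_near_of_level_of_pow hψ j (n + m)
    (fun x : ℚ_[p] => if ‖x‖ ≤ (p : ℝ)⁻¹ ^ (n + m) then 1 else 0)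
    (fun x _ => by split_ifs <;> simp)
    (fun x y _ hxy => if_congr (norm_le_iff_of_norm_sub_le hxy) rfl rfl)
  refine ⟨φ, hφ, fun x hx => ?_⟩
  have := hφx x hx
  rw [mul_ite, mul_one, mul_zero] at this
  exact this.trans ((pow_le_pow_of_le_one prime_inv_pos.le prime_inv_lt_one.le
    (Nat.le_add_right _ _)).trans hj.le)

theorem exists_trig_pi_eq_indicator (hψ : ψ.toAddChar ≠ 1) (n m : ℕ) :
    ∃ c : ℂ_[p], c ≠ 0 ∧ ∃ Φ ∈ trigRing ψ (Fin d → ℚ_[p]), ∀ x : Fin d → ℚ_[p],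
      ‖x‖ ≤ (p : ℝ) ^ m → Φ x = if ‖x‖ ≤ (p : ℝ)⁻¹ ^ n then c else 0 := by
  refine ⟨((p : ℂ_[p]) ^ (n + m)) ^ d,
    pow_ne_zero _ (pow_ne_zero _ prime_ne_zero_padicComplex), ?_⟩
  obtain ⟨φ, hφ, hφx⟩ := exists_trig_eq_indicator hψ (n + m)
  obtain ⟨Φ, hΦ, h⟩ := exists_trig_pi_of_trig (d := d) (ψ := ψ) (n := n) (m := m)
    (c := (p : ℂ_[p]) ^ (n + m)) (by
      rw [norm_pow, norm_prime_padicComplex]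
      exact pow_le_one₀ prime_inv_pos.le prime_inv_lt_one.le) le_rfl
    ⟨φ, hφ, fun x hx => by rw [hφx x hx, sub_self, norm_zero]⟩
  exact ⟨Φ, hΦ, fun x hx => sub_eq_zero.1 (norm_le_zero_iff.1 (h x hx))⟩

end Approximation

/-! ### The ring of integral Heisenberg operators; irreducibility -/

section Operators

variable {p : ℕ} [hp : Fact p.Prime] {d : ℕ} {ψ : SmoothCharacter p}

theorem norm_apply_le_supNorm (f : Schwartz p d) (x : Fin d → ℚ_[p]) :
    ‖f.1 x‖ ≤ supNorm p d f :=
  le_ciSup (bddAbove_norm f) x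

theorem supNorm_le {f : Schwartz p d} {C : ℝ} (h : ∀ x, ‖f.1 x‖ ≤ C) : supNorm p d f ≤ C :=
  ciSup_le h

theorem exists_norm_apply_eq_supNorm (f : Schwartz p d) : ∃ x, ‖f.1 x‖ = supNorm p d f := by
  obtain ⟨x, hx⟩ := f.2.1.continuous.norm.exists_forall_ge_of_hasCompactSupport f.2.2.norm
  exact ⟨x, le_antisymm (norm_apply_le_supNorm f x) (supNorm_le hx)⟩

theorem eq_zero_of_supNorm_eq_zero {f : Schwartz p d} (h : supNorm p d f = 0) : f = 0 := by
  ext x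
  exact norm_le_zero_iff.1 (h ▸ norm_apply_le_supNorm f x)

theorem supNorm_pos {f : Schwartz p d} (h : f ≠ 0) : 0 < supNorm p d f :=
  lt_of_le_of_ne (apply_nonneg _ _) fun h' => h (eq_zero_of_supNorm_eq_zero h'.symm)

theorem schrodinger_apply (h : Heisenberg p d) (f : Schwartz p d) (x : Fin d → ℚ_[p]) :
    (schrodinger ψ d h f).1 x =
      ψ.toAddChar (h.t + 1 / 2 * (fstPart h.w ⬝ᵥ sndPart h.w) + sndPart h.w ⬝ᵥ x)
        * f.1 (x + fstPart h.w) := rfl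

/-- A seminorm that is ultrametric and invariant under the Heisenberg group. -/
structure IsInvariantUltrametric (ψ : SmoothCharacter p) (N : Seminorm ℂ_[p] (Schwartz p d)) :
    Prop where
  add_le_max : ∀ f g, N (f + g) ≤ max (N f) (N g)
  invariant : ∀ (h : Heisenberg p d) (f : Schwartz p d), N (schrodinger ψ d h f) = N f

theorem IsInvariantNorm.isInvariantUltrametric {N : Seminorm ℂ_[p] (Schwartz p d)}
    (h : IsInvariantNorm ψ N) : IsInvariantUltrametric ψ N := ⟨h.add_le_max, h.invariant⟩

theorem isInvariantUltrametric_supNorm : IsInvariantUltrametric ψ (supNorm p d) where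
  add_le_max f g := supNorm_le fun x => (IsUltrametricDist.norm_add_le_max _ _).trans
    (max_le_max (norm_apply_le_supNorm f x) (norm_apply_le_supNorm g x))
  invariant h f := by
    refine le_antisymm (supNorm_le fun x => ?_) (supNorm_le fun x => ?_)
    · rw [schrodinger_apply, norm_mul, ψ.norm_eq_one, one_mul]
      exact norm_apply_le_supNorm f _
    · have := norm_apply_le_supNorm (schrodinger ψ d h f) (x - fstPart h.w)
      rwa [schrodinger_apply, norm_mul, ψ.norm_eq_one, one_mul, sub_add_cancel] at this

/-- The ring of operators generated by the integral scalars and the Heisenberg group. -/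
noncomputable def heisenbergRing (ψ : SmoothCharacter p) (d : ℕ) :
    Subring (Module.End ℂ_[p] (Schwartz p d)) :=
  Subring.closure ({u | ∃ c : ℂ_[p], ‖c‖ ≤ 1 ∧ u = c • 1} ∪ Set.range (schrodinger ψ d))

theorem smul_one_mem_heisenbergRing {c : ℂ_[p]} (hc : ‖c‖ ≤ 1) :
    c • (1 : Module.End ℂ_[p] (Schwartz p d)) ∈ heisenbergRing ψ d :=
  Subring.subset_closure (Or.inl ⟨c, hc, rfl⟩)

theorem schrodinger_mem_heisenbergRing (h : Heisenberg p d) :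
    schrodinger ψ d h ∈ heisenbergRing ψ d :=
  Subring.subset_closure (Or.inr ⟨h, rfl⟩)

theorem smul_mem_heisenbergRing {c : ℂ_[p]} (hc : ‖c‖ ≤ 1)
    {u : Module.End ℂ_[p] (Schwartz p d)} (hu : u ∈ heisenbergRing ψ d) :
    c • u ∈ heisenbergRing ψ d := by
  have := mul_mem (smul_one_mem_heisenbergRing (ψ := ψ) (d := d) hc) hu
  rwa [smul_mul_assoc, one_mul] at this

theorem heisenbergRing_induction {P : Module.End ℂ_[p] (Schwartz p d) → Prop}
    (hc : ∀ c : ℂ_[p], ‖c‖ ≤ 1 → P (c • 1)) (hρ : ∀ h, P (schrodinger ψ d h))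
    (hadd : ∀ u v, P u → P v → P (u + v)) (hmul : ∀ u v, P u → P v → P (u * v))
    {u : Module.End ℂ_[p] (Schwartz p d)} (hu : u ∈ heisenbergRing ψ d) : P u := by
  induction hu using Subring.closure_induction with
  | mem u h =>
    rcases h with ⟨c, h, rfl⟩ | ⟨h, rfl⟩
    · exact hc c h
    · exact hρ h
  | zero => simpa using hc 0 (by simp)
  | one => simpa using hc 1 (by simp)
  | add f g _ _ hf hg => exact hadd f g hf hg
  | mul f g _ _ hf hg => exact hmul f g hf hg
  | neg f _ hf =>
    have := hmul _ _ (hc (-1) (by simp)) hf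
    rw [smul_one_mul] at this
    convert this using 1
    exact LinearMap.ext fun g => (neg_one_smul ℂ_[p] (f g)).symm

theorem IsInvariantUltrametric.apply_le {N : Seminorm ℂ_[p] (Schwartz p d)}
    (hN : IsInvariantUltrametric ψ N) {u : Module.End ℂ_[p] (Schwartz p d)}
    (hu : u ∈ heisenbergRing ψ d) (f : Schwartz p d) : N (u f) ≤ N f := by
  revert f
  refine heisenbergRing_induction (P := fun u => ∀ f, N (u f) ≤ N f) ?_ ?_ ?_ ?_ hu
  · intro c hc f
    rw [LinearMap.smul_apply, Module.End.one_apply, map_smul_eq_mul]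
    exact mul_le_of_le_one_left (apply_nonneg _ _) hc
  · exact fun h f => (hN.invariant h f).le
  · exact fun u v hu hv f => (hN.add_le_max _ _).trans (max_le (hu f) (hv f))
  · exact fun u v hu hv f => (hu _).trans (hv f)

theorem mem_of_mem_heisenbergRing {W : Submodule ℂ_[p] (Schwartz p d)}
    (hW : ∀ h, ∀ f ∈ W, schrodinger ψ d h f ∈ W) {u : Module.End ℂ_[p] (Schwartz p d)}
    (hu : u ∈ heisenbergRing ψ d) {f : Schwartz p d} (hf : f ∈ W) : u f ∈ W := by
  revert f
  refine heisenbergRing_induction (P := fun u => ∀ {f}, f ∈ W → u f ∈ W) ?_ ?_ ?_ ?_ hu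
  · exact fun c _ f hf => W.smul_mem c hf
  · exact fun h f hf => hW h f hf
  · exact fun u v hu hv f hf => W.add_mem (hu hf) (hv hf)
  · exact fun u v hu hv f hf => hu (hv hf)

/-- Conjugation by `T` permutes the Heisenberg operators and fixes scalars. It transports statements
about the sup norm to `‖T ·‖_∞`. -/
theorem IsIntertwining.exists_conj {g : Matrix.symplecticGroup (Fin d) ℚ_[p]}
    {T : Schwartz p d ≃ₗ[ℂ_[p]] Schwartz p d} (hT : IsIntertwining ψ g T)
    {u : Module.End ℂ_[p] (Schwartz p d)} (hu : u ∈ heisenbergRing ψ d) :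
    ∃ v ∈ heisenbergRing ψ d, ∀ f, T (v f) = u (T f) := by
  refine heisenbergRing_induction
    (P := fun u => ∃ v ∈ heisenbergRing ψ d, ∀ f, T (v f) = u (T f)) ?_ ?_ ?_ ?_ hu
  · exact fun c hc => ⟨_, smul_one_mem_heisenbergRing hc, fun f => by simp⟩
  · exact fun h => ⟨_, schrodinger_mem_heisenbergRing _, fun f => (hT h f).symm⟩
  · rintro u v ⟨u', hu, hu'⟩ ⟨v', hv, hv'⟩
    exact ⟨_, add_mem hu hv, fun f => by simp [hu', hv']⟩
  · rintro u v ⟨u', hu, hu'⟩ ⟨v', hv, hv'⟩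
    exact ⟨_, mul_mem hu hv, fun f => by simp [hu', hv']⟩

theorem Heisenberg.act_mul (h : Heisenberg p d)
    (g g' : Matrix (Fin d ⊕ Fin d) (Fin d ⊕ Fin d) ℚ_[p]) :
    h.act (g * g') = (h.act g).act g' := by
  simp [Heisenberg.act, Matrix.vecMul_vecMul]

theorem Heisenberg.act_one (h : Heisenberg p d) : h.act 1 = h := by
  simp [Heisenberg.act]

theorem IsIntertwining.mul {g g' : Matrix.symplecticGroup (Fin d) ℚ_[p]}
    {T T' : Schwartz p d ≃ₗ[ℂ_[p]] Schwartz p d} (hT : IsIntertwining ψ g T)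
    (hT' : IsIntertwining ψ g' T') : IsIntertwining ψ (g * g') (T'.trans T) := by
  intro h f
  rw [LinearEquiv.trans_apply, hT, hT', LinearEquiv.trans_apply, ← Heisenberg.act_mul]
  rfl

theorem IsIntertwining.inv {g : Matrix.symplecticGroup (Fin d) ℚ_[p]}
    {T : Schwartz p d ≃ₗ[ℂ_[p]] Schwartz p d} (hT : IsIntertwining ψ g T) :
    IsIntertwining ψ g⁻¹ T.symm := by
  intro h f
  rw [LinearEquiv.eq_symm_apply]
  have h1 := hT (h.act g⁻¹.1) (T.symm f)
  rw [← Heisenberg.act_mul, LinearEquiv.apply_symm_apply] at h1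
  have h2 : g⁻¹.1 * g.1 = 1 := congrArg Subtype.val (inv_mul_cancel g)
  rw [h2, Heisenberg.act_one] at h1
  exact h1.symm

theorem IsInvariantUltrametric.comp {g : Matrix.symplecticGroup (Fin d) ℚ_[p]}
    {T : Schwartz p d ≃ₗ[ℂ_[p]] Schwartz p d} (hT : IsIntertwining ψ g T)
    {N : Seminorm ℂ_[p] (Schwartz p d)} (hN : IsInvariantUltrametric ψ N) :
    IsInvariantUltrametric ψ (N.comp T.toLinearMap) where
  add_le_max f f' := by
    change N (T (f + f')) ≤ _
    rw [map_add]
    exact hN.add_le_max _ _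
  invariant h f := by
    change N (T _) = N (T f)
    have h1 := hT (h.act g⁻¹.1) f
    have h2 : g⁻¹.1 * g.1 = 1 := congrArg Subtype.val (inv_mul_cancel g)
    rw [← Heisenberg.act_mul, h2, Heisenberg.act_one] at h1
    rw [← h1, hN.invariant]

theorem exists_mem_heisenbergRing_mul {Φ : (Fin d → ℚ_[p]) → ℂ_[p]}
    (hΦ : Φ ∈ trigRing ψ (Fin d → ℚ_[p])) :
    ∃ u ∈ heisenbergRing ψ d, ∀ f x, (u f).1 x = Φ x * f.1 x := by
  refine trigRing_induction
    (P := fun Φ => ∃ u ∈ heisenbergRing ψ d, ∀ f x, (u f).1 x = Φ x * f.1 x) ?_ ?_ ?_ ?_ hΦ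
  · exact fun c hc => ⟨_, smul_one_mem_heisenbergRing hc, fun f x => rfl⟩
  · intro l
    refine ⟨_, schrodinger_mem_heisenbergRing
      ⟨Sum.elim 0 fun i => l fun j => if i = j then 1 else 0, 0⟩, fun f x => ?_⟩
    have h1 : fstPart (Sum.elim (0 : Fin d → ℚ_[p]) fun i => l fun j => if i = j then 1 else 0) = 0 :=
      rfl
    have h2 : sndPart (Sum.elim (0 : Fin d → ℚ_[p]) fun i => l fun j => if i = j then 1 else 0) =
      fun i => l fun j => if i = j then 1 else 0 := rfl
    change _ = ψ.toAddChar (l x) * _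
    rw [schrodinger_apply, h1, h2, LinearMap.pi_apply_eq_sum_univ l x, zero_dotProduct, mul_zero,
      add_zero, zero_add, add_zero, dotProduct]
    simp only [smul_eq_mul, mul_comm]
  · rintro f g ⟨u, hu, hu'⟩ ⟨v, hv, hv'⟩
    refine ⟨_, add_mem hu hv, fun F x => ?_⟩
    change (u F).1 x + (v F).1 x = (f x + g x) * _
    rw [hu', hv', add_mul]
  · rintro f g ⟨u, hu, hu'⟩ ⟨v, hv, hv'⟩
    refine ⟨_, mul_mem hu hv, fun F x => ?_⟩
    change (u (v F)).1 x = f x * g x * _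
    rw [hu', hv', mul_assoc]

theorem exists_mem_heisenbergRing_translate (a : Fin d → ℚ_[p]) :
    ∃ u ∈ heisenbergRing ψ d, ∀ f x, (u f).1 x = f.1 (x + a) := by
  refine ⟨_, schrodinger_mem_heisenbergRing ⟨Sum.elim a 0, 0⟩, fun f x => ?_⟩
  have h1 : fstPart (Sum.elim a (0 : Fin d → ℚ_[p])) = a := rfl
  have h2 : sndPart (Sum.elim a (0 : Fin d → ℚ_[p])) = 0 := rfl
  rw [schrodinger_apply, h1, h2]
  simp

theorem exists_forall_norm_gt_eq_zero (f : Schwartz p d) :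
    ∃ m : ℕ, ∀ m' ≥ m, ∀ x, (p : ℝ) ^ m' < ‖x‖ → f.1 x = 0 := by
  obtain ⟨R, hR⟩ := f.2.2.isCompact.isBounded.exists_norm_le
  have hp1 : (1 : ℝ) < p := by exact_mod_cast hp.out.one_lt
  obtain ⟨m, hm⟩ := pow_unbounded_of_one_lt R hp1
  refine ⟨m, fun m' hm' x hx => image_eq_zero_of_notMem_tsupport fun h => ?_⟩
  have h1 := hR x h
  have h2 : (p : ℝ) ^ m ≤ p ^ m' := pow_le_pow_right₀ hp1.le hm'
  linarith

theorem exists_level (f : Schwartz p d) :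
    ∃ n : ℕ, ∀ n' ≥ n, ∀ x y, ‖x - y‖ ≤ (p : ℝ)⁻¹ ^ n' → f.1 x = f.1 y := by
  obtain ⟨m, hm⟩ := exists_forall_norm_gt_eq_zero f
  have hm := hm m le_rfl
  have hK : IsCompact (Metric.closedBall (0 : Fin d → ℚ_[p]) ((p : ℝ) ^ m)) :=
    isCompact_closedBall _ _
  obtain ⟨ε, hε, h⟩ := lebesgue_number_lemma_of_metric (c := fun z : ℂ_[p] => f.1 ⁻¹' {z}) hK
    (fun z => f.2.1.isOpen_fiber z) fun x _ => Set.mem_iUnion.2 ⟨f.1 x, rfl⟩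
  obtain ⟨n, hn⟩ := exists_pow_lt_of_lt_one hε (prime_inv_lt_one (p := p))
  refine ⟨n, fun n' hn' x y hxy => ?_⟩
  have h1 : (p : ℝ)⁻¹ ^ n' ≤ (p : ℝ)⁻¹ ^ n :=
    pow_le_pow_of_le_one prime_inv_pos.le prime_inv_lt_one.le hn'
  have h2 : (p : ℝ)⁻¹ ^ n' ≤ (p : ℝ) ^ m := by
    refine (pow_le_one₀ prime_inv_pos.le prime_inv_lt_one.le).trans (one_le_pow₀ ?_)
    exact_mod_cast hp.out.one_lt.le
  by_cases hx : ‖x‖ ≤ (p : ℝ) ^ m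
  · obtain ⟨z, hz⟩ := h x (by simpa using hx)
    have h3 := hz (Metric.mem_ball_self hε)
    have h4 := hz (show y ∈ Metric.ball x ε by
      rw [mem_ball_iff_norm, norm_sub_rev]
      linarith)
    exact h3.trans h4.symm
  · rw [hm x (not_le.1 hx), hm y (not_le.1 fun hy =>
      hx ((norm_le_iff_of_norm_sub_le (hxy.trans h2)).2 hy))]

theorem exists_finset_existsUnique {X : Type*} [PseudoMetricSpace X] [IsUltrametricDist X]
    {s : Set X} (hs : IsCompact s) {r : ℝ} (hr : 0 < r) :
    ∃ F : Finset X, ∀ x ∈ s, ∃! a, a ∈ F ∧ dist x a ≤ r := by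
  classical
  obtain ⟨t, -, ht, hst⟩ := hs.finite_cover_balls hr
  have hne : ∀ a : X, (Metric.closedBall a r).Nonempty := fun a =>
    ⟨a, Metric.mem_closedBall_self hr.le⟩
  have hsymm : ∀ {x y : X}, dist x y ≤ r → Metric.closedBall x r = Metric.closedBall y r :=
    fun h => (IsUltrametricDist.closedBall_eq_of_mem (Metric.mem_closedBall.2 h)).symm
  -- The chosen point depends only on the ball as a set, so equal balls receive the same centre and
  -- uniqueness holds.
  let σ : X → X := fun a => (hne a).choose
  have hσ : ∀ a, dist (σ a) a ≤ r := fun a => (hne a).choose_spec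
  refine ⟨ht.toFinset.image σ, fun x hx => ?_⟩
  obtain ⟨b, hb, hxb⟩ := Set.mem_iUnion₂.1 (hst hx)
  have hxb' : dist x b ≤ r := (Metric.mem_ball.1 hxb).le
  refine ⟨σ b, ⟨Finset.mem_image_of_mem _ (ht.mem_toFinset.2 hb), ?_⟩, ?_⟩
  · have : σ b ∈ Metric.closedBall x r := by
      rw [hsymm hxb']
      exact hσ b
    rwa [Metric.mem_closedBall, dist_comm] at this
  · rintro y ⟨hy, hxy⟩
    obtain ⟨c, -, rfl⟩ := Finset.mem_image.1 hy
    have h1 : Metric.closedBall c r = Metric.closedBall b r := by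
      rw [← hsymm (hσ c), ← hsymm hxb', ← hsymm hxy]
    simp only [σ, h1]

/-- An approximate multiple of the indicator of a small ball in the trigonometric ring produces
approximate multiples of any given function. -/
theorem exists_mem_heisenbergRing_near_of_trig (f g : Schwartz p d) (x₀ : Fin d → ℚ_[p])
    (hg : ∀ x, ‖g.1 x‖ ≤ 1) : ∃ n m : ℕ, ∀ (c : ℂ_[p]) (ε : ℝ), 0 ≤ ε →
      ∀ Φ ∈ trigRing ψ (Fin d → ℚ_[p]), (∀ x : Fin d → ℚ_[p], ‖x‖ ≤ (p : ℝ) ^ m →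
        ‖Φ x - if ‖x‖ ≤ (p : ℝ)⁻¹ ^ n then c else 0‖ ≤ ε) →
      ∃ u ∈ heisenbergRing ψ d, ∀ x, ‖(u f).1 x - f.1 x₀ * c * g.1 x‖ ≤ ε * supNorm p d f := by
  obtain ⟨u₀, hu₀, hu₀f⟩ := exists_mem_heisenbergRing_translate (ψ := ψ) x₀
  obtain ⟨n₁, hn₁⟩ := exists_level (u₀ f)
  obtain ⟨n₂, hn₂⟩ := exists_level g
  obtain ⟨m₁, hm₁⟩ := exists_forall_norm_gt_eq_zero (u₀ f)
  obtain ⟨m₂, hm₂⟩ := exists_forall_norm_gt_eq_zero g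
  set n := max n₁ n₂
  set m := max m₁ m₂
  replace hn₁ := hn₁ n (le_max_left _ _)
  replace hn₂ := hn₂ n (le_max_right _ _)
  replace hm₁ := hm₁ m (le_max_left _ _)
  replace hm₂ := hm₂ m (le_max_right _ _)
  refine ⟨n, m, fun c ε hε Φ hΦ hΦx => ?_⟩
  obtain ⟨u₁, hu₁, hu₁f⟩ := exists_mem_heisenbergRing_mul hΦ
  have hpn : (0 : ℝ) < (p : ℝ)⁻¹ ^ n := pow_pos prime_inv_pos _
  have hεf : 0 ≤ ε * supNorm p d f := mul_nonneg hε (apply_nonneg _ _)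
  obtain ⟨F, hF⟩ := exists_finset_existsUnique
    (isCompact_closedBall (0 : Fin d → ℚ_[p]) ((p : ℝ) ^ m)) hpn
  choose τ hτ hτf using fun a => exists_mem_heisenbergRing_translate (ψ := ψ) (d := d) (-a)
  -- Move `x₀` to the origin, cut out the ball around 0, then spread the resulting bump over the
  -- balls of the same radius with weights `g a`.
  refine ⟨∑ a ∈ F, g.1 a • (τ a * u₁ * u₀), sum_mem fun a _ =>
    smul_mem_heisenbergRing (hg a) (mul_mem (mul_mem (hτ a) hu₁) hu₀), fun x => ?_⟩
  have h0 : (u₀ f).1 0 = f.1 x₀ := by rw [hu₀f, zero_add]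
  have key : ∀ x, ‖(u₁ (u₀ f)).1 x - f.1 x₀ * c * (if ‖x‖ ≤ (p : ℝ)⁻¹ ^ n then 1 else 0)‖ ≤
      ε * supNorm p d f := by
    intro x
    rw [hu₁f]
    by_cases hx : ‖x‖ ≤ (p : ℝ) ^ m
    · have h1 : (u₀ f).1 x * (if ‖x‖ ≤ (p : ℝ)⁻¹ ^ n then c else 0) =
          f.1 x₀ * c * (if ‖x‖ ≤ (p : ℝ)⁻¹ ^ n then 1 else 0) := by
        split_ifs with h
        · rw [hn₁ x 0 (by simpa using h), h0, mul_one]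
        · simp
      rw [← h1, mul_comm (Φ x), ← mul_sub, norm_mul, mul_comm]
      refine mul_le_mul (hΦx x hx) ?_ (norm_nonneg _) hε
      rw [hu₀f]
      exact norm_apply_le_supNorm f _
    · have h1 : (u₀ f).1 x = 0 := hm₁ x (not_le.1 hx)
      rw [h1, mul_zero, zero_sub, norm_neg]
      split_ifs with h
      · rw [← h0, ← hn₁ x 0 (by simpa using h), h1, zero_mul, zero_mul, norm_zero]
        exact hεf
      · simpa using hεf
  have h1 : ((∑ a ∈ F, g.1 a • (τ a * u₁ * u₀)) f).1 x =
      ∑ a ∈ F, g.1 a * (u₁ (u₀ f)).1 (x + -a) := by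
    rw [LinearMap.sum_apply, AddSubmonoidClass.coe_finsetSum, Finset.sum_apply]
    refine Finset.sum_congr rfl fun a _ => ?_
    change g.1 a * (τ a (u₁ (u₀ f))).1 x = _
    rw [hτf]
  have h2 : g.1 x = ∑ a ∈ F, g.1 a * (if ‖x + -a‖ ≤ (p : ℝ)⁻¹ ^ n then 1 else 0) := by
    by_cases hx : ‖x‖ ≤ (p : ℝ) ^ m
    · obtain ⟨a, ⟨haF, hxa⟩, ha⟩ := hF x (by simpa using hx)
      rw [Finset.sum_eq_single_of_mem a haF]
      · rw [← sub_eq_add_neg, ← dist_eq_norm, if_pos hxa, mul_one]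
        exact hn₂ x a (by rwa [← dist_eq_norm])
      · intro b hb hba
        rw [if_neg, mul_zero]
        rw [← sub_eq_add_neg, ← dist_eq_norm]
        exact fun h => hba (ha b ⟨hb, h⟩)
    · rw [hm₂ x (not_le.1 hx)]
      refine (Finset.sum_eq_zero fun a _ => ?_).symm
      split_ifs with h
      · rw [← sub_eq_add_neg] at h
        rw [← hn₂ x a h, hm₂ x (not_le.1 hx), zero_mul]
      · rw [mul_zero]
  rw [h1, h2, Finset.mul_sum, ← Finset.sum_sub_distrib]
  refine norm_sum_le_of_forall _ _ hεf fun a _ => ?_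
  rw [mul_left_comm, ← mul_sub, norm_mul]
  exact (mul_le_of_le_one_left (norm_nonneg _) (hg a)).trans (key _)

/-- The essential point is that the loss `p^(2d)` is independent of `f`, `g` and `ε`: a single large
value of `f` controls every integral `g`. -/
theorem exists_mem_heisenbergRing_near (hψ : ψ.toAddChar ≠ 1) (f g : Schwartz p d)
    (x₀ : Fin d → ℚ_[p]) (hg : ∀ x, ‖g.1 x‖ ≤ 1) {ε : ℝ} (hε : 0 < ε) :
    ∃ u ∈ heisenbergRing ψ d, supNorm p d (u f - (f.1 x₀ * ((p : ℂ_[p]) ^ 2) ^ d) • g) ≤ ε := by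
  obtain ⟨n, m, h⟩ := exists_mem_heisenbergRing_near_of_trig (ψ := ψ) f g x₀ hg
  have hpos : 0 < supNorm p d f + 1 := by
    have := apply_nonneg (supNorm p d) f
    linarith
  obtain ⟨Φ, hΦ, hΦx⟩ := exists_trig_pi_near_indicator (d := d) hψ n m (div_pos hε hpos)
  obtain ⟨u, hu, hux⟩ := h _ _ (div_pos hε hpos).le Φ hΦ hΦx
  refine ⟨u, hu, supNorm_le fun x => (hux x).trans ?_⟩
  rw [div_mul_eq_mul_div, div_le_iff₀ hpos]
  exact mul_le_mul_of_nonneg_left (by linarith) hε.le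

/-- Irreducibility of the Schrödinger representation. -/
theorem eq_top_of_invariant (hψ : ψ.toAddChar ≠ 1) {W : Submodule ℂ_[p] (Schwartz p d)}
    (hW : ∀ h, ∀ f ∈ W, schrodinger ψ d h f ∈ W) (hW0 : W ≠ ⊥) : W = ⊤ := by
  obtain ⟨f, hf, hf0⟩ := W.exists_mem_ne_zero_of_ne_bot hW0
  obtain ⟨x₀, hx₀⟩ : ∃ x₀, f.1 x₀ ≠ 0 := by
    by_contra! h
    exact hf0 (by ext x; exact h x)
  have key : ∀ g : Schwartz p d, (∀ x, ‖g.1 x‖ ≤ 1) → g ∈ W := by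
    intro g hg
    obtain ⟨n, m, h⟩ := exists_mem_heisenbergRing_near_of_trig (ψ := ψ) f g x₀ hg
    obtain ⟨c, hc, Φ, hΦ, hΦx⟩ := exists_trig_pi_eq_indicator (d := d) hψ n m
    obtain ⟨u, hu, hux⟩ := h c 0 le_rfl Φ hΦ fun x hx => by rw [hΦx x hx, sub_self, norm_zero]
    have h1 : g = (f.1 x₀ * c)⁻¹ • u f := by
      ext x
      have h2 := hux x
      rw [zero_mul, norm_le_zero_iff, sub_eq_zero] at h2
      change g.1 x = (f.1 x₀ * c)⁻¹ * (u f).1 x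
      rw [h2, inv_mul_cancel_left₀ (mul_ne_zero hx₀ hc)]
    rw [h1]
    exact W.smul_mem _ (mem_of_mem_heisenbergRing hW hu hf)
  rw [eq_top_iff]
  intro g _
  obtain ⟨c, hc⟩ := NormedField.exists_lt_norm ℂ_[p] (supNorm p d g)
  have hc0 : c ≠ 0 := norm_pos_iff.1 ((apply_nonneg _ _).trans_lt hc)
  have h1 := key (c⁻¹ • g) fun x => by
    change ‖c⁻¹ * g.1 x‖ ≤ 1
    rw [norm_mul, norm_inv, inv_mul_le_iff₀ (norm_pos_iff.2 hc0), mul_one]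
    exact (norm_apply_le_supNorm g x).trans hc.le
  have h2 := W.smul_mem c h1
  rwa [smul_inv_smul₀ hc0] at h2

end Operators

/-! ### Separating the sup norm from its transform under a non-Siegel element -/

section Separation

variable {p : ℕ} [hp : Fact p.Prime] {d : ℕ} {ψ : SmoothCharacter p}

/-- The element `[s (0, b), 0]` of the Heisenberg group, `b` the `i`-th unit vector. -/
noncomputable def Heisenberg.modulation (i : Fin d) (s : ℚ_[p]) : Heisenberg p d :=
  ⟨s • Pi.single (Sum.inr i) 1, 0⟩

theorem schrodinger_modulation_apply (i : Fin d) (s : ℚ_[p]) (f : Schwartz p d)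
    (x : Fin d → ℚ_[p]) :
    (schrodinger ψ d (Heisenberg.modulation i s) f).1 x = ψ.toAddChar (s * x i) * f.1 x := by
  have h1 : fstPart (Heisenberg.modulation (p := p) i s).w = 0 := by
    ext j
    simp [fstPart, Heisenberg.modulation]
  have h2 : sndPart (Heisenberg.modulation (p := p) i s).w = s • Pi.single i 1 := by
    ext j
    simp [sndPart, Heisenberg.modulation, Pi.single_apply]
  have h3 : (Heisenberg.modulation (p := p) i s).t = 0 := rfl
  rw [schrodinger_apply, h1, h2, h3]
  simp

theorem norm_schrodinger_act_modulation_apply (g : Matrix.symplecticGroup (Fin d) ℚ_[p])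
    (i : Fin d) (s : ℚ_[p]) (f : Schwartz p d) (x : Fin d → ℚ_[p]) :
    ‖(schrodinger ψ d ((Heisenberg.modulation i s).act g.1) f).1 x‖ =
      ‖f.1 (x + s • g.1.toBlocks₂₁ i)‖ := by
  have h1 : fstPart ((Heisenberg.modulation (p := p) i s).act g.1).w = s • g.1.toBlocks₂₁ i := by
    ext j
    simp [fstPart, Heisenberg.modulation, Heisenberg.act, Matrix.smul_vecMul, Matrix.toBlocks₂₁]
  rw [schrodinger_apply, norm_mul, ψ.norm_eq_one, one_mul, h1]

/-- Apply the monic polynomial `W`, with zeros `ζ ^ v` for `v < p^M`, to the operator of `[s(0,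
e_i), 0] g`. After `T` it multiplies by `W(ψ(s x_i))`, which is tiny on the support of `T f`, where
`ψ(s x_i)` is a power of `ζ`. Before `T` it combines translates of `f` by multiples of `s a`, where
`a` is a nonzero row of the lower left block; for large `s` the leading translate keeps its full
size somewhere. -/
theorem exists_le_supNorm_and_supNorm_le (hψ : ψ.toAddChar ≠ 1)
    {g : Matrix.symplecticGroup (Fin d) ℚ_[p]} (hg : g ∉ siegelParabolic p d)
    {T : Schwartz p d ≃ₗ[ℂ_[p]] Schwartz p d} (hT : IsIntertwining ψ g T) (f : Schwartz p d)
    {ε : ℝ} (hε : 0 < ε) :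
    ∃ u ∈ heisenbergRing ψ d, supNorm p d f ≤ supNorm p d (u f) ∧ supNorm p d (T (u f)) ≤ ε := by
  have hp1 : (1 : ℝ) < p := by exact_mod_cast hp.out.one_lt
  have hp0 : (0 : ℝ) < p := zero_lt_one.trans hp1
  have hC : g.1.toBlocks₂₁ ≠ 0 := hg
  obtain ⟨i, j, hij⟩ : ∃ i j, g.1.toBlocks₂₁ i j ≠ 0 := by
    by_contra! h
    exact hC (by ext i j; exact h i j)
  set a := g.1.toBlocks₂₁ i with ha
  obtain ⟨m, hm⟩ := exists_forall_norm_gt_eq_zero f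
  obtain ⟨m₁, hm₁⟩ := exists_forall_norm_gt_eq_zero (T f)
  replace hm := hm m le_rfl
  replace hm₁ := hm₁ m₁ le_rfl
  obtain ⟨y, hy0, hy⟩ := SmoothCharacter.exists_isPrimitiveRoot hψ
  have haj : 0 < ‖a j‖ := norm_pos_iff.2 hij
  obtain ⟨m', hm'⟩ := pow_unbounded_of_one_lt ((p : ℝ) ^ m / ‖a j‖) hp1
  obtain ⟨m₂, hm₂⟩ := pow_unbounded_of_one_lt ‖y‖⁻¹ hp1
  have hTf : 0 < supNorm p d (T f) + 1 := by
    have := apply_nonneg (supNorm p d) (T f)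
    linarith
  obtain ⟨N, hN⟩ := exists_pow_lt_of_lt_one (div_pos hε hTf) (prime_inv_lt_one (p := p))
  -- The order of `ζ` is `p^(k+1)` with `k + 1 = M + A` and `A` independent of `M`. A shell
  -- therefore contributes `σ` with `σ ^ p^A = 1/p`, and the `M = p^A (N + 1)` shells give
  -- `p^(-(N+1))`.
  set A := m' + m₁ + m₂ + 2 with hA
  set M := p ^ A * (N + 1) with hM
  have hM0 : 0 < M := Nat.mul_pos (pow_pos hp.out.pos _) N.succ_pos
  set k := M + 1 + m' + m₁ + m₂ with hk
  obtain ⟨hζ, hy⟩ := hy k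
  set ζ := ψ.toAddChar (y / (p : ℚ_[p]) ^ k) with hζdef
  have hζ1 : ‖ζ‖ = 1 := ψ.norm_eq_one _
  set s := ((p : ℚ_[p]) ^ (M + 1 + m'))⁻¹ with hs
  have hsn : ‖s‖ = (p : ℝ) ^ (M + 1 + m') := by
    rw [hs, norm_inv, norm_prime_pow, inv_pow, inv_inv]
  set W : Polynomial (unitBallSubring ℂ_[p]) := ∏ v ∈ Finset.range (p ^ M),
    (Polynomial.X - Polynomial.C (⟨ζ ^ v, by rw [mem_unitBallSubring, norm_pow, hζ1, one_pow]⟩ :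
      unitBallSubring ℂ_[p])) with hW
  have hWdeg : W.natDegree = p ^ M := by
    rw [hW, Polynomial.natDegree_finsetProd_X_sub_C_eq_card, Finset.card_range]
  have hWmon : W.Monic := Polynomial.monic_prod_of_monic _ _ fun v _ => Polynomial.monic_X_sub_C _
  have hWz : ∀ z : ℂ_[p], Polynomial.aeval z W = ∏ v ∈ Finset.range (p ^ M), (z - ζ ^ v) := by
    intro z
    rw [hW, map_prod]
    refine Finset.prod_congr rfl fun v _ => ?_
    rw [map_sub, Polynomial.aeval_X, Polynomial.aeval_C]
    rfl
  set u : Module.End ℂ_[p] (Schwartz p d) := ∑ l ∈ Finset.range (p ^ M + 1),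
    (W.coeff l : ℂ_[p]) • schrodinger ψ d ((Heisenberg.modulation i ((l : ℚ_[p]) * s)).act g.1) with hu
  have huf : ∀ F x, (u F).1 x = ∑ l ∈ Finset.range (p ^ M + 1), (W.coeff l : ℂ_[p]) *
      (schrodinger ψ d ((Heisenberg.modulation i ((l : ℚ_[p]) * s)).act g.1) F).1 x := by
    intro F x
    rw [hu, LinearMap.sum_apply, AddSubmonoidClass.coe_finsetSum, Finset.sum_apply]
    rfl
  refine ⟨u, sum_mem fun l _ => smul_mem_heisenbergRing (W.coeff l).2
    (schrodinger_mem_heisenbergRing _), ?_, supNorm_le fun x => ?_⟩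
  · obtain ⟨x₀, hx₀⟩ := exists_norm_apply_eq_supNorm f
    rw [← hx₀]
    by_cases hf0 : f.1 x₀ = 0
    · rw [hf0, norm_zero]
      exact apply_nonneg _ _
    have hx₀m : ‖x₀‖ ≤ (p : ℝ) ^ m := not_lt.1 fun h => hf0 (hm _ h)
    refine le_trans (le_of_eq ?_) (norm_apply_le_supNorm (u f) (x₀ - ((p ^ M : ℕ) * s) • a))
    -- For `l < p^M` the integer `p^M - l` has norm larger than `p^(-(M+1))`, so the term of index
    -- `l` evaluates `f` outside the ball of radius `p^m` that contains its support.
    rw [huf, Finset.sum_eq_single_of_mem (p ^ M) (by simp)]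
    · rw [norm_mul, norm_schrodinger_act_modulation_apply, ← hWdeg, hWmon.coeff_natDegree]
      rw [OneMemClass.coe_one, norm_one, one_mul, hWdeg, ← ha, sub_add_cancel]
    · intro l hl hlM
      rw [Finset.mem_range] at hl
      have hlM : l < p ^ M := by omega
      refine mul_eq_zero_of_right _ (norm_eq_zero.1 ?_)
      rw [norm_schrodinger_act_modulation_apply, norm_eq_zero]
      refine hm _ ?_
      have h1 : x₀ - ((p ^ M : ℕ) * s : ℚ_[p]) • a + ((l : ℚ_[p]) * s) • a =
          x₀ - (((p ^ M - l : ℕ) : ℚ_[p]) * s) • a := by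
        rw [Nat.cast_sub hlM.le, sub_mul, sub_smul]
        abel
      rw [← ha, h1]
      have h2 : (p : ℝ) ^ m < ‖(((p ^ M - l : ℕ) : ℚ_[p]) * s) • a‖ := by
        have h3 : (p : ℝ)⁻¹ ^ (M + 1) < ‖((p ^ M - l : ℕ) : ℚ_[p])‖ := by
          rw [← not_le, norm_natCast_le_iff]
          refine Nat.not_dvd_of_pos_of_lt (by omega) ?_
          exact (Nat.sub_le _ _).trans_lt (Nat.pow_lt_pow_right hp.out.one_lt (Nat.lt_succ_self M))
        rw [div_lt_iff₀ haj] at hm'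
        calc (p : ℝ) ^ m < p ^ m' * ‖a j‖ := hm'
          _ = (p : ℝ)⁻¹ ^ (M + 1) * ‖s‖ * ‖a j‖ := by
              rw [hsn, pow_add _ (M + 1), inv_pow,
                inv_mul_cancel_left₀ (pow_pos hp0 _).ne']
          _ ≤ ‖((p ^ M - l : ℕ) : ℚ_[p])‖ * ‖s‖ * ‖a j‖ := by gcongr
          _ = ‖((((p ^ M - l : ℕ) : ℚ_[p]) * s) • a) j‖ := by
              rw [Pi.smul_apply, smul_eq_mul, norm_mul, norm_mul]
          _ ≤ _ := norm_le_pi_norm _ j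
      refine not_le.1 fun h => h2.not_ge ?_
      have := norm_sub_le_of_le_of_le hx₀m h
      rwa [sub_sub_cancel] at this
  · have h1 : (T (u f)).1 x = Polynomial.aeval (ψ.toAddChar (s * x i)) W * (T f).1 x := by
      rw [Polynomial.aeval_eq_sum_range, hWdeg, Finset.sum_mul, hu, LinearMap.sum_apply, map_sum,
        AddSubmonoidClass.coe_finsetSum, Finset.sum_apply]
      refine Finset.sum_congr rfl fun l _ => ?_
      rw [LinearMap.smul_apply, map_smul, ← hT]
      change (W.coeff l : ℂ_[p]) * (schrodinger ψ d (Heisenberg.modulation i ((l : ℚ_[p]) * s)) (T f)).1 x =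
        (W.coeff l : ℂ_[p]) * _ * _
      rw [schrodinger_modulation_apply, mul_assoc _ s, ← nsmul_eq_mul, AddChar.map_nsmul_eq_pow,
        mul_assoc]
    rw [h1]
    by_cases hx : ‖x‖ ≤ (p : ℝ) ^ m₁
    swap
    · rw [hm₁ x (not_le.1 hx), mul_zero, norm_zero]
      exact hε.le
    set z := s * x i * (p : ℚ_[p]) ^ k / y with hz
    have hz1 : ‖z‖ ≤ 1 := by
      rw [hz, norm_div, norm_mul, norm_mul, hsn, norm_prime_pow, div_eq_mul_inv]
      calc (p : ℝ) ^ (M + 1 + m') * ‖x i‖ * (p : ℝ)⁻¹ ^ k * ‖y‖⁻¹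
          ≤ (p : ℝ) ^ (M + 1 + m') * (p : ℝ) ^ m₁ * (p : ℝ)⁻¹ ^ k * (p : ℝ) ^ m₂ := by
            gcongr
            exact (norm_le_pi_norm x i).trans hx
        _ = 1 := by
            rw [mul_right_comm, ← pow_add, ← pow_add, ← hk, ← mul_pow, mul_inv_cancel₀ hp0.ne',
              one_pow]
    obtain ⟨b, -, hb⟩ := exists_nat_norm_sub_le hz1 (k + 1)
    have h2 : ψ.toAddChar (s * x i) = ζ ^ b := by
      have h3 : s * x i = y / (p : ℚ_[p]) ^ k * (z - b) + b • (y / (p : ℚ_[p]) ^ k) := by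
        have := pow_ne_zero k (prime_ne_zero_padic (p := p))
        rw [hz, nsmul_eq_mul]
        field_simp
        ring
      rw [h3, AddChar.map_add_eq_mul, hy _ hb, one_mul, AddChar.map_nsmul_eq_pow]
    -- With `n = 0` the congruence condition is void and the product runs over all zeros of `W`.
    have h3 := prod_norm_pow_sub_pow_le norm_prime_padicComplex hζ (n := 0) (M := M)
      (Nat.zero_le _) (by omega) b
    rw [Finset.filter_true_of_mem fun u _ => by rw [pow_zero]; exact Nat.modEq_one, ← norm_prod,
      ← hWz, ← h2, Nat.sub_zero] at h3
    have h4 : (‖ζ - 1‖ ^ (p ^ M).totient) ^ M = (p : ℝ)⁻¹ ^ (N + 1) := by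
      have h5 := norm_sub_one_pow_totient norm_prime_padicComplex k.succ_ne_zero hζ
      rw [← prime_pow_mul_totient (p := p) (n := A) (M := k + 1) (by omega),
        show k + 1 - A = M by omega] at h5
      rw [← h5, ← pow_mul, ← pow_mul]
      congr 1
      rw [hM]
      ring
    rw [h4] at h3
    rw [norm_mul]
    have h6 : (p : ℝ)⁻¹ ^ (N + 1) ≤ (p : ℝ)⁻¹ ^ N :=
      pow_le_pow_of_le_one prime_inv_pos.le prime_inv_lt_one.le N.le_succ
    calc _ ≤ ε / (supNorm p d (T f) + 1) * (supNorm p d (T f) + 1) := by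
          refine mul_le_mul (h3.trans (h6.trans hN.le)) ?_ (norm_nonneg _) (div_pos hε hTf).le
          linarith [norm_apply_le_supNorm (T f) x]
      _ = ε := div_mul_cancel₀ _ hTf.ne'

end Separation

/-! ### Intertwining operators from invariant functionals -/

section IntertwinerOfFunctional

open Filter Topology

variable {p : ℕ} [hp : Fact p.Prime] {d : ℕ} {ψ : SmoothCharacter p}

theorem omega_eq_neg_dotProduct (w w' : Fin d ⊕ Fin d → ℚ_[p]) :
    omega w w' = -(w ⬝ᵥ (Matrix.J (Fin d) ℚ_[p] *ᵥ w')) := by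
  have h1 : Matrix.J (Fin d) ℚ_[p] *ᵥ w' = Sum.elim (-sndPart w') (fstPart w') := by
    conv_lhs => rw [Matrix.J, ← Sum.elim_comp_inl_inr w', Matrix.fromBlocks_mulVec]
    ext i
    rcases i with i | i <;> simp [fstPart, sndPart, Matrix.neg_mulVec]
  have h2 : w = Sum.elim (fstPart w) (sndPart w) := (Sum.elim_comp_inl_inr w).symm
  rw [h1]
  conv_rhs => rw [h2]
  rw [sumElim_dotProduct_sumElim, omega, dotProduct_neg]
  ring

theorem omega_vecMul (g : Matrix.symplecticGroup (Fin d) ℚ_[p]) (w w' : Fin d ⊕ Fin d → ℚ_[p]) :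
    omega (w ᵥ* g.1) (w' ᵥ* g.1) = omega w w' := by
  have h := SymplecticGroup.mem_iff.1 g.2
  rw [omega_eq_neg_dotProduct, omega_eq_neg_dotProduct, ← Matrix.mulVec_transpose g.1 w',
    Matrix.mulVec_mulVec, ← Matrix.dotProduct_mulVec, Matrix.mulVec_mulVec, ← mul_assoc, h]

theorem Heisenberg.act_mul_left (g : Matrix.symplecticGroup (Fin d) ℚ_[p]) (h k : Heisenberg p d) :
    (h * k).act g.1 = h.act g.1 * k.act g.1 := by
  ext1
  · simp [Heisenberg.act, Matrix.add_vecMul]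
  · simp [Heisenberg.act, omega_vecMul]

theorem norm_dotProduct_le (a b : Fin d → ℚ_[p]) : ‖a ⬝ᵥ b‖ ≤ ‖a‖ * ‖b‖ := by
  refine norm_sum_le_of_forall _ _ (by positivity) fun i _ => ?_
  rw [norm_mul]
  exact mul_le_mul (norm_le_pi_norm a i) (norm_le_pi_norm b i) (norm_nonneg _) (norm_nonneg _)

theorem norm_fstPart_le (w : Fin d ⊕ Fin d → ℚ_[p]) : ‖fstPart w‖ ≤ ‖w‖ :=
  (pi_norm_le_iff_of_nonneg (norm_nonneg _)).2 fun i => norm_le_pi_norm w (Sum.inl i)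

theorem norm_sndPart_le (w : Fin d ⊕ Fin d → ℚ_[p]) : ‖sndPart w‖ ≤ ‖w‖ :=
  (pi_norm_le_iff_of_nonneg (norm_nonneg _)).2 fun i => norm_le_pi_norm w (Sum.inr i)

/-- Smoothness of the Schrödinger representation. -/
theorem eventually_schrodinger_eq (f : Schwartz p d) :
    ∀ᶠ w : Fin d ⊕ Fin d → ℚ_[p] in 𝓝 0, schrodinger ψ d ⟨w, 0⟩ f = f := by
  have hp0 : (0 : ℝ) < p := by exact_mod_cast hp.out.pos
  obtain ⟨n, hn⟩ := exists_level f
  obtain ⟨m, hm⟩ := exists_forall_norm_gt_eq_zero f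
  obtain ⟨k, hk⟩ := ψ.exists_eq_one_of_norm_le
  replace hn := hn n le_rfl
  replace hm := hm m le_rfl
  have hball : ∀ r : ℝ, 0 < r → ∀ᶠ w : Fin d ⊕ Fin d → ℚ_[p] in 𝓝 0, ‖w‖ < r := fun r hr => by
    filter_upwards [Metric.ball_mem_nhds (0 : Fin d ⊕ Fin d → ℚ_[p]) hr] with w hw
    simpa using hw
  have hk0 : (0 : ℝ) < (p : ℝ)⁻¹ ^ k := pow_pos prime_inv_pos _
  have hc : (0 : ℝ) < ‖(1 / 2 : ℚ_[p])‖ := norm_pos_iff.2 (by norm_num)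
  have hpm : (0 : ℝ) < (p : ℝ) ^ m := pow_pos hp0 _
  filter_upwards [hball 1 one_pos, hball _ (pow_pos (prime_inv_pos (p := p)) n),
    hball _ (div_pos hk0 hc), hball _ (div_pos hk0 hpm)] with w h1 h2 h3 h4
  rw [lt_div_iff₀ hc] at h3
  rw [lt_div_iff₀ hpm] at h4
  ext x
  rw [schrodinger_apply, hn (x + fstPart w) x (by
    rw [add_sub_cancel_left]
    exact (norm_fstPart_le w).trans h2.le)]
  by_cases hx : ‖x‖ ≤ (p : ℝ) ^ m
  · rw [hk, one_mul]
    refine norm_add_le_of_le_of_le ?_ ?_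
    · rw [zero_add, norm_mul]
      calc _ ≤ ‖(1 / 2 : ℚ_[p])‖ * (‖w‖ * 1) := by
            refine mul_le_mul_of_nonneg_left ?_ hc.le
            exact (norm_dotProduct_le _ _).trans (mul_le_mul (norm_fstPart_le w)
              ((norm_sndPart_le w).trans h1.le) (norm_nonneg _) (norm_nonneg _))
        _ ≤ _ := by linarith
    · exact (norm_dotProduct_le _ _).trans ((mul_le_mul (norm_sndPart_le w) hx (norm_nonneg _)
        (norm_nonneg _)).trans h4.le)
  · rw [hm x (not_le.1 hx), mul_zero]

theorem schrodinger_center (t : ℚ_[p]) (f : Schwartz p d) :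
    schrodinger ψ d ⟨0, t⟩ f = ψ.toAddChar t • f := by
  ext x
  rw [schrodinger_apply]
  simp

theorem schrodinger_mul_apply (h k : Heisenberg p d) (f : Schwartz p d) :
    schrodinger ψ d (h * k) f = schrodinger ψ d h (schrodinger ψ d k f) := by
  rw [map_mul]
  rfl

variable (ψ) in
/-- The functions `x ↦ l (ρ([(x, 0) g, 0]) f)` attached to a linear functional `l`. -/
noncomputable def coefficientFun (g : Matrix.symplecticGroup (Fin d) ℚ_[p])
    (l : Schwartz p d →ₗ[ℂ_[p]] ℂ_[p]) (f : Schwartz p d) (x : Fin d → ℚ_[p]) : ℂ_[p] :=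
  l (schrodinger ψ d (Heisenberg.act ⟨Sum.elim x 0, 0⟩ g.1) f)

theorem elim_mul_elim (x y : Fin d → ℚ_[p]) :
    (⟨Sum.elim x 0, 0⟩ * ⟨Sum.elim y 0, 0⟩ : Heisenberg p d) = ⟨Sum.elim (x + y) 0, 0⟩ := by
  ext1
  · ext i
    rcases i with i | i <;> simp
  · have h1 : ∀ x : Fin d → ℚ_[p], fstPart (Sum.elim x (0 : Fin d → ℚ_[p])) = x := fun _ => rfl
    have h2 : ∀ x : Fin d → ℚ_[p], sndPart (Sum.elim x (0 : Fin d → ℚ_[p])) = 0 := fun _ => rfl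
    simp [omega, h1, h2]

/-- Moving the `(0, b)` part to the left, where the invariant functional absorbs it, leaves exactly
the translation and the central phase of the Schrödinger formula. -/
theorem elim_zero_mul_heisenberg (x : Fin d → ℚ_[p]) (h : Heisenberg p d) :
    (⟨Sum.elim x 0, 0⟩ * h : Heisenberg p d) =
      ⟨Sum.elim 0 (sndPart h.w), 0⟩ * ⟨Sum.elim (x + fstPart h.w) 0, 0⟩ *
        ⟨0, h.t + 1 / 2 * (fstPart h.w ⬝ᵥ sndPart h.w) + sndPart h.w ⬝ᵥ x⟩ := by
  have h1 : ∀ x y : Fin d → ℚ_[p], fstPart (Sum.elim x y) = x := fun _ _ => rfl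
  have h2 : ∀ x y : Fin d → ℚ_[p], sndPart (Sum.elim x y) = y := fun _ _ => rfl
  ext1
  · ext i
    rcases i with i | i <;> simp [fstPart, sndPart]
  · simp only [Heisenberg.mul_t, Heisenberg.mul_w, omega, h1, h2, fstPart_add, sndPart_add,
      fstPart_zero, sndPart_zero, zero_dotProduct, dotProduct_zero, dotProduct_add]
    rw [dotProduct_comm x, dotProduct_comm (fstPart h.w)]
    ring

section

variable {g : Matrix.symplecticGroup (Fin d) ℚ_[p]} {l : Schwartz p d →ₗ[ℂ_[p]] ℂ_[p]}

theorem coefficientFun_schrodinger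
    (hl : ∀ b f, l (schrodinger ψ d (Heisenberg.act ⟨Sum.elim 0 b, 0⟩ g.1) f) = l f)
    (h : Heisenberg p d) (f : Schwartz p d) (x : Fin d → ℚ_[p]) :
    coefficientFun ψ g l (schrodinger ψ d (h.act g.1) f) x =
      ψ.toAddChar (h.t + 1 / 2 * (fstPart h.w ⬝ᵥ sndPart h.w) + sndPart h.w ⬝ᵥ x) *
        coefficientFun ψ g l f (x + fstPart h.w) := by
  rw [coefficientFun, ← schrodinger_mul_apply, ← Heisenberg.act_mul_left,
    elim_zero_mul_heisenberg, Heisenberg.act_mul_left, Heisenberg.act_mul_left,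
    schrodinger_mul_apply, schrodinger_mul_apply, hl]
  have h1 : ∀ t : ℚ_[p], (⟨0, t⟩ : Heisenberg p d).act g.1 = ⟨0, t⟩ := fun t => by
    simp [Heisenberg.act]
  rw [h1, schrodinger_center, map_smul, map_smul, smul_eq_mul]
  rfl

/-- Both properties come from smoothness: local constancy from small elements `(y, 0) g` fixing `f`,
compact support from small elements `(0, b) g` fixing `f`. -/
theorem coefficientFun_mem (hψ : ψ.toAddChar ≠ 1)
    (hl : ∀ b f, l (schrodinger ψ d (Heisenberg.act ⟨Sum.elim 0 b, 0⟩ g.1) f) = l f)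
    (f : Schwartz p d) : coefficientFun ψ g l f ∈ Schwartz p d := by
  have hcont : ∀ L : (Fin d → ℚ_[p]) →ₗ[ℚ_[p]] (Fin d ⊕ Fin d → ℚ_[p]),
      ∀ᶠ y in 𝓝 (0 : Fin d → ℚ_[p]), schrodinger ψ d ⟨L y ᵥ* g.1, 0⟩ f = f := by
    intro L
    have h1 : Tendsto (fun y => (Matrix.vecMulLinear g.1 ∘ₗ L) y) (𝓝 0) (𝓝 0) := by
      have := (LinearMap.continuous_on_pi (Matrix.vecMulLinear g.1 ∘ₗ L)).tendsto 0
      rwa [map_zero] at this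
    exact h1.eventually (eventually_schrodinger_eq f)
  refine ⟨?_, ?_⟩
  · rw [IsLocallyConstant.iff_eventually_eq]
    intro x
    have h1 := hcont
      { toFun := fun y => Sum.elim y (0 : Fin d → ℚ_[p])
        map_add' := fun y z => by ext i; rcases i with i | i <;> simp
        map_smul' := fun c y => by ext i; rcases i with i | i <;> simp }
    have h2 : Tendsto (fun y : Fin d → ℚ_[p] => y - x) (𝓝 x) (𝓝 0) := by
      have : Continuous fun y : Fin d → ℚ_[p] => y - x := continuous_id.sub continuous_const
      simpa using this.tendsto x
    filter_upwards [h2.eventually h1] with y hy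
    have h3 : (⟨Sum.elim y 0, 0⟩ : Heisenberg p d) =
        ⟨Sum.elim x 0, 0⟩ * ⟨Sum.elim (y - x) 0, 0⟩ := by
      rw [elim_mul_elim, add_sub_cancel]
    rw [coefficientFun, h3, Heisenberg.act_mul_left, schrodinger_mul_apply]
    exact congrArg _ (congrArg _ hy)
  · have h1 := hcont
      { toFun := fun y => Sum.elim (0 : Fin d → ℚ_[p]) y
        map_add' := fun y z => by ext i; rcases i with i | i <;> simp
        map_smul' := fun c y => by ext i; rcases i with i | i <;> simp }
    obtain ⟨r, hr, h2⟩ := Metric.eventually_nhds_iff.1 h1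
    obtain ⟨t, ht⟩ := AddChar.ne_one_iff.1 hψ
    refine HasCompactSupport.intro (isCompact_closedBall (0 : Fin d → ℚ_[p]) (‖t‖ / r))
      fun x hx => ?_
    by_contra hne
    refine hx ?_
    rw [mem_closedBall_zero_iff, pi_norm_le_iff_of_nonneg (by positivity)]
    intro i
    by_contra! hi
    have hxi : 0 < ‖x i‖ := lt_of_le_of_lt (by positivity) hi
    rw [div_lt_iff₀ hr] at hi
    -- Chosen so that `b · x = t`. For large `x i` this `b` is small and fixes `f`, so the value at
    -- `x` equals `ψ(t) ≠ 1` times itself.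
    set b : Fin d → ℚ_[p] := Pi.single i (t / x i) with hb
    have hbr : ‖b‖ < r := by
      rw [hb, Pi.norm_single, norm_div, div_lt_iff₀ hxi, mul_comm]
      exact hi
    have h3 := h2 (y := b) (by simpa using hbr)
    have h4 := coefficientFun_schrodinger hl ⟨Sum.elim 0 b, 0⟩ f x
    have h5 : schrodinger ψ d (Heisenberg.act ⟨Sum.elim 0 b, 0⟩ g.1) f = f := h3
    have h6 : fstPart (Sum.elim (0 : Fin d → ℚ_[p]) b) = 0 := rfl
    have h7 : sndPart (Sum.elim (0 : Fin d → ℚ_[p]) b) = b := rfl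
    have h8 : b ⬝ᵥ x = t := by
      rw [hb, single_dotProduct, div_mul_cancel₀ _ (norm_pos_iff.1 hxi)]
    rw [h5, h6, h7, h8, zero_dotProduct, mul_zero, add_zero, zero_add, add_zero] at h4
    exact ht (mul_right_cancel₀ hne (by rw [one_mul]; exact h4.symm))

/-- A nonzero functional invariant under the Lagrangian subspace `(0 ⊕ ℚ_p^d) g` gives an
intertwining operator for `g`. -/
theorem exists_isIntertwining_of_functional (hψ : ψ.toAddChar ≠ 1) (hl0 : l ≠ 0)
    (hl : ∀ b f, l (schrodinger ψ d (Heisenberg.act ⟨Sum.elim 0 b, 0⟩ g.1) f) = l f) :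
    ∃ T, IsIntertwining ψ g T := by
  let T : Schwartz p d →ₗ[ℂ_[p]] Schwartz p d :=
    { toFun := fun f => ⟨coefficientFun ψ g l f, coefficientFun_mem hψ hl f⟩
      map_add' := fun f f' => by
        ext x
        simp [coefficientFun]
      map_smul' := fun c f => by
        ext x
        simp [coefficientFun] }
  have hT : ∀ h f, schrodinger ψ d h (T f) = T (schrodinger ψ d (h.act g.1) f) := by
    intro h f
    ext x
    exact (coefficientFun_schrodinger hl h f x).symm
  have hT' : ∀ h f, schrodinger ψ d (h.act g⁻¹.1) (T f) = T (schrodinger ψ d h f) := by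
    intro h f
    have h2 : g⁻¹.1 * g.1 = 1 := congrArg Subtype.val (inv_mul_cancel g)
    rw [hT, ← Heisenberg.act_mul, h2, Heisenberg.act_one]
  have hT0 : ∀ f, (T f).1 0 = l f := by
    intro f
    change l (schrodinger ψ d (Heisenberg.act ⟨Sum.elim 0 0, 0⟩ g.1) f) = l f
    have h1 : (⟨Sum.elim 0 0, 0⟩ : Heisenberg p d) = 1 := by
      ext i
      · rcases i with i | i <;> rfl
      · rfl
    have h2 : (1 : Heisenberg p d).act g.1 = 1 := by
      ext1
      · simp [Heisenberg.act]
      · rfl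
    rw [h1, h2, map_one]
    rfl
  obtain ⟨f₀, hf₀⟩ : ∃ f, l f ≠ 0 := by
    by_contra! h
    exact hl0 (LinearMap.ext h)
  have hTf₀ : T f₀ ≠ 0 := fun h => hf₀ (by rw [← hT0, h]; rfl)
  -- Kernel and range of `T` are stable under the Heisenberg group, so irreducibility makes the
  -- nonzero map `T` bijective.
  have hker : LinearMap.ker T = ⊥ := by
    by_contra hne
    have := eq_top_of_invariant hψ (W := LinearMap.ker T) (fun h f hf => by
      rw [LinearMap.mem_ker] at hf ⊢
      rw [← hT', hf, map_zero]) hne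
    exact hTf₀ (LinearMap.mem_ker.1 (this ▸ Submodule.mem_top))
  have hrange : LinearMap.range T = ⊤ := by
    refine eq_top_of_invariant hψ ?_ ?_
    · rintro h _ ⟨f, rfl⟩
      exact ⟨_, (hT h f).symm⟩
    · intro h
      exact hTf₀ ((Submodule.mem_bot _).1 (h ▸ LinearMap.mem_range_self T f₀))
  exact ⟨LinearEquiv.ofBijective T ⟨LinearMap.ker_eq_bot.1 hker, LinearMap.range_eq_top.1 hrange⟩,
    hT⟩

end

end IntertwinerOfFunctional

/-! ### Intertwiners for the Siegel parabolic and for partial Weyl elements -/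

section IntertwinerExistence

variable {p : ℕ} [hp : Fact p.Prime] {d : ℕ} {ψ : SmoothCharacter p}

theorem fstPart_vecMul_elim_zero (g : Matrix (Fin d ⊕ Fin d) (Fin d ⊕ Fin d) ℚ_[p])
    (b : Fin d → ℚ_[p]) : fstPart (Sum.elim 0 b ᵥ* g) = b ᵥ* g.toBlocks₂₁ := by
  ext j
  simp [fstPart, Matrix.vecMul, dotProduct, Matrix.toBlocks₂₁]

theorem sndPart_vecMul_elim_zero (g : Matrix (Fin d ⊕ Fin d) (Fin d ⊕ Fin d) ℚ_[p])
    (b : Fin d → ℚ_[p]) : sndPart (Sum.elim 0 b ᵥ* g) = b ᵥ* g.toBlocks₂₂ := by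
  ext j
  simp [sndPart, Matrix.vecMul, dotProduct, Matrix.toBlocks₂₂]

theorem exists_isIntertwining_of_mem_siegelParabolic (hψ : ψ.toAddChar ≠ 1)
    {g : Matrix.symplecticGroup (Fin d) ℚ_[p]} (hg : g ∈ siegelParabolic p d) :
    ∃ T, IsIntertwining ψ g T := by
  refine exists_isIntertwining_of_functional hψ
    (l := { toFun := fun f => f.1 0, map_add' := fun _ _ => rfl, map_smul' := fun _ _ => rfl })
    (fun h => ?_) fun b f => ?_
  · have h1 := LinearMap.congr_fun h (intIndicator p d)
    have h2 : (intIndicator p d).1 0 = 1 := Set.indicator_of_mem (by simp) _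
    exact one_ne_zero (h2.symm.trans h1)
  · have hg' : g.1.toBlocks₂₁ = 0 := hg
    change (schrodinger ψ d _ f).1 0 = f.1 0
    have h1 : fstPart (Heisenberg.act ⟨Sum.elim 0 b, 0⟩ g.1).w = 0 := by
      rw [Heisenberg.act, fstPart_vecMul_elim_zero, hg', Matrix.vecMul_zero]
    rw [schrodinger_apply, h1]
    simp [Heisenberg.act]

/-- The Weyl element exchanging the coordinates where the `0`-`1` vector `e` is `1`. -/
noncomputable def partialWeyl (e : Fin d → ℚ_[p]) :
    Matrix (Fin d ⊕ Fin d) (Fin d ⊕ Fin d) ℚ_[p] :=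
  Matrix.fromBlocks (Matrix.diagonal (1 - e)) (-Matrix.diagonal e) (Matrix.diagonal e)
    (Matrix.diagonal (1 - e))

theorem partialWeyl_mem {e : Fin d → ℚ_[p]} (he : e * e = e) :
    partialWeyl e ∈ Matrix.symplecticGroup (Fin d) ℚ_[p] := by
  have he' : ∀ i, e i * e i = e i := fun i => congrFun he i
  rw [SymplecticGroup.mem_iff, partialWeyl, Matrix.J, Matrix.fromBlocks_transpose,
    Matrix.fromBlocks_multiply, Matrix.fromBlocks_multiply]
  simp only [Matrix.diagonal_transpose, mul_zero, zero_add, add_zero,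
    mul_one, mul_neg, neg_mul, neg_neg, Matrix.diagonal_mul_diagonal, Matrix.diagonal_neg,
    Matrix.diagonal_add]
  rw [← Matrix.diagonal_one, ← Matrix.diagonal_zero, Matrix.diagonal_neg]
  congr 2 <;> ext i <;> have := he' i <;> simp only [Pi.sub_apply, Pi.one_apply] <;> grind

theorem partialWeyl_mul {e e' : Fin d → ℚ_[p]} (h : e * e' = 0) :
    partialWeyl e * partialWeyl e' = partialWeyl (e + e') := by
  have he' : ∀ i, e i * e' i = 0 := fun i => congrFun h i
  rw [partialWeyl, partialWeyl, partialWeyl, Matrix.fromBlocks_multiply]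
  simp only [mul_neg, neg_mul, Matrix.diagonal_mul_diagonal, Matrix.diagonal_neg,
    Matrix.diagonal_add]
  congr 2 <;> ext i <;> have := he' i <;>
    simp only [Pi.sub_apply, Pi.one_apply, Pi.add_apply] <;> grind

theorem sum_range_add_of_periodic {G : ℕ → ℂ_[p]} {P : ℕ} (hG : ∀ j, G (j + P) = G j) (a : ℕ) :
    ∑ j ∈ Finset.range P, G (j + a) = ∑ j ∈ Finset.range P, G j := by
  induction a with
  | zero => rfl
  | succ a ih =>
    rw [← ih]
    have h1 := Finset.sum_range_succ (fun j => G (j + a)) P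
    have h2 := Finset.sum_range_succ' (fun j => G (j + a)) P
    rw [h1, add_comm P a, hG a] at h2
    simp only [zero_add] at h2
    rw [← add_right_cancel h2.symm]
    exact Finset.sum_congr rfl fun j _ => by rw [add_right_comm, add_assoc]

variable (p) in
/-- Up to a scalar, the integral over the ball of radius `p ^ n` of a function that is constant on
the cosets of the ball of radius `p ^ (-n)`. -/
noncomputable def lineSum (n : ℕ) (F : ℚ_[p] → ℂ_[p]) : ℂ_[p] :=
  ∑ j ∈ Finset.range (p ^ (n + n)), F (j / (p : ℚ_[p]) ^ n)

theorem lineSum_add_right {n : ℕ} {F : ℚ_[p] → ℂ_[p]}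
    (hF : ∀ x y, ‖x - y‖ ≤ (p : ℝ)⁻¹ ^ n → F x = F y) {t : ℚ_[p]} (ht : ‖t‖ ≤ (p : ℝ) ^ n) :
    lineSum p n (fun s => F (s + t)) = lineSum p n F := by
  have hp0 : (0 : ℝ) < p := by exact_mod_cast hp.out.pos
  have hpn : (p : ℚ_[p]) ^ n ≠ 0 := pow_ne_zero _ prime_ne_zero_padic
  have hpn' : (0 : ℝ) < (p : ℝ)⁻¹ ^ n := pow_pos prime_inv_pos _
  obtain ⟨a, -, ha⟩ := exists_nat_norm_sub_le (x := t * (p : ℚ_[p]) ^ n) (by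
    rw [norm_mul, norm_prime_pow, inv_pow, ← div_eq_mul_inv]
    exact (div_le_one (pow_pos hp0 _)).2 ht) (n + n)
  have hG : ∀ x y : ℚ_[p], ‖x - y‖ ≤ (p : ℝ)⁻¹ ^ (n + n) →
      F (x / (p : ℚ_[p]) ^ n) = F (y / (p : ℚ_[p]) ^ n) := by
    intro x y hxy
    refine hF _ _ ?_
    rw [← sub_div, norm_div, norm_prime_pow, div_le_iff₀ hpn', ← pow_add]
    exact hxy
  have h1 := sum_range_add_of_periodic (p := p) (P := p ^ (n + n))
    (G := fun j => F ((j : ℚ_[p]) / (p : ℚ_[p]) ^ n)) (fun j => hG _ _ (by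
      rw [Nat.cast_add, add_sub_cancel_left, Nat.cast_pow, norm_prime_pow])) a
  rw [lineSum, lineSum, ← h1]
  refine Finset.sum_congr rfl fun j _ => ?_
  rw [← hG (j + t * (p : ℚ_[p]) ^ n) ((j + a : ℕ) : ℚ_[p]) (by
    rw [Nat.cast_add, add_sub_add_left_eq_sub]
    exact ha), add_div, mul_div_cancel_right₀ _ hpn]

theorem lineSum_indicator_ne_zero (n : ℕ) :
    lineSum p n (fun s => if ‖s‖ ≤ 1 then 1 else 0) ≠ 0 := by
  have hpn' : (0 : ℝ) < (p : ℝ)⁻¹ ^ n := pow_pos prime_inv_pos _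
  rw [lineSum, Finset.sum_boole, Nat.cast_ne_zero]
  refine (Finset.card_pos.2 ⟨0, ?_⟩).ne'
  simp [hp.out.pos]

/-- The functional wanted is integration along the `i`-th axis. Unnormalised Riemann sums replace a
measure: each element of the span `V` of the differences `ρ f - f` is killed by all sums with `n`
large, while the indicator of `ℤ_p^d` is killed by none. So the indicator lies outside `V`, and a
functional vanishing on `V` but not on it exists. -/
theorem exists_isIntertwining_partialWeyl_single (hψ : ψ.toAddChar ≠ 1) (i : Fin d)
    {g : Matrix.symplecticGroup (Fin d) ℚ_[p]} (hg : g.1 = partialWeyl (Pi.single i 1)) :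
    ∃ T, IsIntertwining ψ g T := by
  have hfst : ∀ b : Fin d → ℚ_[p], fstPart (Sum.elim 0 b ᵥ* g.1) = Pi.single i (b i) := by
    intro b
    rw [fstPart_vecMul_elim_zero, hg, partialWeyl, Matrix.toBlocks_fromBlocks₂₁]
    ext j
    rw [Matrix.vecMul_diagonal]
    rcases eq_or_ne j i with rfl | h <;> simp [*]
  have hsnd : ∀ (b : Fin d → ℚ_[p]) (s : ℚ_[p]),
      sndPart (Sum.elim 0 b ᵥ* g.1) ⬝ᵥ Pi.single i s = 0 := by
    intro b s
    rw [sndPart_vecMul_elim_zero, hg, partialWeyl, Matrix.toBlocks_fromBlocks₂₂,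
      dotProduct_single, Matrix.vecMul_diagonal]
    simp
  have hρ : ∀ b f s, (schrodinger ψ d (Heisenberg.act ⟨Sum.elim 0 b, 0⟩ g.1) f).1 (Pi.single i s) =
      f.1 (Pi.single i (s + b i)) := by
    intro b f s
    rw [schrodinger_apply, Heisenberg.act]
    simp only [hfst, hsnd]
    rw [dotProduct_comm, hsnd, mul_zero, add_zero, add_zero, AddChar.map_zero_eq_one, one_mul,
      ← Pi.single_add]
  set V : Submodule ℂ_[p] (Schwartz p d) := Submodule.span ℂ_[p]
    {k | ∃ b f, k = schrodinger ψ d (Heisenberg.act ⟨Sum.elim 0 b, 0⟩ g.1) f - f} with hV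
  have hlin : ∀ n, ∃ Λ : Schwartz p d →ₗ[ℂ_[p]] ℂ_[p],
      ∀ f, Λ f = lineSum p n fun s => f.1 (Pi.single i s) := fun n =>
    ⟨{ toFun := fun f => lineSum p n fun s => f.1 (Pi.single i s)
       map_add' := fun f f' => Finset.sum_add_distrib
       map_smul' := fun c f => (Finset.mul_sum _ _ _).symm }, fun _ => rfl⟩
  choose Λ hΛ using hlin
  have hp1 : (1 : ℝ) < p := by exact_mod_cast hp.out.one_lt
  have hvan : ∀ k ∈ V, ∃ n₀, ∀ n ≥ n₀, Λ n k = 0 := by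
    intro k hk
    induction hk using Submodule.span_induction with
    | mem k hk =>
      obtain ⟨b, f, rfl⟩ := hk
      obtain ⟨n₁, hn₁⟩ := exists_level f
      obtain ⟨n₂, hn₂⟩ := pow_unbounded_of_one_lt ‖b i‖ hp1
      refine ⟨max n₁ n₂, fun n hn => ?_⟩
      rw [map_sub, sub_eq_zero, hΛ, hΛ]
      simp only [hρ]
      refine lineSum_add_right (F := fun s => f.1 (Pi.single i s)) (fun x y hxy => ?_) ?_
      · refine hn₁ n (le_trans (le_max_left _ _) hn) _ _ ?_
        rwa [← Pi.single_sub, Pi.norm_single]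
      · exact hn₂.le.trans (pow_le_pow_right₀ hp1.le (le_trans (le_max_right _ _) hn))
    | zero => exact ⟨0, fun n _ => map_zero _⟩
    | add k k' _ _ hk hk' =>
      obtain ⟨n₁, h₁⟩ := hk
      obtain ⟨n₂, h₂⟩ := hk'
      exact ⟨max n₁ n₂, fun n hn => by
        rw [map_add, h₁ n (le_trans (le_max_left _ _) hn),
          h₂ n (le_trans (le_max_right _ _) hn), add_zero]⟩
    | smul c k _ hk =>
      obtain ⟨n₁, h₁⟩ := hk
      exact ⟨n₁, fun n hn => by rw [map_smul, h₁ n hn, smul_zero]⟩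
  have hnot : intIndicator p d ∉ V := by
    intro h
    obtain ⟨n, hn⟩ := hvan _ h
    refine lineSum_indicator_ne_zero (p := p) n ?_
    have h0 := hn n le_rfl
    rw [hΛ] at h0
    refine (congrArg (lineSum p n) (funext fun s => Eq.symm ?_)).trans h0
    change Set.indicator {x : Fin d → ℚ_[p] | ∀ i, ‖x i‖ ≤ 1} 1 (Pi.single i s) = _
    rw [Set.indicator_apply]
    refine if_congr ?_ rfl rfl
    rw [Set.mem_ofPred_eq, ← pi_norm_le_iff_of_nonneg zero_le_one, Pi.norm_single]
  obtain ⟨l, hl1, hlV⟩ := Submodule.exists_le_ker_of_notMem hnot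
  refine exists_isIntertwining_of_functional hψ (l := l) ?_ fun b f => ?_
  · rintro rfl
    exact hl1 rfl
  · have := hlV (Submodule.subset_span ⟨b, f, rfl⟩)
    rwa [LinearMap.mem_ker, map_sub, sub_eq_zero] at this

theorem exists_isIntertwining_mul {g g' : Matrix.symplecticGroup (Fin d) ℚ_[p]}
    (h : ∃ T, IsIntertwining ψ g T) (h' : ∃ T, IsIntertwining ψ g' T) :
    ∃ T, IsIntertwining ψ (g * g') T := by
  obtain ⟨T, hT⟩ := h
  obtain ⟨T', hT'⟩ := h'
  exact ⟨_, hT.mul hT'⟩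

theorem exists_isIntertwining_inv {g : Matrix.symplecticGroup (Fin d) ℚ_[p]}
    (h : ∃ T, IsIntertwining ψ g T) : ∃ T, IsIntertwining ψ g⁻¹ T := by
  obtain ⟨T, hT⟩ := h
  exact ⟨_, hT.inv⟩

theorem exists_isIntertwining_partialWeyl (hψ : ψ.toAddChar ≠ 1) (s : Finset (Fin d))
    {g : Matrix.symplecticGroup (Fin d) ℚ_[p]}
    (hg : g.1 = partialWeyl fun i => if i ∈ s then 1 else 0) : ∃ T, IsIntertwining ψ g T := by
  classical
  induction s using Finset.induction_on generalizing g with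
  | empty =>
    refine exists_isIntertwining_of_mem_siegelParabolic hψ ?_
    change g.1.toBlocks₂₁ = 0
    rw [hg, partialWeyl, Matrix.toBlocks_fromBlocks₂₁]
    simp
  | insert a s ha ih =>
    have h1 : (fun i => if i ∈ s then (1 : ℚ_[p]) else 0) * (fun i => if i ∈ s then 1 else 0) =
        fun i => if i ∈ s then 1 else 0 := by
      ext i
      simp
    have h2 : (Pi.single a (1 : ℚ_[p]) : Fin d → ℚ_[p]) * Pi.single a 1 = Pi.single a 1 := by
      rw [← Pi.single_mul, one_mul]
    have h3 : g = ⟨_, partialWeyl_mem h2⟩ * ⟨_, partialWeyl_mem h1⟩ := by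
      refine Subtype.ext ?_
      change g.1 = partialWeyl _ * partialWeyl _
      rw [partialWeyl_mul, hg]
      · congr 1
        ext i
        rcases eq_or_ne i a with rfl | h <;> simp [*]
      · ext i
        rcases eq_or_ne i a with rfl | h <;> simp [*]
    rw [h3]
    exact exists_isIntertwining_mul (exists_isIntertwining_partialWeyl_single hψ a rfl) (ih rfl)

end IntertwinerExistence

/-! ### Generation of the symplectic group by intertwinable elements -/

section Generation

variable {p : ℕ} [hp : Fact p.Prime] {d : ℕ} {ψ : SmoothCharacter p}

theorem fromBlocks_mem_symplecticGroup_iff {A B C D : Matrix (Fin d) (Fin d) ℚ_[p]} :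
    Matrix.fromBlocks A B C D ∈ Matrix.symplecticGroup (Fin d) ℚ_[p] ↔
      A * Bᵀ = B * Aᵀ ∧ C * Dᵀ = D * Cᵀ ∧ A * Dᵀ - B * Cᵀ = 1 := by
  rw [SymplecticGroup.mem_iff, Matrix.J, Matrix.fromBlocks_transpose,
    Matrix.fromBlocks_multiply, Matrix.fromBlocks_multiply, Matrix.fromBlocks_inj]
  simp only [mul_zero, zero_add, add_zero, mul_one, mul_neg, neg_mul]
  constructor
  · rintro ⟨h1, h2, -, h4⟩
    refine ⟨?_, ?_, ?_⟩
    · rw [add_neg_eq_zero] at h1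
      exact h1.symm
    · rw [add_neg_eq_zero] at h4
      exact h4.symm
    · rw [← neg_inj, ← h2]
      abel
  · rintro ⟨h1, h2, h3⟩
    refine ⟨?_, ?_, ?_, ?_⟩
    · rw [h1, add_neg_cancel]
    · rw [← h3]
      abel
    · have h4 := congrArg Matrix.transpose h3
      simp only [Matrix.transpose_sub, Matrix.transpose_mul, Matrix.transpose_transpose,
        Matrix.transpose_one] at h4
      rw [← h4]
      abel
    · rw [h2, add_neg_cancel]

variable (ψ d) in
/-- The subgroup of the symplectic matrices that have an intertwining operator. -/
def intertwinableSubgroup : Subgroup (Matrix.symplecticGroup (Fin d) ℚ_[p]) where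
  carrier := {g | ∃ T, IsIntertwining ψ g T}
  one_mem' := ⟨LinearEquiv.refl _ _, fun h f => by simp [Heisenberg.act]⟩
  mul_mem' := exists_isIntertwining_mul
  inv_mem' := exists_isIntertwining_inv

theorem mem_intertwinableSubgroup_of_toBlocks₂₁_eq_zero (hψ : ψ.toAddChar ≠ 1)
    {g : Matrix.symplecticGroup (Fin d) ℚ_[p]} (hg : g.1.toBlocks₂₁ = 0) :
    g ∈ intertwinableSubgroup d ψ :=
  exists_isIntertwining_of_mem_siegelParabolic hψ hg

/-- The full Weyl element conjugates lower unipotents into upper ones, which lie in the Siegel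
parabolic. -/
theorem mem_intertwinableSubgroup_of_lowerUnipotent (hψ : ψ.toAddChar ≠ 1)
    {X : Matrix (Fin d) (Fin d) ℚ_[p]} (hX : Xᵀ = X)
    {g : Matrix.symplecticGroup (Fin d) ℚ_[p]} (hg : g.1 = Matrix.fromBlocks 1 0 X 1) :
    g ∈ intertwinableSubgroup d ψ := by
  set e : Fin d → ℚ_[p] := fun i => if i ∈ Finset.univ then 1 else 0 with he
  have he1 : e = 1 := by
    ext i
    simp [he]
  have hw : partialWeyl e = Matrix.fromBlocks 0 (-1) 1 0 := by
    rw [he1, partialWeyl, sub_self]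
    simp
  have hu : Matrix.fromBlocks 1 (-X) 0 1 ∈ Matrix.symplecticGroup (Fin d) ℚ_[p] :=
    fromBlocks_mem_symplecticGroup_iff.2 (by simp [hX])
  set w : Matrix.symplecticGroup (Fin d) ℚ_[p] :=
    ⟨partialWeyl e, partialWeyl_mem (by rw [he1, one_mul])⟩
  set u : Matrix.symplecticGroup (Fin d) ℚ_[p] := ⟨_, hu⟩
  have hww : w ∈ intertwinableSubgroup d ψ := exists_isIntertwining_partialWeyl hψ _ rfl
  have huu : u ∈ intertwinableSubgroup d ψ :=
    mem_intertwinableSubgroup_of_toBlocks₂₁_eq_zero hψ (Matrix.toBlocks_fromBlocks₂₁ ..)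
  have hgw : g * w = w * u := by
    refine Subtype.ext ?_
    change g.1 * partialWeyl e = partialWeyl e * Matrix.fromBlocks 1 (-X) 0 1
    rw [hg, hw, Matrix.fromBlocks_multiply, Matrix.fromBlocks_multiply]
    simp
  rw [← Subgroup.mul_mem_cancel_right _ hww, hgw]
  exact mul_mem hww huu

/-- Block elimination: left multiplication by the lower unipotent with block `-C A⁻¹` kills the
lower left block; that block is symmetric because `Aᵀ C` is. -/
theorem mem_intertwinableSubgroup_of_isUnit (hψ : ψ.toAddChar ≠ 1)
    {g : Matrix.symplecticGroup (Fin d) ℚ_[p]} (hg : IsUnit g.1.toBlocks₁₁) :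
    g ∈ intertwinableSubgroup d ψ := by
  obtain ⟨V, hAV, hVA⟩ := isUnit_iff_exists.1 hg
  have h := SymplecticGroup.transpose_mem g.2
  rw [← Matrix.fromBlocks_toBlocks g.1, Matrix.fromBlocks_transpose,
    fromBlocks_mem_symplecticGroup_iff] at h
  obtain ⟨h1, -, -⟩ := h
  simp only [Matrix.transpose_transpose] at h1
  set A := g.1.toBlocks₁₁
  set C := g.1.toBlocks₂₁
  have hAV' : Vᵀ * Aᵀ = 1 := by rw [← Matrix.transpose_mul, hAV, Matrix.transpose_one]
  have hX : (-(C * V))ᵀ = -(C * V) := by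
    rw [Matrix.transpose_neg, Matrix.transpose_mul]
    congr 1
    calc Vᵀ * Cᵀ = Vᵀ * (Cᵀ * A) * V := by rw [mul_assoc, mul_assoc, hAV, mul_one]
      _ = C * V := by rw [← h1, ← mul_assoc, hAV', one_mul]
  have hl : Matrix.fromBlocks 1 0 (-(C * V)) 1 ∈ Matrix.symplecticGroup (Fin d) ℚ_[p] :=
    fromBlocks_mem_symplecticGroup_iff.2 (by simp [hX])
  set l : Matrix.symplecticGroup (Fin d) ℚ_[p] := ⟨_, hl⟩
  have hll : l ∈ intertwinableSubgroup d ψ := mem_intertwinableSubgroup_of_lowerUnipotent hψ hX rfl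
  rw [← Subgroup.mul_mem_cancel_left _ hll]
  refine mem_intertwinableSubgroup_of_toBlocks₂₁_eq_zero hψ ?_
  change (Matrix.fromBlocks 1 0 (-(C * V)) 1 * g.1).toBlocks₂₁ = 0
  rw [← Matrix.fromBlocks_toBlocks g.1, Matrix.fromBlocks_multiply, Matrix.toBlocks_fromBlocks₂₁]
  change -(C * V) * A + 1 * C = 0
  rw [neg_mul, mul_assoc, hVA, mul_one, one_mul, neg_add_cancel]

/-- An upper unipotent with block `E`, the indicator of the zeros of `D`, turns the upper left block
into `D + E C`. A kernel vector `x` satisfies `D x = 0`, and symmetry of `D C` gives `C x = 0` as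
well; the symplectic relation then forces `x = 0`, so the previous case applies. -/
theorem mem_intertwinableSubgroup_of_toBlocks₁₁_eq_diagonal (hψ : ψ.toAddChar ≠ 1)
    {g : Matrix.symplecticGroup (Fin d) ℚ_[p]} {D : Fin d → ℚ_[p]}
    (hg : g.1.toBlocks₁₁ = Matrix.diagonal D) : g ∈ intertwinableSubgroup d ψ := by
  have h := SymplecticGroup.transpose_mem g.2
  rw [← Matrix.fromBlocks_toBlocks g.1, Matrix.fromBlocks_transpose,
    fromBlocks_mem_symplecticGroup_iff] at h
  classical
  obtain ⟨h1, -, h3⟩ := h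
  have h3 := congrArg Matrix.transpose h3
  simp only [Matrix.transpose_sub, Matrix.transpose_mul, Matrix.transpose_transpose,
    Matrix.transpose_one] at h1 h3
  set C := g.1.toBlocks₂₁
  rw [hg, Matrix.diagonal_transpose] at h1
  set E : Fin d → ℚ_[p] := fun i => if D i = 0 then 1 else 0 with hE
  have hu : Matrix.fromBlocks 1 (Matrix.diagonal E) 0 1 ∈
      Matrix.symplecticGroup (Fin d) ℚ_[p] :=
    fromBlocks_mem_symplecticGroup_iff.2 (by simp)
  set u : Matrix.symplecticGroup (Fin d) ℚ_[p] := ⟨_, hu⟩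
  have huu : u ∈ intertwinableSubgroup d ψ :=
    mem_intertwinableSubgroup_of_toBlocks₂₁_eq_zero hψ (Matrix.toBlocks_fromBlocks₂₁ ..)
  rw [← Subgroup.mul_mem_cancel_left _ huu]
  refine mem_intertwinableSubgroup_of_isUnit hψ ?_
  have hA : (u * g).1.toBlocks₁₁ = Matrix.diagonal D + Matrix.diagonal E * C := by
    change (Matrix.fromBlocks 1 (Matrix.diagonal E) 0 1 * g.1).toBlocks₁₁ = _
    rw [← Matrix.fromBlocks_toBlocks g.1, Matrix.fromBlocks_multiply,
      Matrix.toBlocks_fromBlocks₁₁, hg, one_mul]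
  rw [hA, ← Matrix.mulVec_injective_iff_isUnit]
  refine (injective_iff_map_eq_zero (Matrix.mulVecLin
    (Matrix.diagonal D + Matrix.diagonal E * C)).toAddMonoidHom).2 fun x hx => ?_
  have hx' : ∀ i, D i * x i + E i * (C *ᵥ x) i = 0 := by
    intro i
    have h := congrFun hx i
    change ((Matrix.diagonal D + Matrix.diagonal E * C) *ᵥ x) i = 0 at h
    rwa [Matrix.add_mulVec, ← Matrix.mulVec_mulVec, Pi.add_apply, Matrix.mulVec_diagonal,
      Matrix.mulVec_diagonal] at h
  have hx0 : ∀ i, D i ≠ 0 → x i = 0 := by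
    intro i hi
    have h := hx' i
    rw [hE] at h
    simpa [hi] using h
  have hCx : C *ᵥ x = 0 := by
    ext i
    by_cases hi : D i = 0
    · have h := hx' i
      rw [hE] at h
      simpa [hi] using h
    · change ∑ j, C i j * x j = 0
      refine Finset.sum_eq_zero fun j _ => ?_
      by_cases hj : D j = 0
      · have h := congrFun (congrFun h1 i) j
        rw [Matrix.diagonal_mul, Matrix.mul_diagonal, hj, mul_zero] at h
        rw [(mul_eq_zero.1 h).resolve_left hi, zero_mul]
      · rw [hx0 j hj, mul_zero]
  have hAx : g.1.toBlocks₁₁ *ᵥ x = 0 := by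
    rw [hg]
    ext i
    rw [Matrix.mulVec_diagonal, Pi.zero_apply, mul_eq_zero]
    exact or_iff_not_imp_left.2 (hx0 i)
  rw [← Matrix.one_mulVec x, ← h3, Matrix.sub_mulVec, ← Matrix.mulVec_mulVec,
    ← Matrix.mulVec_mulVec, hAx, hCx, Matrix.mulVec_zero, Matrix.mulVec_zero, sub_zero]

theorem exists_mem_intertwinableSubgroup_eq_levi (hψ : ψ.toAddChar ≠ 1)
    {U : Matrix (Fin d) (Fin d) ℚ_[p]} (hU : IsUnit U) :
    ∃ g ∈ intertwinableSubgroup d ψ, ∃ V, g.1 = Matrix.fromBlocks U 0 0 V := by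
  obtain ⟨V, hUV, -⟩ := isUnit_iff_exists.1 hU
  exact ⟨⟨Matrix.fromBlocks U 0 0 Vᵀ, fromBlocks_mem_symplecticGroup_iff.2 (by simp [hUV])⟩,
    mem_intertwinableSubgroup_of_toBlocks₂₁_eq_zero hψ (Matrix.toBlocks_fromBlocks₂₁ ..), _, rfl⟩

/-- Gaussian elimination by transvections, realised by Levi elements on both sides, makes the upper
left block diagonal. -/
theorem intertwinableSubgroup_eq_top (hψ : ψ.toAddChar ≠ 1) : intertwinableSubgroup d ψ = ⊤ := by
  refine eq_top_iff.2 fun g _ => ?_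
  obtain ⟨L, L', D, h⟩ :=
    Matrix.Pivot.exists_list_transvec_mul_mul_list_transvec_eq_diagonal g.1.toBlocks₁₁
  have hunit : ∀ L : List (Matrix.TransvectionStruct (Fin d) ℚ_[p]),
      IsUnit (L.map Matrix.TransvectionStruct.toMatrix).prod := fun L => by
    rw [Matrix.isUnit_iff_isUnit_det, Matrix.TransvectionStruct.det_toMatrix_prod]
    exact isUnit_one
  obtain ⟨u, hu, V, huV⟩ := exists_mem_intertwinableSubgroup_eq_levi hψ (hunit L)
  obtain ⟨u', hu', V', huV'⟩ := exists_mem_intertwinableSubgroup_eq_levi hψ (hunit L')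
  rw [← Subgroup.mul_mem_cancel_left _ hu, ← Subgroup.mul_mem_cancel_right _ hu']
  refine mem_intertwinableSubgroup_of_toBlocks₁₁_eq_diagonal hψ (D := D) ?_
  change (u.1 * g.1 * u'.1).toBlocks₁₁ = _
  rw [huV, huV', ← Matrix.fromBlocks_toBlocks g.1, Matrix.fromBlocks_multiply,
    Matrix.fromBlocks_multiply, Matrix.toBlocks_fromBlocks₁₁, ← h]
  simp

theorem isIntertwining_intertwiner (hψ : ψ.toAddChar ≠ 1)
    (g : Matrix.symplecticGroup (Fin d) ℚ_[p]) : IsIntertwining ψ g (intertwiner ψ g) :=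
  Classical.epsilon_spec (p := IsIntertwining ψ g)
    ((intertwinableSubgroup_eq_top hψ).ge (Subgroup.mem_top g))

end Generation

/-! ### Comparison of invariant norms -/

section Comparison

variable {p : ℕ} [hp : Fact p.Prime] {d : ℕ} {ψ : SmoothCharacter p}

theorem Dominated.trans {N₁ N₂ N₃ : Seminorm ℂ_[p] (Schwartz p d)} (h : Dominated N₁ N₂)
    (h' : Dominated N₂ N₃) : Dominated N₁ N₃ := by
  obtain ⟨D, hD, h⟩ := h
  obtain ⟨D', hD', h'⟩ := h'
  refine ⟨D * D', mul_pos hD hD', fun f => (h f).trans ?_⟩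
  rw [mul_assoc]
  exact mul_le_mul_of_nonneg_left (h' f) hD.le

theorem supNorm_apply_linearEquiv_pos (T : Schwartz p d ≃ₗ[ℂ_[p]] Schwartz p d)
    {f : Schwartz p d} (hf : f ≠ 0) : 0 < supNorm p d (T f) :=
  supNorm_pos (T.map_ne_zero_iff.2 hf)

theorem intIndicator_ne_zero : intIndicator p d ≠ 0 := by
  intro h
  have h1 : (intIndicator p d).1 0 = 1 := Set.indicator_of_mem (by simp) _
  rw [h] at h1
  exact zero_ne_one h1

theorem exists_grassmannianNorm_apply_eq (ψ : SmoothCharacter p) (α : Grassmannian p d) :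
    ∃ c : ℝ, 0 < c ∧ ∀ f, grassmannianNorm ψ α f =
      c * supNorm p d (intertwiner ψ (Quotient.out α) f) := by
  refine ⟨_, ?_, fun f => rfl⟩
  have h := supNorm_apply_linearEquiv_pos (intertwiner ψ (Quotient.out α))
    (intIndicator_ne_zero (p := p) (d := d))
  exact NNReal.coe_pos.2 (inv_pos.2 (Real.toNNReal_pos.2 h))

theorem isInvariantUltrametric_grassmannianNorm (hψ : ψ.toAddChar ≠ 1) (α : Grassmannian p d) :
    IsInvariantUltrametric ψ (grassmannianNorm ψ α) := by
  obtain ⟨c, hc, h⟩ := exists_grassmannianNorm_apply_eq ψ α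
  have hA := (isInvariantUltrametric_supNorm (p := p) (d := d) (ψ := ψ)).comp
    (isIntertwining_intertwiner hψ (Quotient.out α))
  refine ⟨fun f g => ?_, fun k f => ?_⟩
  · rw [h, h, h, ← mul_max_of_nonneg _ _ hc.le]
    exact mul_le_mul_of_nonneg_left (hA.add_le_max f g) hc.le
  · rw [h, h]
    exact congrArg (c * ·) (hA.invariant k f)

/-- Transport by `T_α` reduces to the separation statement for `g_β g_α⁻¹`, which is outside the
parabolic because the cosets differ. -/
theorem exists_grassmannianNorm_le (hψ : ψ.toAddChar ≠ 1) {α β : Grassmannian p d} (hαβ : α ≠ β)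
    (f : Schwartz p d) {ε : ℝ} (hε : 0 < ε) : ∃ u ∈ heisenbergRing ψ d,
      grassmannianNorm ψ α f ≤ grassmannianNorm ψ α (u f) ∧ grassmannianNorm ψ β (u f) ≤ ε := by
  obtain ⟨a, ha, hα⟩ := exists_grassmannianNorm_apply_eq ψ α
  obtain ⟨b, hb, hβ⟩ := exists_grassmannianNorm_apply_eq ψ β
  have hTα := isIntertwining_intertwiner hψ (Quotient.out α)
  have hTβ := isIntertwining_intertwiner hψ (Quotient.out β)
  set S := intertwiner ψ (Quotient.out α)
  set T := intertwiner ψ (Quotient.out β)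
  have hg : Quotient.out β * (Quotient.out α)⁻¹ ∉ siegelParabolic p d := fun h =>
    hαβ <| by
      rw [← Quotient.out_eq α, ← Quotient.out_eq β]
      exact Quotient.sound (QuotientGroup.rightRel_apply.2 h)
  obtain ⟨u', hu', h1, h2⟩ := exists_le_supNorm_and_supNorm_le hψ hg (hTβ.mul hTα.inv) (S f)
    (div_pos hε hb)
  obtain ⟨u, hu, h⟩ := hTα.exists_conj hu'
  refine ⟨u, hu, ?_, ?_⟩
  · rw [hα, hα, h]
    exact mul_le_mul_of_nonneg_left h1 ha.le
  · rw [← h, LinearEquiv.trans_apply, LinearEquiv.symm_apply_apply, le_div_iff₀' hb] at h2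
    rwa [hβ]

/-- The indices are treated one at a time: later operators do not increase the norms that are
already small. -/
theorem exists_forall_grassmannianNorm_le (hψ : ψ.toAddChar ≠ 1) {α : Grassmannian p d}
    {s : Finset (Grassmannian p d)} (hα : α ∉ s) (f : Schwartz p d) {ε : ℝ} (hε : 0 < ε) :
    ∃ u ∈ heisenbergRing ψ d, grassmannianNorm ψ α f ≤ grassmannianNorm ψ α (u f) ∧
      ∀ β ∈ s, grassmannianNorm ψ β (u f) ≤ ε := by
  classical
  induction s using Finset.induction_on with
  | empty => exact ⟨1, one_mem _, le_rfl, by simp⟩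
  | insert β s _ ih =>
    rw [Finset.mem_insert, not_or] at hα
    obtain ⟨u, hu, h1, h2⟩ := ih hα.2
    obtain ⟨v, hv, h3, h4⟩ := exists_grassmannianNorm_le hψ hα.1 (u f) hε
    refine ⟨v * u, mul_mem hv hu, h1.trans h3, fun γ hγ => ?_⟩
    rcases Finset.mem_insert.1 hγ with rfl | hγ
    · exact h4
    · exact ((isInvariantUltrametric_grassmannianNorm hψ γ).apply_le hv (u f)).trans (h2 γ hγ)

theorem maxNorm_apply_le {s : Finset (Grassmannian p d)} {f : Schwartz p d} {a : ℝ} (ha : 0 ≤ a)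
    (h : ∀ β ∈ s, grassmannianNorm ψ β f ≤ a) : maxNorm ψ s f ≤ a :=
  Seminorm.finset_sup_apply_le ha h

theorem grassmannianNorm_apply_le_maxNorm {s : Finset (Grassmannian p d)} {α : Grassmannian p d}
    (hα : α ∈ s) (f : Schwartz p d) : grassmannianNorm ψ α f ≤ maxNorm ψ s f :=
  Seminorm.le_finset_sup_apply hα

theorem subset_of_dominated (hψ : ψ.toAddChar ≠ 1) {I J : Finset (Grassmannian p d)}
    (h : Dominated (maxNorm ψ I) (maxNorm ψ J)) : I ⊆ J := by
  intro α hα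
  by_contra hαJ
  obtain ⟨D, hD, h⟩ := h
  obtain ⟨c, hc, hcα⟩ := exists_grassmannianNorm_apply_eq ψ α
  set f := intIndicator p d
  have hf : 0 < grassmannianNorm ψ α f := by
    rw [hcα]
    exact mul_pos hc (supNorm_apply_linearEquiv_pos _ intIndicator_ne_zero)
  have hε : 0 < grassmannianNorm ψ α f / (2 * D) := div_pos hf (by positivity)
  obtain ⟨u, -, h1, h2⟩ := exists_forall_grassmannianNorm_le hψ hαJ f hε
  have h3 := (h1.trans (grassmannianNorm_apply_le_maxNorm hα _)).trans <| (h (u f)).trans <|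
    mul_le_mul_of_nonneg_left (maxNorm_apply_le hε.le h2) hD.le
  have h4 : D * (grassmannianNorm ψ α f / (2 * D)) = grassmannianNorm ψ α f / 2 := by
    field_simp
  linarith

/-- If `‖·‖_α` is not dominated by `N`, every `g` is approximated in `‖·‖_α` by functions that are
small for `N` and for any finitely many of the other norms `‖·‖_β`. -/
theorem exists_approx_of_not_dominated (hψ : ψ.toAddChar ≠ 1)
    {N : Seminorm ℂ_[p] (Schwartz p d)} (hN : IsInvariantUltrametric ψ N)
    {α : Grassmannian p d} {s : Finset (Grassmannian p d)} (hα : α ∉ s)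
    (hαN : ¬ Dominated (grassmannianNorm ψ α) N) (g : Schwartz p d) {ε : ℝ} (hε : 0 < ε) :
    ∃ g', N g' ≤ ε ∧ grassmannianNorm ψ α (g' - g) ≤ ε ∧ ∀ β ∈ s, grassmannianNorm ψ β g' ≤ ε := by
  obtain ⟨c, hc, hcα⟩ := exists_grassmannianNorm_apply_eq ψ α
  have hT := isIntertwining_intertwiner hψ (Quotient.out α)
  set T := intertwiner ψ (Quotient.out α)
  have hpc : (p : ℂ_[p]) ≠ 0 := prime_ne_zero_padicComplex
  obtain ⟨m, hm⟩ : ∃ m : ℕ, ∀ x, ‖((p : ℂ_[p]) ^ m • T g).1 x‖ ≤ 1 := by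
    have h1 : (0 : ℝ) < supNorm p d (T g) + 1 :=
      add_pos_of_nonneg_of_pos (apply_nonneg _ _) one_pos
    obtain ⟨m, hm⟩ := exists_pow_lt_of_lt_one (inv_pos.2 h1) (prime_inv_lt_one (p := p))
    refine ⟨m, fun x => (norm_apply_le_supNorm _ x).trans ?_⟩
    rw [map_smul_eq_mul, norm_pow, norm_prime_padicComplex]
    calc (p : ℝ)⁻¹ ^ m * supNorm p d (T g)
        ≤ (supNorm p d (T g) + 1)⁻¹ * (supNorm p d (T g) + 1) :=
          mul_le_mul hm.le (le_add_of_nonneg_right zero_le_one) (apply_nonneg _ _)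
            (inv_pos.2 h1).le
      _ = 1 := inv_mul_cancel₀ h1.ne'
  set P : ℂ_[p] := ((p : ℂ_[p]) ^ 2) ^ d with hP
  have hq : 0 < ‖P * (p : ℂ_[p]) ^ m‖ :=
    norm_pos_iff.2 (mul_ne_zero (pow_ne_zero _ (pow_ne_zero _ hpc)) (pow_ne_zero _ hpc))
  set q := ‖P * (p : ℂ_[p]) ^ m‖ with hqdef
  -- The constant already accounts for the final division by `k`, whose norm is `q` times a value of
  -- size at least `‖T f‖_∞`.
  obtain ⟨f, hf⟩ : ∃ f, (ε * q * c⁻¹)⁻¹ * N f < grassmannianNorm ψ α f := by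
    by_contra! h
    exact hαN ⟨_, by positivity, h⟩
  rw [hcα, inv_mul_lt_iff₀ (by positivity)] at hf
  have hNf : N f < ε * q * supNorm p d (T f) := hf.trans_eq (by field_simp)
  have hTf : 0 < supNorm p d (T f) := by
    refine pos_of_mul_pos_right ((apply_nonneg N f).trans_lt hNf) (by positivity)
  obtain ⟨u, hu, h1, h2⟩ := exists_forall_grassmannianNorm_le hψ hα f
    (mul_pos (mul_pos hε hq) hTf)
  rw [hcα, hcα, mul_le_mul_iff_right₀ hc] at h1
  obtain ⟨x₀, hx₀⟩ := exists_norm_apply_eq_supNorm (T (u f))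
  -- Transitivity is applied at a point where `T (u f)` attains its maximum; `p^m` only makes the
  -- target integral.
  obtain ⟨v', hv', h3⟩ := exists_mem_heisenbergRing_near hψ (T (u f)) ((p : ℂ_[p]) ^ m • T g) x₀ hm
    (mul_pos (mul_pos (mul_pos hε hq) hTf) (inv_pos.2 hc))
  obtain ⟨v, hv, h4⟩ := hT.exists_conj hv'
  set l := (T (u f)).1 x₀
  have hl : supNorm p d (T f) ≤ ‖l‖ := h1.trans_eq hx₀.symm
  have hl0 : l ≠ 0 := norm_pos_iff.1 (hTf.trans_le hl)
  set k := l * (P * (p : ℂ_[p]) ^ m) with hk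
  have hk0 : k ≠ 0 := mul_ne_zero hl0 (norm_pos_iff.1 hq)
  have hkey : ∀ a b : ℝ, 0 ≤ b → a ≤ ε * q * supNorm p d (T f) * b → ‖k⁻¹‖ * a ≤ ε * b := by
    intro a b hb hab
    rw [norm_inv, inv_mul_le_iff₀ (norm_pos_iff.2 hk0), hk, norm_mul]
    refine hab.trans ?_
    calc ε * q * supNorm p d (T f) * b ≤ ε * q * ‖l‖ * b := by gcongr
      _ = ‖l‖ * q * (ε * b) := by ring
  refine ⟨k⁻¹ • v (u f), ?_, ?_, fun β hβ => ?_⟩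
  · rw [map_smul_eq_mul]
    refine (hkey _ 1 zero_le_one ?_).trans_eq (mul_one ε)
    rw [mul_one]
    exact ((hN.apply_le hv _).trans (hN.apply_le hu _)).trans hNf.le
  · have h5 : T (k⁻¹ • v (u f) - g) = k⁻¹ • (v' (T (u f)) - (l * P) • (p : ℂ_[p]) ^ m • T g) := by
      rw [map_sub, map_smul, h4, smul_sub, smul_smul (l * P), mul_assoc l, ← hk,
        inv_smul_smul₀ hk0]
    rw [hcα, h5, map_smul_eq_mul, ← le_div_iff₀' hc]
    exact hkey _ _ (inv_pos.2 hc).le h3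
  · rw [map_smul_eq_mul]
    refine (hkey _ 1 zero_le_one ?_).trans_eq (mul_one ε)
    rw [mul_one]
    exact ((isInvariantUltrametric_grassmannianNorm hψ β).apply_le hv _).trans (h2 β hβ)

/-- Subtract from `f` an approximation of it in `‖·‖_α` that is negligible for `N` and for the other
norms. The difference has nearly no `‖·‖_α`-norm, so the bound by `I` becomes a bound by the
remaining indices with the same constant. -/
theorem dominated_maxNorm_erase [DecidableEq (Grassmannian p d)] (hψ : ψ.toAddChar ≠ 1)
    {N : Seminorm ℂ_[p] (Schwartz p d)} (hN : IsInvariantUltrametric ψ N)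
    {α : Grassmannian p d} {I : Finset (Grassmannian p d)}
    (hαN : ¬ Dominated (grassmannianNorm ψ α) N) (h : Dominated N (maxNorm ψ I)) :
    Dominated N (maxNorm ψ (I.erase α)) := by
  obtain ⟨D, hD, h⟩ := h
  refine ⟨D, hD, fun f => le_of_forall_pos_le_add fun ε hε => ?_⟩
  have hδ : 0 < min ε (ε / D) := lt_min hε (div_pos hε hD)
  obtain ⟨g, h1, h2, h3⟩ := exists_approx_of_not_dominated hψ hN (Finset.notMem_erase α I) hαN f hδ
  set δ := min ε (ε / D)
  have hM : 0 ≤ maxNorm ψ (I.erase α) f := apply_nonneg _ _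
  have h4 : maxNorm ψ I (f - g) ≤ maxNorm ψ (I.erase α) f + ε / D := by
    refine maxNorm_apply_le (add_nonneg hM (div_pos hε hD).le) fun β hβ => ?_
    rcases eq_or_ne β α with rfl | hβα
    · rw [map_sub_rev]
      exact (h2.trans (min_le_right _ _)).trans (le_add_of_nonneg_left hM)
    · have hβ' := Finset.mem_erase.2 ⟨hβα, hβ⟩
      exact (map_sub_le_add _ f g).trans (add_le_add (grassmannianNorm_apply_le_maxNorm hβ' f)
        ((h3 β hβ').trans (min_le_right _ _)))
  have h5 : N (f - g) ≤ D * maxNorm ψ (I.erase α) f + ε := by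
    refine (h _).trans ((mul_le_mul_of_nonneg_left h4 hD.le).trans_eq ?_)
    rw [mul_add, mul_div_cancel₀ _ hD.ne']
  have h6 := hN.add_le_max (f - g) g
  rw [sub_add_cancel] at h6
  exact h6.trans (max_le h5 ((h1.trans (min_le_left _ _)).trans
    (le_add_of_nonneg_left (mul_nonneg hD.le hM))))

/-- Either `N` dominates every `‖·‖_α` with `α ∈ I`, and then it dominates their maximum, or an
index that it does not dominate can be erased. -/
theorem exists_subset_equivalent_maxNorm (hψ : ψ.toAddChar ≠ 1)
    {N : Seminorm ℂ_[p] (Schwartz p d)} (hN : IsInvariantUltrametric ψ N)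
    {I : Finset (Grassmannian p d)} (h : Dominated N (maxNorm ψ I)) :
    ∃ J ⊆ I, Equivalent N (maxNorm ψ J) := by
  classical
  induction I using Finset.strongInduction with
  | H I ih =>
    by_cases hI : ∀ α ∈ I, Dominated (grassmannianNorm ψ α) N
    · refine ⟨I, subset_rfl, h, ?_⟩
      choose! D hD hD' using hI
      have hpos : 0 ≤ ∑ α ∈ I, D α := Finset.sum_nonneg fun α hα => (hD α hα).le
      refine ⟨∑ α ∈ I, D α + 1, add_pos_of_nonneg_of_pos hpos one_pos, fun f => ?_⟩
      refine maxNorm_apply_le (mul_nonneg (add_nonneg hpos zero_le_one) (apply_nonneg _ _))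
        fun α hα => (hD' α hα f).trans (mul_le_mul_of_nonneg_right ?_ (apply_nonneg _ _))
      exact (Finset.single_le_sum (fun β hβ => (hD β hβ).le) hα).trans
        (le_add_of_nonneg_right zero_le_one)
    · push Not at hI
      obtain ⟨α, hα, hαN⟩ := hI
      obtain ⟨J, hJ, hJN⟩ := ih _ (Finset.erase_ssubset hα) (dominated_maxNorm_erase hψ hN hαN h)
      exact ⟨J, hJ.trans (Finset.erase_subset _ _), hJN⟩

theorem eq_of_equivalent_maxNorm (hψ : ψ.toAddChar ≠ 1) {N : Seminorm ℂ_[p] (Schwartz p d)}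
    {I J : Finset (Grassmannian p d)} (hI : Equivalent N (maxNorm ψ I))
    (hJ : Equivalent N (maxNorm ψ J)) : I = J :=
  (subset_of_dominated hψ (hI.2.trans hJ.1)).antisymm
    (subset_of_dominated hψ (hJ.2.trans hI.1))

end Comparison

end PadicHeis

theorem mainTheorem5 (p : ℕ) [Fact p.Prime] (d : ℕ) (hd : 1 ≤ d)
    (ψ : SmoothCharacter p) (hψ : ψ.toAddChar ≠ 1) :
    (∀ I J : Finset (Grassmannian p d), I ≠ J →
      ¬ Equivalent (maxNorm ψ I) (maxNorm ψ J)) ∧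
    (∀ (I : Finset (Grassmannian p d)) (N : Seminorm ℂ_[p] (Schwartz p d)),
      IsInvariantNorm ψ N → Dominated N (maxNorm ψ I) →
        ∃! J : Finset (Grassmannian p d), J ⊆ I ∧ Equivalent N (maxNorm ψ J)) ∧
    (∀ I₁ I₂ : Finset (Grassmannian p d), Disjoint I₁ I₂ →
      ¬ ∃ N : Seminorm ℂ_[p] (Schwartz p d), IsInvariantNorm ψ N ∧
        Dominated N (maxNorm ψ I₁) ∧ Dominated N (maxNorm ψ I₂)) := by
  refine ⟨fun I J hIJ h => hIJ ?_, fun I N hN h => ?_, ?_⟩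
  · exact (subset_of_dominated hψ h.1).antisymm (subset_of_dominated hψ h.2)
  · obtain ⟨J, hJ, hJN⟩ := exists_subset_equivalent_maxNorm hψ hN.isInvariantUltrametric h
    exact ⟨J, ⟨hJ, hJN⟩, fun K hK => eq_of_equivalent_maxNorm hψ hK.2 hJN⟩
  · rintro I₁ I₂ hI ⟨N, hN, h₁, h₂⟩
    obtain ⟨J₁, hJ₁, hN₁⟩ := exists_subset_equivalent_maxNorm hψ hN.isInvariantUltrametric h₁
    obtain ⟨J₂, hJ₂, hN₂⟩ := exists_subset_equivalent_maxNorm hψ hN.isInvariantUltrametric h₂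
    obtain rfl := eq_of_equivalent_maxNorm hψ hN₁ hN₂
    -- The common subset lies in both disjoint sets. Being dominated by the empty maximum, which is
    -- zero, `N` vanishes on a nonzero function.
    obtain rfl : J₁ = ∅ := Finset.subset_empty.1 (hI hJ₁ hJ₂)
    obtain ⟨D, -, hD⟩ := hN₁.1
    refine intIndicator_ne_zero (p := p) (d := d) (hN.eq_zero _ ?_)
    refine le_antisymm ((hD _).trans_eq ?_) (apply_nonneg _ _)
    rw [maxNorm, Finset.sup_empty]
    exact mul_zero D
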